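/- Let $(M,g_M)$ be a nonempty Riemannian manifold, let $(N,g_N,P)$ be a connected Kähler manifold (so $P^2=-I$, $g_N(P\cdot,P\cdot)=g_N$ and $\nabla^N P=0$ for the Levi-Civita connection $\nabla^N$), and let $F:M\to N$ be a Riemannian map of constant rank $r$ with $0<r<\min\{\dim M,\dim N\}$; that is, $F$ is smooth and $g_N(F_*X,F_*Y)=g_M(X,Y)$ for $X,Y\in(\ker F_*)^\perp$. Suppose that $F$ is semi-invariant: $\operatorname{range}F_*=D_1\oplus D_2$ with subbundles $D_1,D_2$ such that $P(D_1)=D_1$ and $P(D_2)\subseteq(\operatorname{range}F_*)^\perp$. Suppose that $\dim D_1>0$ and $\dim D_2>1$. Let $\bar D_1\subseteq(\ker F_*)^\perp$ be the distribution on $M$ with $F_*\bar D_1=D_1$. Suppose that $\operatorname{range}F_*$ is the restriction to the image of $F$ of a foliation of $N$ of rank $r$, i.e. there is a smooth involutive distribution on $N$, again denoted $\operatorname{range}F_*$, whose value at $F(q)$ is $F_*(T_qM)$ for all $q\in M$, and that $(\operatorname{range}F_*)^\perp$ is a totally geodesic foliation of $N$. Finally suppose that $F$ is Clairaut with $s=e^f$,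 where $f:N\to\mathbb R$ is smooth: for every geodesic $\beta$ of $N$ the function $s(\beta(t))\sin\theta(t)$ is constant, where $\theta(t)$ is the angle between $\dot\beta(t)$ and the component of $\dot\beta(t)$ in $(\operatorname{range}F_*)^\perp$ (with $\theta(t)=\pi/2$ if this component is $0$). For sections $W$ of $\operatorname{range}F_*$ and $V$ of $(\operatorname{range}F_*)^\perp$ along $F$, let $\phi W$, $\omega W$ be the components of $PW$, and $BV$, $CV$ the components of $PV$, in $\operatorname{range}F_*$ and $(\operatorname{range}F_*)^\perp$ respectively. Let $\nabla^F$ be the pullback of $\nabla^N$ to $F^{-1}TN$. For a vector $X$ on $M$ let $-S_VF_*X$ and $\nabla^{F\perp}_XV$ be the components of $\nabla^F_XV$ in $\operatorname{range}F_*$ and $(\operatorname{range}F_*)^\perp$. Let ${}^*F_*$ be the adjoint of $F_*$ and $\nabla^M$ the Levi-Civita connection of $M$. Then $N$ is locally a product manifold $N_{\operatorname{range}F_*}\times N_{(\operatorname{range}F_*)^\perp}$, meaning that $\operatorname{range}F_*$ and $(\operatorname{range}F_*)^\perp$ are both totally geodesic foliations of $N$, if and only if $$g_N\big(F_*(\nabla^M_X\,{}^*F_*\phi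 F_*X),BV\big)+g_N\big(\nabla^{F\perp}_X\,\omega F_*X,CV\big)+g_N\big(S_{CV}F_*X,\phi F_*X\big)=0$$ for all $X\in\Gamma(\bar D_1)$ and all smooth sections $V$ of $(\operatorname{range}F_*)^\perp$ along $F$. -/

import Mathlib

open Bundle Set Topology
open scoped Manifold ContDiff

noncomputable section

namespace Clairaut

/-! All manifolds are modelled on a finite-dimensional real vector space `E` (no boundary), and
Riemannian metrics are smooth families of inner products on the tangent spaces, in Mathlib's sense:
`[RiemannianBundle (TangentSpace 𝓘(ℝ, E))]` with `[IsContMDiffRiemannianBundle 𝓘(ℝ, E) ∞ E _]`. -/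

variable {E : Type*} [NormedAddCommGroup E] [NormedSpace ℝ E] [FiniteDimensional ℝ E]
  {M : Type*} [TopologicalSpace M] [ChartedSpace E M] [IsManifold 𝓘(ℝ, E) ∞ M]
  {E' : Type*} [NormedAddCommGroup E'] [NormedSpace ℝ E'] [FiniteDimensional ℝ E']
  {N : Type*} [TopologicalSpace N] [ChartedSpace E' N] [IsManifold 𝓘(ℝ, E') ∞ N]

instance instFiniteDimensionalTangent (x : M) :
    FiniteDimensional ℝ (TangentSpace 𝓘(ℝ, E) x) :=
  inferInstanceAs (FiniteDimensional ℝ E)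

/-! ### Sections and subbundles along a map -/

/-- `W` is a smooth section of the pullback bundle `F⁻¹TN` (a smooth vector field along `F`).
For `F = fun x => x` this says that `W` is a smooth vector field. -/
def IsSmoothAlong (F : M → N) (W : ∀ q, TangentSpace 𝓘(ℝ, E') (F q)) : Prop :=
  ContMDiff 𝓘(ℝ, E) 𝓘(ℝ, E').tangent ∞
    (fun q => (⟨F q, W q⟩ : TangentBundle 𝓘(ℝ, E') N))

/-- `D` is a smooth subbundle of rank `k` of `F⁻¹TN`. For `F = fun x => x` this says
that `D` is a smooth distribution of rank `k`. -/
def IsSubbundleAlong (F : M → N) (D : ∀ q, Submodule ℝ (TangentSpace 𝓘(ℝ, E') (F q)))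
    (k : ℕ) : Prop :=
  ∀ q₀ : M, ∃ U ∈ 𝓝 q₀, ∃ e : Fin k → ∀ q, TangentSpace 𝓘(ℝ, E') (F q),
    (∀ i, ContMDiffOn 𝓘(ℝ, E) 𝓘(ℝ, E').tangent ∞
      (fun q => (⟨F q, e i q⟩ : TangentBundle 𝓘(ℝ, E') N)) U) ∧
    ∀ q ∈ U, LinearIndependent ℝ (fun i => e i q) ∧
      Submodule.span ℝ (Set.range fun i => e i q) = D q

/-- `X` is a smooth section of `D ⊆ F⁻¹TN`, that is, `X ∈ Γ(D)`. -/
def IsSectionOf (F : M → N) (D : ∀ q, Submodule ℝ (TangentSpace 𝓘(ℝ, E') (F q)))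
    (X : ∀ q, TangentSpace 𝓘(ℝ, E') (F q)) : Prop :=
  IsSmoothAlong (E := E) F X ∧ ∀ q, X q ∈ D q

/-! ### The Levi-Civita connection and its pullback -/

section LeviCivita

variable [RiemannianBundle (TangentSpace 𝓘(ℝ, E) : M → Type _)]
  [RiemannianBundle (TangentSpace 𝓘(ℝ, E') : N → Type _)]

/-- The right-hand side of Koszul's formula,
`X g(Y,Z) + Y g(X,Z) - Z g(X,Y) + g([X,Y],Z) - g([X,Z],Y) - g([Y,Z],X)`. -/
def koszul (X Y Z : ∀ x : M, TangentSpace 𝓘(ℝ, E) x) (x : M) : ℝ :=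
  mvfderiv 𝓘(ℝ, E) (fun y => inner ℝ (Y y) (Z y)) x (X x)
    + mvfderiv 𝓘(ℝ, E) (fun y => inner ℝ (X y) (Z y)) x (Y x)
    - mvfderiv 𝓘(ℝ, E) (fun y => inner ℝ (X y) (Y y)) x (Z x)
    + inner ℝ (VectorField.mlieBracket 𝓘(ℝ, E) X Y x) (Z x)
    - inner ℝ (VectorField.mlieBracket 𝓘(ℝ, E) X Z x) (Y x)
    - inner ℝ (VectorField.mlieBracket 𝓘(ℝ, E) Y Z x) (X x)

/-- The Levi-Civita covariant derivative `∇_v Y` at `x`, for `v ∈ T_x M`: the vector with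
`2 g(∇_v Y, z) = koszul v Y z` for all `z ∈ T_x M`, written out in an orthonormal basis of `T_x M`.
The vectors `v` and `z` are extended to local vector fields with constant coordinates. -/
def nabla (Y : ∀ x : M, TangentSpace 𝓘(ℝ, E) x) (x : M) (v : TangentSpace 𝓘(ℝ, E) x) :
    TangentSpace 𝓘(ℝ, E) x :=
  ∑ i, ((1 / 2 : ℝ) * koszul (FiberBundle.extend E v) Y
      (FiberBundle.extend E (stdOrthonormalBasis ℝ (TangentSpace 𝓘(ℝ, E) x) i)) x) •
    stdOrthonormalBasis ℝ (TangentSpace 𝓘(ℝ, E) x) i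

/-- The pullback `∇^F_v W` of the Levi-Civita connection of `N`, for a vector field `W` along `F`
and `v ∈ T_q M`. In the trivialization of `TN` at `F q` write `W = ∑ Wⁱ eᵢ` with `eᵢ` the
coordinate frame; then `∇^F_v W = ∑ dWⁱ(v) eᵢ + ∑ Wⁱ(q) ∇^N_{F_* v} eᵢ`. -/
def nablaAlong (F : M → N) (W : ∀ q, TangentSpace 𝓘(ℝ, E') (F q)) (q : M)
    (v : TangentSpace 𝓘(ℝ, E) q) : TangentSpace 𝓘(ℝ, E') (F q) :=
  (trivializationAt E' (TangentSpace 𝓘(ℝ, E') : N → Type _) (F q)).symm (F q)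
      (mvfderiv 𝓘(ℝ, E) (fun p => (trivializationAt E' (TangentSpace 𝓘(ℝ, E') : N → Type _)
        (F q) ⟨F p, W p⟩).2) q v)
    + nabla (FiberBundle.extend E' (W q)) (F q) (mfderiv 𝓘(ℝ, E) 𝓘(ℝ, E') F q v)

/-- The velocity of a curve. -/
def velocity (β : ℝ → N) (t : ℝ) : TangentSpace 𝓘(ℝ, E') (β t) :=
  mfderiv 𝓘(ℝ, ℝ) 𝓘(ℝ, E') β t (1 : ℝ)

/-- `β` is a geodesic on the open interval `(a, b)`: it is smooth and `∇_β' β' = 0`. -/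
def IsGeodesicOn (β : ℝ → N) (a b : ℝ) : Prop :=
  ContMDiffOn 𝓘(ℝ, ℝ) 𝓘(ℝ, E') ∞ β (Ioo a b) ∧
    ∀ t ∈ Ioo a b, nablaAlong (E := ℝ) (E' := E') β (velocity β) t (1 : ℝ) = 0

/-! ### Foliations and local products -/

/-- A distribution is involutive (tangent to a foliation) if `[X, Y] ∈ Γ(D)` for `X, Y ∈ Γ(D)`. -/
def IsInvolutive (D : ∀ x : M, Submodule ℝ (TangentSpace 𝓘(ℝ, E) x)) : Prop :=
  ∀ X Y : ∀ x : M, TangentSpace 𝓘(ℝ, E) x, IsSectionOf (E := E) (fun x => x) D X →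
    IsSectionOf (E := E) (fun x => x) D Y → ∀ x, VectorField.mlieBracket 𝓘(ℝ, E) X Y x ∈ D x

/-- `D` is a totally geodesic foliation: it is involutive and `∇_X Y ∈ Γ(D)` for `X, Y ∈ Γ(D)`. -/
def IsTotallyGeodesicFoliation (D : ∀ x : M, Submodule ℝ (TangentSpace 𝓘(ℝ, E) x)) : Prop :=
  IsInvolutive D ∧
  ∀ X Y : ∀ x : M, TangentSpace 𝓘(ℝ, E) x, IsSectionOf (E := E) (fun x => x) D X →
    IsSectionOf (E := E) (fun x => x) D Y → ∀ x, nabla Y x (X x) ∈ D x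

/-- The Riemannian manifold is locally a product with canonical foliations `D` and `Dᗮ`:
both are totally geodesic foliations. -/
def IsLocallyProduct (D : ∀ x : M, Submodule ℝ (TangentSpace 𝓘(ℝ, E) x)) : Prop :=
  IsTotallyGeodesicFoliation D ∧ IsTotallyGeodesicFoliation fun x => (D x)ᗮ

/-! ### Kähler structures -/

/-- `(N, g, P)` is a Kähler manifold: `P` is a smooth field of endomorphisms of the tangent
spaces with `P² = -1`, `g(PX, PY) = g(X, Y)` and `∇P = 0`. -/
structure IsKahler
    (P : ∀ y : N, TangentSpace 𝓘(ℝ, E') y →L[ℝ] TangentSpace 𝓘(ℝ, E') y) : Prop where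
  smooth : ContMDiff 𝓘(ℝ, E') (𝓘(ℝ, E').prod 𝓘(ℝ, E' →L[ℝ] E')) ∞
    (fun y => TotalSpace.mk' (E' →L[ℝ] E')
      (E := fun y : N => TangentSpace 𝓘(ℝ, E') y →L[ℝ] TangentSpace 𝓘(ℝ, E') y) y (P y))
  sq_eq : ∀ y v, P y (P y v) = -v
  inner_eq : ∀ y v w, inner ℝ (P y v) (P y w) = inner ℝ v w
  parallel : ∀ Y : ∀ y : N, TangentSpace 𝓘(ℝ, E') y, IsSmoothAlong (E := E') (fun y => y) Y →
    ∀ y v, nabla (fun z => P z (Y z)) y v = P y (nabla Y y v)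

/-! ### Riemannian maps -/

/-- The kernel of `F_*` at `q`. -/
def kerD (F : M → N) (q : M) : Submodule ℝ (TangentSpace 𝓘(ℝ, E) q) :=
  LinearMap.ker (mfderiv 𝓘(ℝ, E) 𝓘(ℝ, E') F q).toLinearMap

/-- The range of `F_*` at `q`. -/
def rangeD (F : M → N) (q : M) : Submodule ℝ (TangentSpace 𝓘(ℝ, E') (F q)) :=
  LinearMap.range (mfderiv 𝓘(ℝ, E) 𝓘(ℝ, E') F q).toLinearMap

/-- `F` is a Riemannian map of rank `r`, with `0 < r < min (dim M) (dim N)`: it is smooth of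
constant rank `r`, and `F_*` is isometric on `(ker F_*)ᗮ`. -/
structure IsRiemannianMap (F : M → N) (r : ℕ) : Prop where
  smooth : ContMDiff 𝓘(ℝ, E) 𝓘(ℝ, E') ∞ F
  rank_eq : ∀ q, Module.finrank ℝ (rangeD (E := E) (E' := E') F q) = r
  rank_pos : 0 < r
  rank_lt : r < min (Module.finrank ℝ E) (Module.finrank ℝ E')
  isometry : ∀ q, ∀ v ∈ (kerD (E := E) (E' := E') F q)ᗮ,
    ∀ w ∈ (kerD (E := E) (E' := E') F q)ᗮ,
    inner ℝ (mfderiv 𝓘(ℝ, E) 𝓘(ℝ, E') F q v) (mfderiv 𝓘(ℝ, E) 𝓘(ℝ, E') F q w) = inner ℝ v w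

/-- The Riemannian map `F` is semi-invariant, with `range F_* = D₁ ⊕ D₂`, `P D₁ = D₁` and
`P D₂ ⊆ (range F_*)ᗮ`; `D₁`, `D₂` are subbundles of `range F_*` of ranks `d₁`, `d₂`.
(`D₁ ⟂ D₂` follows.) -/
structure IsSemiInvariant (F : M → N)
    (P : ∀ y : N, TangentSpace 𝓘(ℝ, E') y →L[ℝ] TangentSpace 𝓘(ℝ, E') y)
    (D₁ D₂ : ∀ q : M, Submodule ℝ (TangentSpace 𝓘(ℝ, E') (F q))) (d₁ d₂ : ℕ) : Prop where
  subbundle₁ : IsSubbundleAlong (E := E) F D₁ d₁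
  subbundle₂ : IsSubbundleAlong (E := E) F D₂ d₂
  sup_eq : ∀ q, D₁ q ⊔ D₂ q = rangeD (E := E) F q
  invariant : ∀ q, (D₁ q).map (P (F q)).toLinearMap = D₁ q
  antiInvariant : ∀ q, ∀ v ∈ D₂ q, P (F q) v ∈ (rangeD (E := E) F q)ᗮ

/-- The adjoint `*F_*` of `F_*` at `q`. -/
def adjointD (F : M → N) (q : M) :
    TangentSpace 𝓘(ℝ, E') (F q) →ₗ[ℝ] TangentSpace 𝓘(ℝ, E) q :=
  LinearMap.adjoint (mfderiv 𝓘(ℝ, E) 𝓘(ℝ, E') F q).toLinearMap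

/-- The component in `range F_*` of a vector at `F q`. -/
def tangentialPart (F : M → N) (q : M) (w : TangentSpace 𝓘(ℝ, E') (F q)) :
    TangentSpace 𝓘(ℝ, E') (F q) :=
  (rangeD (E := E) F q).starProjection w

/-- The component in `(range F_*)ᗮ` of a vector at `F q`. -/
def normalPart (F : M → N) (q : M) (w : TangentSpace 𝓘(ℝ, E') (F q)) :
    TangentSpace 𝓘(ℝ, E') (F q) :=
  (rangeD (E := E) F q)ᗮ.starProjection w

/-- `S_V F_* v`, the negative of the tangential part of `∇^F_v V`. -/
def shapeOp (F : M → N) (V : ∀ q, TangentSpace 𝓘(ℝ, E') (F q)) (q : M)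
    (v : TangentSpace 𝓘(ℝ, E) q) : TangentSpace 𝓘(ℝ, E') (F q) :=
  -tangentialPart (E := E) F q (nablaAlong F V q v)

/-- The normal connection `∇^{F⊥}_v V`, the normal part of `∇^F_v V`. -/
def normalNabla (F : M → N) (V : ∀ q, TangentSpace 𝓘(ℝ, E') (F q)) (q : M)
    (v : TangentSpace 𝓘(ℝ, E) q) : TangentSpace 𝓘(ℝ, E') (F q) :=
  normalPart (E := E) F q (nablaAlong F V q v)

/-- The vector field `F_* X` along `F`. -/
def push (F : M → N) (X : ∀ q : M, TangentSpace 𝓘(ℝ, E) q) (q : M) :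
    TangentSpace 𝓘(ℝ, E') (F q) :=
  mfderiv 𝓘(ℝ, E) 𝓘(ℝ, E') F q (X q)

/-- `tanP F P W` is the tangential part of `P W`: this is `φ W` if `W ∈ Γ(range F_*)`, and
`B W` if `W ∈ Γ((range F_*)ᗮ)`. -/
def tanP (F : M → N) (P : ∀ y : N, TangentSpace 𝓘(ℝ, E') y →L[ℝ] TangentSpace 𝓘(ℝ, E') y)
    (W : ∀ q : M, TangentSpace 𝓘(ℝ, E') (F q)) (q : M) : TangentSpace 𝓘(ℝ, E') (F q) :=
  tangentialPart (E := E) F q (P (F q) (W q))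

/-- `norP F P W` is the normal part of `P W`: this is `ω W` if `W ∈ Γ(range F_*)`, and
`C W` if `W ∈ Γ((range F_*)ᗮ)`. -/
def norP (F : M → N) (P : ∀ y : N, TangentSpace 𝓘(ℝ, E') y →L[ℝ] TangentSpace 𝓘(ℝ, E') y)
    (W : ∀ q : M, TangentSpace 𝓘(ℝ, E') (F q)) (q : M) : TangentSpace 𝓘(ℝ, E') (F q) :=
  normalPart (E := E) F q (P (F q) (W q))

/-- The distribution `D̄ = {v ∈ (ker F_*)ᗮ : F_* v ∈ D}` on `M`. -/
def horizontalLift (F : M → N) (D : ∀ q : M, Submodule ℝ (TangentSpace 𝓘(ℝ, E') (F q)))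
    (q : M) : Submodule ℝ (TangentSpace 𝓘(ℝ, E) q) :=
  (kerD (E' := E') F q)ᗮ ⊓ (D q).comap (mfderiv 𝓘(ℝ, E) 𝓘(ℝ, E') F q).toLinearMap

/-- The Clairaut condition with function `s = e^f`, for the distribution `R` that extends
`range F_*` to `N`: along every geodesic `β` of `N`, the function `s(β(t)) sin θ(t)` is constant,
where `θ(t)` is the angle between `β'(t)` and its component in `Rᗮ` (`π / 2` if one of them is `0`,
which is Mathlib's convention for `angle`). -/
def IsClairaut (R : ∀ y : N, Submodule ℝ (TangentSpace 𝓘(ℝ, E') y)) (f : N → ℝ) : Prop :=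
  ∀ (β : ℝ → N) (a b : ℝ), IsGeodesicOn (E' := E') β a b → ∃ c : ℝ, ∀ t ∈ Ioo a b,
    Real.exp (f (β t)) * Real.sin (InnerProductGeometry.angle (velocity (E' := E') β t)
      ((R (β t))ᗮ.starProjection (velocity β t))) = c

end LeviCivita

end Clairaut

end

noncomputable section

namespace Clairaut

set_option maxSynthPendingDepth 3

/-! Both sides of the equivalence hold outright: the hypotheses force `df = 0` on all of `N`, and
then `R` is parallel. Write `π` for the orthogonal projection onto `R` and `ξ` for the gradient of
`f`.

Umbilicity. Differentiating Clairaut's relation along geodesics gives `df(v)|πv|² + g((∇_v π)v, πv)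
= 0` (`clairaut_deriv`). Since `R` is involutive and `Rᗮ` is totally geodesic, pointwise algebra
then determines `∇π` completely: `ξ ⟂ R` and `(∇_v π)a = -(df(a) πv + g(πv,a) ξ)`
(`projection_derivative_eq`, `nablaEnd_proj`). So `R` is totally umbilical with mean curvature
vector `-ξ`.

Rigidity at a point. Semi-invariance of `R` makes `S = πPπP(1-π)` vanish. If `S = 0` and `∇_u S = 0`
for `u ∈ R` at a point, then, as `∇P = 0`, evaluating `∇_u S` on `ξ` and pairing with `u` gives
`|πPξ|²|u|² = g(u,Pξ)² + |ξ|²|πPu|²`. A nonzero `u` in the invariant part yields `|πPξ| = |ξ|`; a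
nonzero `u` in the anti-invariant part orthogonal to `Pξ`, which exists because that part has rank
at least two, yields `πPξ = 0`. Hence `ξ = 0` (`gradient_eq_zero`). This applies at the points `F
q`: there `S` vanishes along `F`, whose derivative fills `R`.

Propagation. The image of `F` need not be open, so the vanishing has to be carried to the rest of
`N`. From a point with `df = 0` and `S = 0`, move first along `R` and then along `Rᗮ`.
Differentiating `df ∘ π = 0` gives a linear ODE that keeps `df = 0` on the first leg, so `∇π = 0`
there; on the second leg `∇_v π = 0` because `πv = 0`. Thus `S` is parallel on both legs and stays
zero, and such broken curves reach a neighbourhood (`exists_broken_curve`,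
`eventually_semi_eq_zero`). Rigidity applies again at the new points, the rank of the invariant part
being a locally constant trace. The good set is therefore clopen (`isClopen_critical`), and `N` is
connected.

Conclusion. Once `∇π = 0`, `R` is totally geodesic (`isLocallyProduct`), and the displayed
expression collapses to `g(∇^F_X F_*X, V) = 0` (`expression_eq_zero_of_parallel`). -/

theorem mvfderiv_congr {E : Type*} [NormedAddCommGroup E] [NormedSpace ℝ E]
    {M : Type*} [TopologicalSpace M] [ChartedSpace E M] {x : M}
    {V : Type*} [NormedAddCommGroup V] [NormedSpace ℝ V] {f g : M → V}
    (h : f =ᶠ[𝓝 x] g) : mvfderiv 𝓘(ℝ, E) f x = mvfderiv 𝓘(ℝ, E) g x := by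
  have := h.mfderiv_eq (I := 𝓘(ℝ, E)) (I' := 𝓘(ℝ, V))
  exact this

/-- The vector field `X` is differentiable at `x`. -/
abbrev DiffField {E : Type*} [NormedAddCommGroup E] [NormedSpace ℝ E]
    {M : Type*} [TopologicalSpace M] [ChartedSpace E M] [IsManifold 𝓘(ℝ, E) ∞ M]
    (X : ∀ x : M, TangentSpace 𝓘(ℝ, E) x) (x : M) : Prop :=
  MDifferentiableAt 𝓘(ℝ, E) 𝓘(ℝ, E).tangent (fun y => (⟨y, X y⟩ : TangentBundle 𝓘(ℝ, E) M)) x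

/-! ### The Levi-Civita connection obtained from Koszul's formula. -/

section NablaAxioms

set_option linter.unusedSectionVars false

variable {E : Type*} [NormedAddCommGroup E] [NormedSpace ℝ E] [FiniteDimensional ℝ E]
  {M : Type*} [TopologicalSpace M] [ChartedSpace E M] [IsManifold 𝓘(ℝ, E) ∞ M]
  [RiemannianBundle (TangentSpace 𝓘(ℝ, E) : M → Type _)]
  [IsContMDiffRiemannianBundle 𝓘(ℝ, E) ∞ E (TangentSpace 𝓘(ℝ, E) : M → Type _)]

variable {X Y Z : ∀ x : M, TangentSpace 𝓘(ℝ, E) x} {x : M}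

theorem DiffField.inner (hX : DiffField X x) (hY : DiffField Y x) :
    MDifferentiableAt 𝓘(ℝ, E) 𝓘(ℝ, ℝ) (fun y => inner ℝ (X y) (Y y)) x :=
  MDifferentiableAt.inner_bundle hX hY

/-- The derivatives of a factor `f` in the first slot, coming from the metric terms and from the
brackets, cancel in pairs. Hence the extension of `v` chosen in `nabla` is immaterial. -/
theorem koszul_tensorial_left (hY : DiffField Y x) (hZ : DiffField Z x) :
    TensorialAt 𝓘(ℝ, E) E (fun X => koszul X Y Z x) x where
  smul {f σ} hf hσ := by
    simp only [koszul, Pi.smul_apply', map_smul, inner_smul_left, inner_smul_right, conj_trivial]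
    rw [mvfderiv_fun_mul hf (DiffField.inner hσ hZ), mvfderiv_fun_mul hf (DiffField.inner hσ hY),
      VectorField.mlieBracket_smul_left hf hσ, VectorField.mlieBracket_smul_left hf hσ]
    simp [inner_add_left, inner_smul_left, real_inner_comm]
    ring
  add {σ σ'} hσ hσ' := by
    simp only [koszul, Pi.add_apply, map_add, inner_add_left, inner_add_right]
    rw [mvfderiv_fun_add (DiffField.inner hσ hZ) (DiffField.inner hσ' hZ),
      mvfderiv_fun_add (DiffField.inner hσ hY) (DiffField.inner hσ' hY),
      VectorField.mlieBracket_add_left hσ hσ', VectorField.mlieBracket_add_left hσ hσ']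
    simp [inner_add_left]
    ring

theorem koszul_tensorial_right (hX : DiffField X x) (hY : DiffField Y x) :
    TensorialAt 𝓘(ℝ, E) E (fun Z => koszul X Y Z x) x where
  smul {f σ} hf hσ := by
    simp only [koszul, Pi.smul_apply', map_smul, inner_smul_right]
    rw [mvfderiv_fun_mul hf (DiffField.inner hY hσ), mvfderiv_fun_mul hf (DiffField.inner hX hσ),
      VectorField.mlieBracket_smul_right hf hσ, VectorField.mlieBracket_smul_right hf hσ]
    simp [inner_add_left, inner_smul_left, real_inner_comm]
    ring
  add {σ σ'} hσ hσ' := by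
    simp only [koszul, Pi.add_apply, map_add, inner_add_right]
    rw [mvfderiv_fun_add (DiffField.inner hY hσ) (DiffField.inner hY hσ'),
      mvfderiv_fun_add (DiffField.inner hX hσ) (DiffField.inner hX hσ'),
      VectorField.mlieBracket_add_right hσ hσ', VectorField.mlieBracket_add_right hσ hσ']
    simp [inner_add_left]
    ring

theorem diffField_extend (v : TangentSpace 𝓘(ℝ, E) x) :
    DiffField (FiberBundle.extend E v) x :=
  FiberBundle.mdifferentiableAt_extend 𝓘(ℝ, E) E v

/-- Koszul's formula. -/
theorem two_mul_inner_nabla (hX : DiffField X x) (hY : DiffField Y x) (hZ : DiffField Z x) :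
    2 * inner ℝ (nabla Y x (X x)) (Z x) = koszul X Y Z x := by
  set b := stdOrthonormalBasis ℝ (TangentSpace 𝓘(ℝ, E) x)
  have h1 : ∀ v : TangentSpace 𝓘(ℝ, E) x,
      koszul (FiberBundle.extend E (X x)) Y (FiberBundle.extend E v) x
        = koszul X Y (FiberBundle.extend E v) x := fun v =>
    (koszul_tensorial_left hY (diffField_extend v)).pointwise (diffField_extend _) hX (by simp)
  -- The last slot of `koszul` is a covector at `x`, so its values on the orthonormal basis used in
  -- `nabla` determine its value on `Z x`.
  set Lf := TensorialAt.mkHom (fun Z => koszul X Y Z x) x (koszul_tensorial_right hX hY)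
  have h2 : ∀ v : TangentSpace 𝓘(ℝ, E) x, koszul X Y (FiberBundle.extend E v) x = Lf v :=
    fun v => rfl
  have h3 : Lf (Z x) = koszul X Y Z x := TensorialAt.mkHom_apply _ hZ
  rw [← h3, nabla, sum_inner]
  simp only [h1, h2, inner_smul_left]
  conv_rhs => rw [← b.sum_repr (Z x), map_sum]
  rw [Finset.mul_sum]
  refine Finset.sum_congr rfl fun i _ => ?_
  rw [map_smul, b.repr_apply_apply]
  simp only [b, smul_eq_mul, conj_trivial]
  ring

theorem eq_of_inner_extend {u w : TangentSpace 𝓘(ℝ, E) x}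
    (h : ∀ Z : ∀ x : M, TangentSpace 𝓘(ℝ, E) x, DiffField Z x →
      inner ℝ u (Z x) = inner ℝ w (Z x)) : u = w := by
  refine ext_inner_right ℝ fun v => ?_
  simpa using h (FiberBundle.extend E v) (diffField_extend v)

theorem two_mul_inner_nabla' (hY : DiffField Y x) (hZ : DiffField Z x)
    (v : TangentSpace 𝓘(ℝ, E) x) :
    2 * inner ℝ (nabla Y x v) (Z x) = koszul (FiberBundle.extend E v) Y Z x := by
  simpa using two_mul_inner_nabla (diffField_extend v) hY hZ

theorem nabla_add {Y' : ∀ x : M, TangentSpace 𝓘(ℝ, E) x} (hY : DiffField Y x)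
    (hY' : DiffField Y' x) (v : TangentSpace 𝓘(ℝ, E) x) :
    nabla (Y + Y') x v = nabla Y x v + nabla Y' x v := by
  refine eq_of_inner_extend fun Z hZ => ?_
  have hX := diffField_extend v
  have h := two_mul_inner_nabla' (mdifferentiableAt_add_section hY hY') hZ v
  have h1 := two_mul_inner_nabla' hY hZ v
  have h2 := two_mul_inner_nabla' hY' hZ v
  simp only [koszul, Pi.add_apply, map_add, inner_add_left, inner_add_right] at h h1 h2 ⊢
  erw [VectorField.mlieBracket_add_right hY hY', VectorField.mlieBracket_add_left hY hY',
    mvfderiv_fun_add (DiffField.inner hY hZ) (DiffField.inner hY' hZ),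
    mvfderiv_fun_add (DiffField.inner hX hY) (DiffField.inner hX hY')] at h
  simp only [inner_add_left, add_apply] at h
  linarith

theorem nabla_smul {c : M → ℝ} (hc : MDifferentiableAt 𝓘(ℝ, E) 𝓘(ℝ, ℝ) c x)
    (hY : DiffField Y x) (v : TangentSpace 𝓘(ℝ, E) x) :
    nabla (fun y => c y • Y y) x v = c x • nabla Y x v + mvfderiv 𝓘(ℝ, E) c x v • Y x := by
  refine eq_of_inner_extend fun Z hZ => ?_
  have hX := diffField_extend v
  have h := two_mul_inner_nabla' (hc.smul_section hY) hZ v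
  have h1 := two_mul_inner_nabla' hY hZ v
  simp only [koszul, Pi.smul_apply', map_smul, inner_smul_left, inner_smul_right, inner_add_left]
    at h h1 ⊢
  change 2 * inner ℝ (nabla (fun y => c y • Y y) x v) (Z x) = _ at h
  erw [VectorField.mlieBracket_smul_right hc hY, VectorField.mlieBracket_smul_left hc hY,
    mvfderiv_fun_mul hc (DiffField.inner hY hZ),
    mvfderiv_fun_mul hc (DiffField.inner hX hY)] at h
  simp [inner_add_left, inner_smul_left] at h h1 ⊢
  rw [real_inner_comm (Y x) v] at h
  linear_combination h / 2 - c x / 2 * h1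

/-- Metric compatibility: adding Koszul's formulas for `(Y, Z)` and `(Z, Y)` leaves only twice the
derivative of the inner product. -/
theorem mvfderiv_inner (hY : DiffField Y x) (hZ : DiffField Z x)
    (v : TangentSpace 𝓘(ℝ, E) x) :
    mvfderiv 𝓘(ℝ, E) (fun y => inner ℝ (Y y) (Z y)) x v
      = inner ℝ (nabla Y x v) (Z x) + inner ℝ (Y x) (nabla Z x v) := by
  have h1 := two_mul_inner_nabla' hY hZ v
  have h2 := two_mul_inner_nabla' hZ hY v
  have h3 : (fun y => inner ℝ (Z y) (Y y)) = fun y => inner ℝ (Y y) (Z y) :=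
    funext fun y => real_inner_comm _ _
  simp only [koszul] at h1 h2
  rw [VectorField.mlieBracket_swap_apply (V := Z) (W := Y), h3] at h2
  rw [real_inner_comm (nabla Z x v)]
  simp only [FiberBundle.extend_apply_self, inner_neg_left] at h1 h2
  linarith

/-- Torsion-freeness: exchanging the first two fields in Koszul's formula changes it by twice the
bracket term. -/
theorem nabla_sub_nabla (hX : DiffField X x) (hY : DiffField Y x) :
    nabla Y x (X x) - nabla X x (Y x) = VectorField.mlieBracket 𝓘(ℝ, E) X Y x := by
  refine eq_of_inner_extend fun Z hZ => ?_
  have h1 := two_mul_inner_nabla hX hY hZ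
  have h2 := two_mul_inner_nabla hY hX hZ
  simp only [koszul] at h1 h2
  rw [VectorField.mlieBracket_swap_apply (V := Y) (W := X)] at h2
  have h3 : (fun y => inner ℝ (Y y) (X y)) = fun y => inner ℝ (X y) (Y y) :=
    funext fun y => real_inner_comm _ _
  rw [h3] at h2
  simp only [inner_neg_left, inner_sub_left] at h1 h2 ⊢
  linarith

theorem koszul_congr {Y' : ∀ x : M, TangentSpace 𝓘(ℝ, E) x} (h : Y =ᶠ[𝓝 x] Y') :
    koszul X Y Z x = koszul X Y' Z x := by
  have e1 : mvfderiv 𝓘(ℝ, E) (fun y => inner ℝ (Y y) (Z y)) x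
      = mvfderiv 𝓘(ℝ, E) (fun y => inner ℝ (Y' y) (Z y)) x :=
    mvfderiv_congr (by filter_upwards [h] with y hy using by rw [hy])
  have e2 : mvfderiv 𝓘(ℝ, E) (fun y => inner ℝ (X y) (Y y)) x
      = mvfderiv 𝓘(ℝ, E) (fun y => inner ℝ (X y) (Y' y)) x :=
    mvfderiv_congr (by filter_upwards [h] with y hy using by rw [hy])
  have e3 : VectorField.mlieBracket 𝓘(ℝ, E) X Y x = VectorField.mlieBracket 𝓘(ℝ, E) X Y' x :=
    Filter.EventuallyEq.mlieBracket_vectorField_eq (Filter.EventuallyEq.refl _ _) h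
  have e4 : VectorField.mlieBracket 𝓘(ℝ, E) Y Z x = VectorField.mlieBracket 𝓘(ℝ, E) Y' Z x :=
    Filter.EventuallyEq.mlieBracket_vectorField_eq h (Filter.EventuallyEq.refl _ _)
  simp only [koszul]
  rw [e1, e2, e3, e4, h.self_of_nhds]

theorem nabla_congr {Y' : ∀ x : M, TangentSpace 𝓘(ℝ, E) x} (h : Y =ᶠ[𝓝 x] Y')
    (v : TangentSpace 𝓘(ℝ, E) x) : nabla Y x v = nabla Y' x v := by
  simp only [nabla, koszul_congr h]

end NablaAxioms

/-! ### Coordinates of points, tangent vectors and derivatives in a fixed chart. -/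

section Coordinates

set_option linter.unusedSectionVars false

variable {E : Type*} [NormedAddCommGroup E] [NormedSpace ℝ E] [FiniteDimensional ℝ E]
  {M : Type*} [TopologicalSpace M] [ChartedSpace E M] [IsManifold 𝓘(ℝ, E) ∞ M]

/-- The coordinates of a tangent vector at `y` in the chart centred at `o`. -/
def coordMap (o y : M) : TangentSpace 𝓘(ℝ, E) y →L[ℝ] E :=
  (trivializationAt E (TangentSpace 𝓘(ℝ, E) : M → Type _) o).continuousLinearMapAt ℝ y

/-- The tangent vector at `y` with given coordinates in the chart centred at `o`. -/
def coordVec (o y : M) : E →L[ℝ] TangentSpace 𝓘(ℝ, E) y :=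
  (trivializationAt E (TangentSpace 𝓘(ℝ, E) : M → Type _) o).symmL ℝ y

/-- The domain of the chart centred at `o`. -/
def dom (o : M) : Set M := (chartAt E o).source

variable {o y : M}

theorem isOpen_dom (o : M) : IsOpen (dom (E := E) o) := (chartAt E o).open_source

theorem self_mem_dom (o : M) : o ∈ dom (E := E) o := mem_chart_source E o

theorem dom_mem_nhds (hy : y ∈ dom (E := E) o) : dom (E := E) o ∈ 𝓝 y := (isOpen_dom o).mem_nhds hy

theorem mem_baseSet (hy : y ∈ dom (E := E) o) :
    y ∈ (trivializationAt E (TangentSpace 𝓘(ℝ, E) : M → Type _) o).baseSet := by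
  rwa [TangentBundle.trivializationAt_baseSet]

@[simp] theorem coordMap_coordVec (hy : y ∈ dom (E := E) o) (a : E) :
    coordMap o y (coordVec o y a) = a :=
  Trivialization.continuousLinearMapAt_symmL _ (mem_baseSet hy) a

@[simp] theorem coordVec_coordMap (hy : y ∈ dom (E := E) o) (v : TangentSpace 𝓘(ℝ, E) y) :
    coordVec o y (coordMap o y v) = v :=
  Trivialization.symmL_continuousLinearMapAt _ (mem_baseSet hy) v

theorem coordMap_eq (hy : y ∈ dom (E := E) o) (v : TangentSpace 𝓘(ℝ, E) y) :
    coordMap o y v = (trivializationAt E (TangentSpace 𝓘(ℝ, E) : M → Type _) o ⟨y, v⟩).2 := by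
  simp only [coordMap, Trivialization.continuousLinearMapAt_apply]
  rw [Trivialization.linearMapAt_apply, if_pos (mem_baseSet hy)]

theorem coordMap_eq_mfderiv (hy : y ∈ dom (E := E) o) :
    coordMap o y = mfderiv 𝓘(ℝ, E) 𝓘(ℝ, E) (extChartAt 𝓘(ℝ, E) o) y :=
  TangentBundle.continuousLinearMapAt_trivializationAt hy

section Along

variable {E₀ : Type*} [NormedAddCommGroup E₀] [NormedSpace ℝ E₀]
  {M₀ : Type*} [TopologicalSpace M₀] [ChartedSpace E₀ M₀]
  {F : M₀ → M} {W : ∀ q, TangentSpace 𝓘(ℝ, E) (F q)} {q : M₀}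

theorem contMDiffAt_along_iff (hq : F q ∈ dom (E := E) o)
    (hF : ContMDiffAt 𝓘(ℝ, E₀) 𝓘(ℝ, E) ∞ F q) :
    ContMDiffAt 𝓘(ℝ, E₀) 𝓘(ℝ, E).tangent ∞ (fun p => (⟨F p, W p⟩ : TangentBundle 𝓘(ℝ, E) M)) q ↔
      ContMDiffAt 𝓘(ℝ, E₀) 𝓘(ℝ, E) ∞ (fun p => coordMap o (F p) (W p)) q := by
  rw [Trivialization.contMDiffAt_iff
    (e := trivializationAt E (TangentSpace 𝓘(ℝ, E) : M → Type _) o)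
    (by rw [Trivialization.mem_source]; exact mem_baseSet hq)]
  refine ⟨fun h => h.2.congr_of_eventuallyEq ?_, fun h => ⟨hF, h.congr_of_eventuallyEq ?_⟩⟩
  · filter_upwards [hF.continuousAt (dom_mem_nhds hq)] with p hp using coordMap_eq hp _
  · filter_upwards [hF.continuousAt (dom_mem_nhds hq)] with p hp using (coordMap_eq hp _).symm

theorem mdifferentiableAt_along_iff (hq : F q ∈ dom (E := E) o)
    (hF : MDifferentiableAt 𝓘(ℝ, E₀) 𝓘(ℝ, E) F q) :
    MDifferentiableAt 𝓘(ℝ, E₀) 𝓘(ℝ, E).tangent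
      (fun p => (⟨F p, W p⟩ : TangentBundle 𝓘(ℝ, E) M)) q ↔
      MDifferentiableAt 𝓘(ℝ, E₀) 𝓘(ℝ, E) (fun p => coordMap o (F p) (W p)) q := by
  rw [Trivialization.mdifferentiableAt_totalSpace_iff 𝓘(ℝ, E)
    (trivializationAt E (TangentSpace 𝓘(ℝ, E) : M → Type _) o) _
    (by rw [Trivialization.mem_source]; exact mem_baseSet hq)]
  refine ⟨fun h => h.2.congr_of_eventuallyEq ?_, fun h => ⟨hF, h.congr_of_eventuallyEq ?_⟩⟩
  · filter_upwards [hF.continuousAt (dom_mem_nhds hq)] with p hp using coordMap_eq hp _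
  · filter_upwards [hF.continuousAt (dom_mem_nhds hq)] with p hp using (coordMap_eq hp _).symm

end Along

variable {Y : ∀ x : M, TangentSpace 𝓘(ℝ, E) x}

theorem diffField_iff (hy : y ∈ dom (E := E) o) :
    DiffField Y y ↔ MDifferentiableAt 𝓘(ℝ, E) 𝓘(ℝ, E) (fun p => coordMap o p (Y p)) y :=
  mdifferentiableAt_along_iff (F := fun p => p) hy mdifferentiableAt_id

theorem contMDiffAt_field_iff (hy : y ∈ dom (E := E) o) :
    ContMDiffAt 𝓘(ℝ, E) 𝓘(ℝ, E).tangent ∞ (fun p => (⟨p, Y p⟩ : TangentBundle 𝓘(ℝ, E) M)) y ↔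
      ContMDiffAt 𝓘(ℝ, E) 𝓘(ℝ, E) ∞ (fun p => coordMap o p (Y p)) y :=
  contMDiffAt_along_iff (F := fun p => p) hy contMDiffAt_id

theorem contMDiffAt_coordVec (hy : y ∈ dom (E := E) o) (a : E) :
    ContMDiffAt 𝓘(ℝ, E) 𝓘(ℝ, E).tangent ∞
      (fun p => (⟨p, coordVec o p a⟩ : TangentBundle 𝓘(ℝ, E) M)) y := by
  rw [contMDiffAt_field_iff hy]
  refine (contMDiffAt_const (c := a)).congr_of_eventuallyEq ?_
  filter_upwards [dom_mem_nhds hy] with p hp using coordMap_coordVec hp a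

theorem diffField_coordVec (hy : y ∈ dom (E := E) o) (a : E) :
    DiffField (fun p => coordVec o p a) y :=
  (contMDiffAt_coordVec hy a).mdifferentiableAt (by simp)

theorem extend_eq (v : TangentSpace 𝓘(ℝ, E) o) :
    (FiberBundle.extend E v : ∀ p : M, TangentSpace 𝓘(ℝ, E) p)
      =ᶠ[𝓝 o] fun p => coordVec o p (coordMap o o v) := by
  filter_upwards [dom_mem_nhds (self_mem_dom (E := E) o)] with p hp
  rw [coordMap_eq (self_mem_dom o)]
  exact (Trivialization.symmL_apply _ (mem_baseSet hp) _).symm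

/-- The domain of the chart at `o`, as a subset of the model space. -/
def cod (o : M) : Set E := (extChartAt 𝓘(ℝ, E) o).target

theorem isOpen_cod (o : M) : IsOpen (cod (E := E) o) := isOpen_extChartAt_target o

theorem symm_mem_dom {x : E} (hx : x ∈ cod o) : (extChartAt 𝓘(ℝ, E) o).symm x ∈ dom (E := E) o := by
  have := (extChartAt 𝓘(ℝ, E) o).map_target hx
  rwa [extChartAt_source] at this

theorem chart_mem_cod (hy : y ∈ dom (E := E) o) : extChartAt 𝓘(ℝ, E) o y ∈ cod (E := E) o :=
  (extChartAt 𝓘(ℝ, E) o).map_source (by rwa [extChartAt_source])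

theorem chart_left_inv (hy : y ∈ dom (E := E) o) :
    (extChartAt 𝓘(ℝ, E) o).symm (extChartAt 𝓘(ℝ, E) o y) = y :=
  (extChartAt 𝓘(ℝ, E) o).left_inv (by rwa [extChartAt_source])

theorem chart_right_inv {x : E} (hx : x ∈ cod o) :
    extChartAt 𝓘(ℝ, E) o ((extChartAt 𝓘(ℝ, E) o).symm x) = x :=
  (extChartAt 𝓘(ℝ, E) o).right_inv hx

theorem contMDiffAt_chart (hy : y ∈ dom (E := E) o) :
    ContMDiffAt 𝓘(ℝ, E) 𝓘(ℝ, E) ∞ (extChartAt 𝓘(ℝ, E) o) y :=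
  contMDiffAt_extChartAt' hy

theorem contMDiffAt_chart_symm {x : E} (hx : x ∈ cod o) :
    ContMDiffAt 𝓘(ℝ, E) 𝓘(ℝ, E) ∞ (extChartAt 𝓘(ℝ, E) o).symm x :=
  (contMDiffOn_extChartAt_symm o).contMDiffAt ((isOpen_cod o).mem_nhds hx)

variable {V : Type*} [NormedAddCommGroup V] [NormedSpace ℝ V]

theorem contDiffAt_chart_symm {f : M → V} {x : E} (hx : x ∈ cod o)
    (hf : ContMDiffAt 𝓘(ℝ, E) 𝓘(ℝ, V) ∞ f ((extChartAt 𝓘(ℝ, E) o).symm x)) :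
    ContDiffAt ℝ ∞ (fun z => f ((extChartAt 𝓘(ℝ, E) o).symm z)) x :=
  (hf.comp x (contMDiffAt_chart_symm hx)).contDiffAt

theorem mvfderiv_eq_fderiv {f : M → V} (hy : y ∈ dom (E := E) o)
    (hf : MDifferentiableAt 𝓘(ℝ, E) 𝓘(ℝ, V) f y) (v : TangentSpace 𝓘(ℝ, E) y) :
    mvfderiv 𝓘(ℝ, E) f y v
      = fderiv ℝ (fun z => f ((extChartAt 𝓘(ℝ, E) o).symm z)) (extChartAt 𝓘(ℝ, E) o y)
        (coordMap o y v) := by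
  set φ := extChartAt 𝓘(ℝ, E) o
  have h1 : f =ᶠ[𝓝 y] (fun z => f (φ.symm z)) ∘ φ := by
    filter_upwards [dom_mem_nhds hy] with p hp
    simp only [Function.comp, φ, chart_left_inv hp]
  have h2 : MDifferentiableAt 𝓘(ℝ, E) 𝓘(ℝ, V) (fun z => f (φ.symm z)) (φ y) := by
    refine MDifferentiableAt.comp (I' := 𝓘(ℝ, E)) (φ y) (g := f) (f := φ.symm) ?_
      ((contMDiffAt_chart_symm (chart_mem_cod hy)).mdifferentiableAt (by simp))
    rwa [chart_left_inv hy]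
  rw [mvfderiv_congr h1, coordMap_eq_mfderiv hy, ← mfderiv_eq_fderiv]
  exact congrArg (fun T => T v) (mfderiv_comp y h2
    ((contMDiffAt_chart hy).mdifferentiableAt (by simp)))

theorem mvfderiv_coordVec {f : M → V} (hy : y ∈ dom (E := E) o)
    (hf : MDifferentiableAt 𝓘(ℝ, E) 𝓘(ℝ, V) f y) (a : E) :
    mvfderiv 𝓘(ℝ, E) f y (coordVec o y a)
      = fderiv ℝ (fun z => f ((extChartAt 𝓘(ℝ, E) o).symm z)) (extChartAt 𝓘(ℝ, E) o y) a := by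
  rw [mvfderiv_eq_fderiv hy hf, coordMap_coordVec hy]

theorem inverse_coordMap (hy : y ∈ dom (E := E) o) :
    (coordMap o y).inverse = coordVec (E := E) o y :=
  ContinuousLinearMap.inverse_eq (by ext v; exact coordMap_coordVec hy v)
    (by ext v; exact coordVec_coordMap hy v)

/-- Fields with constant coordinates are pullbacks of constant fields under the chart, and the
bracket commutes with pullback. -/
theorem mlieBracket_coordVec (hy : y ∈ dom (E := E) o) (a b : E) :
    VectorField.mlieBracket 𝓘(ℝ, E) (fun p : M => coordVec o p a) (fun p => coordVec o p b) y = 0 := by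
  have h2 : (2 : ℕ∞ω) ≤ ∞ := WithTop.coe_le_coe.2 (le_top : (2 : ℕ∞) ≤ ⊤)
  have h2' : minSmoothness ℝ 2 ≤ (∞ : ℕ∞ω) := by simpa using h2
  let c : E → ∀ z : E, TangentSpace 𝓘(ℝ, E) z := fun a _ => a
  have key : ∀ a : E, (fun p : M => coordVec o p a) =ᶠ[𝓝 y]
      VectorField.mpullback 𝓘(ℝ, E) 𝓘(ℝ, E) (extChartAt 𝓘(ℝ, E) o) (c a) := fun a => by
    filter_upwards [dom_mem_nhds hy] with p hp
    refine Eq.trans ?_ (VectorField.mpullback_apply (V := c a)).symm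
    rw [← coordMap_eq_mfderiv hp]
    exact congrArg (fun T : E →L[ℝ] TangentSpace 𝓘(ℝ, E) p => T a) (inverse_coordMap hp).symm
  have : IsManifold 𝓘(ℝ, E) (minSmoothness ℝ 2) M := IsManifold.of_le (n := ∞) h2'
  have : IsManifold 𝓘(ℝ, E) (minSmoothness ℝ 2) E := IsManifold.of_le (n := ∞) h2'
  have hc : ∀ (a : E) (z : E), DiffField (c a) z := fun a z =>
    (contMDiffAt_vectorSpace_iff_contDiffAt.2
      (contDiffAt_const (c := a) (n := ∞))).mdifferentiableAt (by simp)
  rw [Filter.EventuallyEq.mlieBracket_vectorField_eq (key a) (key b),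
    ← VectorField.mpullback_mlieBracket (n := ∞) (hc a _) (hc b _) (contMDiffAt_chart hy) h2']
  refine (VectorField.mpullback_apply).trans ?_
  have : VectorField.mlieBracket 𝓘(ℝ, E) (c a) (c b) (extChartAt 𝓘(ℝ, E) o y) = 0 := by
    rw [← VectorField.mlieBracketWithin_univ, VectorField.mlieBracketWithin_eq_lieBracketWithin,
      VectorField.lieBracketWithin_univ]
    change fderiv ℝ (fun _ => b) _ a - fderiv ℝ (fun _ => a) _ b = 0
    simp
  rw [this, map_zero]

end Coordinates

/-! ### The Levi-Civita connection in an arbitrary chart. -/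

section ChartFormula

set_option linter.unusedSectionVars false

variable {E : Type*} [NormedAddCommGroup E] [NormedSpace ℝ E] [FiniteDimensional ℝ E]
  {M : Type*} [TopologicalSpace M] [ChartedSpace E M] [IsManifold 𝓘(ℝ, E) ∞ M]
  [RiemannianBundle (TangentSpace 𝓘(ℝ, E) : M → Type _)]
  [IsContMDiffRiemannianBundle 𝓘(ℝ, E) ∞ E (TangentSpace 𝓘(ℝ, E) : M → Type _)]
  {o x : M} {Y : ∀ x : M, TangentSpace 𝓘(ℝ, E) x}

theorem mvfderiv_clm_comp {E₀ : Type*} [NormedAddCommGroup E₀] [NormedSpace ℝ E₀]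
    {M₀ : Type*} [TopologicalSpace M₀] [ChartedSpace E₀ M₀] {q : M₀}
    {V V' : Type*} [NormedAddCommGroup V] [NormedSpace ℝ V] [NormedAddCommGroup V']
    [NormedSpace ℝ V'] (L : V →L[ℝ] V') {h : M₀ → V}
    (hh : MDifferentiableAt 𝓘(ℝ, E₀) 𝓘(ℝ, V) h q) (v : TangentSpace 𝓘(ℝ, E₀) q) :
    mvfderiv 𝓘(ℝ, E₀) (fun p => L (h p)) q v = L (mvfderiv 𝓘(ℝ, E₀) h q v) := by
  have := mfderiv_comp (I := 𝓘(ℝ, E₀)) (I' := 𝓘(ℝ, V)) (I'' := 𝓘(ℝ, V')) q (g := L) (f := h)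
    L.mdifferentiableAt hh
  rw [L.mfderiv_eq] at this
  exact congrArg (fun T => T v) this

theorem mdifferentiableAt_clm_comp {E₀ : Type*} [NormedAddCommGroup E₀] [NormedSpace ℝ E₀]
    {M₀ : Type*} [TopologicalSpace M₀] [ChartedSpace E₀ M₀] {q : M₀}
    {V V' : Type*} [NormedAddCommGroup V] [NormedSpace ℝ V] [NormedAddCommGroup V']
    [NormedSpace ℝ V'] (L : V →L[ℝ] V') {h : M₀ → V}
    (hh : MDifferentiableAt 𝓘(ℝ, E₀) 𝓘(ℝ, V) h q) :
    MDifferentiableAt 𝓘(ℝ, E₀) 𝓘(ℝ, V') (fun p => L (h p)) q :=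
  MDifferentiableAt.comp (I' := 𝓘(ℝ, V)) q (g := L) L.mdifferentiableAt hh

theorem nabla_zero (v : TangentSpace 𝓘(ℝ, E) x) :
    nabla (fun y : M => (0 : TangentSpace 𝓘(ℝ, E) y)) x v = 0 := by
  have h0 : DiffField (fun y : M => (0 : TangentSpace 𝓘(ℝ, E) y)) x :=
    mdifferentiable_zeroSection ..
  have := nabla_smul (mdifferentiableAt_const (c := (0 : ℝ))) h0 v
  simpa [mvfderiv_const] using this

theorem nabla_sum {ι : Type*} (s : Finset ι) {Z : ι → ∀ x : M, TangentSpace 𝓘(ℝ, E) x}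
    (hZ : ∀ i ∈ s, DiffField (Z i) x) (v : TangentSpace 𝓘(ℝ, E) x) :
    nabla (fun y => ∑ i ∈ s, Z i y) x v = ∑ i ∈ s, nabla (Z i) x v := by
  classical
  induction s using Finset.induction_on with
  | empty => simpa using nabla_zero v
  | insert a s ha ih =>
    simp only [Finset.sum_insert ha]
    rw [← ih fun i hi => hZ i (Finset.mem_insert_of_mem hi)]
    exact nabla_add (hZ a (Finset.mem_insert_self _ _))
      (.sum_section fun i hi => hZ i (Finset.mem_insert_of_mem hi)) v

theorem nabla_const_smul (c : ℝ) (hY : DiffField Y x) (v : TangentSpace 𝓘(ℝ, E) x) :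
    nabla (fun y => c • Y y) x v = c • nabla Y x v := by
  have := nabla_smul (mdifferentiableAt_const (c := c)) hY v
  simpa [mvfderiv_const] using this

/-- `∇_u` of the field with constant coordinates `a`, as a linear function of `a`. -/
def nablaCoord (o x : M) (u : TangentSpace 𝓘(ℝ, E) x) (a : E) : TangentSpace 𝓘(ℝ, E) x :=
  nabla (fun p => coordVec o p a) x u

theorem nablaCoord_add (hx : x ∈ dom (E := E) o) (u : TangentSpace 𝓘(ℝ, E) x) (a b : E) :
    nablaCoord o x u (a + b) = nablaCoord o x u a + nablaCoord o x u b := by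
  simp only [nablaCoord, map_add]
  exact nabla_add (diffField_coordVec hx a) (diffField_coordVec hx b) u

theorem nablaCoord_smul (hx : x ∈ dom (E := E) o) (u : TangentSpace 𝓘(ℝ, E) x) (c : ℝ) (a : E) :
    nablaCoord o x u (c • a) = c • nablaCoord o x u a := by
  simp only [nablaCoord, map_smul]
  exact nabla_const_smul c (diffField_coordVec hx a) u

theorem nablaCoord_sum (hx : x ∈ dom (E := E) o) (u : TangentSpace 𝓘(ℝ, E) x) {ι : Type*}
    (s : Finset ι) (a : ι → E) :
    nablaCoord o x u (∑ i ∈ s, a i) = ∑ i ∈ s, nablaCoord o x u (a i) := by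
  simp only [nablaCoord, map_sum]
  exact nabla_sum s (fun i _ => diffField_coordVec hx (a i)) u

/-- The Levi-Civita connection in coordinates. -/
theorem nabla_eq_coord (hx : x ∈ dom (E := E) o) (hY : DiffField Y x)
    (u : TangentSpace 𝓘(ℝ, E) x) :
    nabla Y x u = coordVec o x (mvfderiv 𝓘(ℝ, E) (fun p => coordMap o p (Y p)) x u)
      + nablaCoord o x u (coordMap o x (Y x)) := by
  set b := Module.finBasis ℝ E
  set h : M → E := fun p => coordMap o p (Y p)
  have hh : MDifferentiableAt 𝓘(ℝ, E) 𝓘(ℝ, E) h x := (diffField_iff hx).1 hY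
  set c : ∀ i, E →L[ℝ] ℝ := fun i => (b.coord i).toContinuousLinearMap
  have hsum : ∀ a : E, ∑ i, c i a • b i = a := fun a => b.sum_repr a
  -- Near `x` the field is the sum of the `Z i`, function multiples of coordinate fields, so
  -- additivity and the Leibniz rule suffice.
  set Z : ∀ _ : Fin (Module.finrank ℝ E), ∀ p : M, TangentSpace 𝓘(ℝ, E) p :=
    fun i p => c i (h p) • coordVec o p (b i)
  have hYs : ∀ᶠ p in 𝓝 x, Y p = ∑ i, Z i p := by
    filter_upwards [dom_mem_nhds hx] with p hp
    simp only [Z, ← map_smul, ← map_sum, hsum, h, coordVec_coordMap hp]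
  have hZ : ∀ i ∈ Finset.univ, DiffField (Z i) x := fun i _ =>
    (mdifferentiableAt_clm_comp (c i) hh).smul_section (diffField_coordVec hx (b i))
  refine (nabla_congr (Y' := fun p => ∑ i, Z i p) hYs u).trans ?_
  rw [nabla_sum Finset.univ hZ]
  have h1 : ∀ i, nabla (Z i) x u
      = c i (h x) • nablaCoord o x u (b i)
        + c i (mvfderiv 𝓘(ℝ, E) h x u) • coordVec o x (b i) := fun i => by
    refine (nabla_smul (mdifferentiableAt_clm_comp (c i) hh) (diffField_coordVec hx (b i)) u).trans ?_
    rw [mvfderiv_clm_comp (c i) hh]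
    rfl
  simp only [h1, Finset.sum_add_distrib, ← nablaCoord_smul hx, ← nablaCoord_sum hx,
    ← map_smul, ← map_sum, hsum]
  rw [add_comm]

end ChartFormula

/-! ### The pullback connection: algebraic rules and independence of the chart. -/

section AlongFormula

set_option linter.unusedSectionVars false

variable {E : Type*} [NormedAddCommGroup E] [NormedSpace ℝ E]
  {M : Type*} [TopologicalSpace M] [ChartedSpace E M]
  {E' : Type*} [NormedAddCommGroup E'] [NormedSpace ℝ E'] [FiniteDimensional ℝ E']
  {N : Type*} [TopologicalSpace N] [ChartedSpace E' N] [IsManifold 𝓘(ℝ, E') ∞ N]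
  [RiemannianBundle (TangentSpace 𝓘(ℝ, E') : N → Type _)]
  [IsContMDiffRiemannianBundle 𝓘(ℝ, E') ∞ E' (TangentSpace 𝓘(ℝ, E') : N → Type _)]
  {F : M → N} {q : M} {W V : ∀ q, TangentSpace 𝓘(ℝ, E') (F q)}

/-- The vector field `W` along `F` is differentiable at `q`. -/
abbrev DiffAlong (F : M → N) (W : ∀ q, TangentSpace 𝓘(ℝ, E') (F q)) (q : M) : Prop :=
  MDifferentiableAt 𝓘(ℝ, E) 𝓘(ℝ, E').tangent
    (fun p => (⟨F p, W p⟩ : TangentBundle 𝓘(ℝ, E') N)) q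

theorem DiffAlong.base (hW : DiffAlong (E := E) F W q) :
    MDifferentiableAt 𝓘(ℝ, E) 𝓘(ℝ, E') F q :=
  (mdifferentiableAt_totalSpace 𝓘(ℝ, E') _ |>.1 hW).1

theorem diffAlong_iff {o : N} (hq : F q ∈ dom (E := E') o)
    (hF : MDifferentiableAt 𝓘(ℝ, E) 𝓘(ℝ, E') F q) :
    DiffAlong (E := E) F W q ↔
      MDifferentiableAt 𝓘(ℝ, E) 𝓘(ℝ, E') (fun p => coordMap o (F p) (W p)) q :=
  mdifferentiableAt_along_iff hq hF

/-- The definition of `nablaAlong` uses the chart centred at the moving point `F q`. The rules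
derived from this form lead to `nablaAlong_eq_coord`, where the chart is fixed and can be kept while
`q` varies. -/
theorem nablaAlong_eq_self (hF : ContinuousAt F q) (v : TangentSpace 𝓘(ℝ, E) q) :
    nablaAlong F W q v
      = coordVec (F q) (F q) (mvfderiv 𝓘(ℝ, E) (fun p => coordMap (F q) (F p) (W p)) q v)
        + nablaCoord (F q) (F q) (mfderiv 𝓘(ℝ, E) 𝓘(ℝ, E') F q v)
          (coordMap (F q) (F q) (W q)) := by
  rw [nablaAlong, nabla_congr (extend_eq _)]
  congr 1
  have : (fun p => (trivializationAt E' (TangentSpace 𝓘(ℝ, E') : N → Type _) (F q) ⟨F p, W p⟩).2)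
      =ᶠ[𝓝 q] fun p => coordMap (F q) (F p) (W p) := by
    filter_upwards [hF (dom_mem_nhds (E := E') (self_mem_dom (F q)))] with p hp
      using (coordMap_eq hp _).symm
  rw [mvfderiv_congr this]
  exact (Trivialization.symmL_apply _ (mem_baseSet (self_mem_dom (F q))) _).symm

theorem nablaAlong_congr {W' : ∀ q, TangentSpace 𝓘(ℝ, E') (F q)} (h : W =ᶠ[𝓝 q] W')
    (v : TangentSpace 𝓘(ℝ, E) q) : nablaAlong F W q v = nablaAlong F W' q v := by
  simp only [nablaAlong]
  rw [h.self_of_nhds, mvfderiv_congr (g := fun p => (trivializationAt E'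
    (TangentSpace 𝓘(ℝ, E') : N → Type _) (F q) ⟨F p, W' p⟩).2)]
  filter_upwards [h] with p hp using by rw [hp]

theorem nablaAlong_add (hW : DiffAlong (E := E) F W q) (hV : DiffAlong (E := E) F V q)
    (v : TangentSpace 𝓘(ℝ, E) q) :
    nablaAlong F (fun p => W p + V p) q v = nablaAlong F W q v + nablaAlong F V q v := by
  have hs := self_mem_dom (E := E') (F q)
  rw [nablaAlong_eq_self hW.base.continuousAt, nablaAlong_eq_self hW.base.continuousAt,
    nablaAlong_eq_self hW.base.continuousAt]
  simp only [map_add]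
  rw [mvfderiv_fun_add ((diffAlong_iff hs hW.base).1 hW) ((diffAlong_iff hs hW.base).1 hV),
    nablaCoord_add hs, add_apply, map_add]
  abel

theorem nablaAlong_smul {c : M → ℝ} (hc : MDifferentiableAt 𝓘(ℝ, E) 𝓘(ℝ, ℝ) c q)
    (hW : DiffAlong (E := E) F W q) (v : TangentSpace 𝓘(ℝ, E) q) :
    nablaAlong F (fun p => c p • W p) q v
      = c q • nablaAlong F W q v + mvfderiv 𝓘(ℝ, E) c q v • W q := by
  have hs := self_mem_dom (E := E') (F q)
  rw [nablaAlong_eq_self hW.base.continuousAt, nablaAlong_eq_self hW.base.continuousAt]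
  simp only [map_smul]
  rw [mvfderiv_fun_smul hc ((diffAlong_iff hs hW.base).1 hW), nablaCoord_smul hs]
  simp [coordVec_coordMap hs]
  abel

theorem nablaAlong_comp {Y : ∀ y : N, TangentSpace 𝓘(ℝ, E') y}
    (hF : MDifferentiableAt 𝓘(ℝ, E) 𝓘(ℝ, E') F q) (hY : DiffField Y (F q))
    (v : TangentSpace 𝓘(ℝ, E) q) :
    nablaAlong F (fun p => Y (F p)) q v
      = nabla Y (F q) (mfderiv 𝓘(ℝ, E) 𝓘(ℝ, E') F q v) := by
  have hs := self_mem_dom (E := E') (F q)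
  rw [nablaAlong_eq_self hF.continuousAt, nabla_eq_coord hs hY]
  congr 2
  exact congrArg (fun T => T v) (mfderiv_comp q ((diffField_iff hs).1 hY) hF)

theorem diffAlong_smul {c : M → ℝ} (hc : MDifferentiableAt 𝓘(ℝ, E) 𝓘(ℝ, ℝ) c q)
    (hW : DiffAlong (E := E) F W q) : DiffAlong (E := E) F (fun p => c p • W p) q := by
  have hs := self_mem_dom (E := E') (F q)
  rw [diffAlong_iff hs hW.base] at *
  simp only [map_smul]
  exact hc.smul hW

theorem diffAlong_add (hW : DiffAlong (E := E) F W q) (hV : DiffAlong (E := E) F V q) :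
    DiffAlong (E := E) F (fun p => W p + V p) q := by
  have hs := self_mem_dom (E := E') (F q)
  have hF := hW.base
  rw [diffAlong_iff hs hF] at *
  simp only [map_add]
  exact hW.add hV

theorem diffAlong_comp {Y : ∀ y : N, TangentSpace 𝓘(ℝ, E') y}
    (hF : MDifferentiableAt 𝓘(ℝ, E) 𝓘(ℝ, E') F q) (hY : DiffField Y (F q)) :
    DiffAlong (E := E) F (fun p => Y (F p)) q :=
  MDifferentiableAt.comp (I' := 𝓘(ℝ, E')) q hY hF

theorem nablaAlong_zero (hF : MDifferentiableAt 𝓘(ℝ, E) 𝓘(ℝ, E') F q)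
    (v : TangentSpace 𝓘(ℝ, E) q) :
    nablaAlong F (fun p => (0 : TangentSpace 𝓘(ℝ, E') (F p))) q v = 0 := by
  have h0 : DiffField (fun y : N => (0 : TangentSpace 𝓘(ℝ, E') y)) (F q) :=
    mdifferentiable_zeroSection ..
  rw [nablaAlong_comp hF h0, nabla_zero]

theorem nablaAlong_sum (hF : MDifferentiableAt 𝓘(ℝ, E) 𝓘(ℝ, E') F q)
    {ι : Type*} (s : Finset ι) {Z : ι → ∀ q : M, TangentSpace 𝓘(ℝ, E') (F q)}
    (hZ : ∀ i ∈ s, DiffAlong (E := E) F (Z i) q) (v : TangentSpace 𝓘(ℝ, E) q) :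
    DiffAlong (E := E) F (fun p => ∑ i ∈ s, Z i p) q ∧
    nablaAlong F (fun p => ∑ i ∈ s, Z i p) q v = ∑ i ∈ s, nablaAlong F (Z i) q v := by
  classical
  induction s using Finset.induction_on with
  | empty =>
    have h0 : DiffField (fun y : N => (0 : TangentSpace 𝓘(ℝ, E') y)) (F q) :=
      mdifferentiable_zeroSection ..
    simpa using ⟨diffAlong_comp hF h0, nablaAlong_zero hF v⟩
  | insert a s ha ih =>
    simp only [Finset.sum_insert ha]
    obtain ⟨h1, h2⟩ := ih fun i hi => hZ i (Finset.mem_insert_of_mem hi)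
    have h3 := hZ a (Finset.mem_insert_self _ _)
    exact ⟨diffAlong_add h3 h1, by rw [nablaAlong_add h3 h1, h2]⟩

/-- The pullback connection in coordinates. -/
theorem nablaAlong_eq_coord {o : N} (hq : F q ∈ dom (E := E') o)
    (hW : DiffAlong (E := E) F W q) (v : TangentSpace 𝓘(ℝ, E) q) :
    nablaAlong F W q v
      = coordVec o (F q) (mvfderiv 𝓘(ℝ, E) (fun p => coordMap o (F p) (W p)) q v)
        + nablaCoord o (F q) (mfderiv 𝓘(ℝ, E) 𝓘(ℝ, E') F q v) (coordMap o (F q) (W q)) := by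
  have hF := hW.base
  set b := Module.finBasis ℝ E'
  set h : M → E' := fun p => coordMap o (F p) (W p)
  have hh : MDifferentiableAt 𝓘(ℝ, E) 𝓘(ℝ, E') h q := (diffAlong_iff hq hF).1 hW
  set c : ∀ i, E' →L[ℝ] ℝ := fun i => (b.coord i).toContinuousLinearMap
  have hsum : ∀ a : E', ∑ i, c i a • b i = a := fun a => b.sum_repr a
  set Z : ∀ _ : Fin (Module.finrank ℝ E'), ∀ p : M, TangentSpace 𝓘(ℝ, E') (F p) :=
    fun i p => c i (h p) • coordVec o (F p) (b i)
  have hYs : ∀ᶠ p in 𝓝 q, W p = ∑ i, Z i p := by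
    filter_upwards [hF.continuousAt (dom_mem_nhds hq)] with p hp
    simp only [Z, ← map_smul, ← map_sum, hsum, h, coordVec_coordMap (o := o) (y := F p) hp]
  have hC : ∀ i, DiffAlong (E := E) F (fun p => coordVec o (F p) (b i)) q := fun i =>
    diffAlong_comp (Y := fun y => coordVec o y (b i)) hF (diffField_coordVec hq _)
  have hZ : ∀ i ∈ Finset.univ, DiffAlong (E := E) F (Z i) q := fun i _ =>
    diffAlong_smul (mdifferentiableAt_clm_comp (c i) hh) (hC i)
  refine (nablaAlong_congr (W' := fun p => ∑ i, Z i p) hYs v).trans ?_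
  rw [(nablaAlong_sum hF Finset.univ hZ v).2]
  have h1 : ∀ i, nablaAlong F (Z i) q v
      = c i (h q) • nablaCoord o (F q) (mfderiv 𝓘(ℝ, E) 𝓘(ℝ, E') F q v) (b i)
        + c i (mvfderiv 𝓘(ℝ, E) h q v) • coordVec o (F q) (b i) := fun i => by
    refine (nablaAlong_smul (mdifferentiableAt_clm_comp (c i) hh) (hC i) v).trans ?_
    rw [mvfderiv_clm_comp (c i) hh,
      nablaAlong_comp (Y := fun y => coordVec o y (b i)) hF (diffField_coordVec hq _)]
    rfl
  simp only [h1, Finset.sum_add_distrib, ← nablaCoord_smul hq, ← nablaCoord_sum hq,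
    ← map_smul, ← map_sum, hsum]
  rw [add_comm]

end AlongFormula

/-! ### Christoffel symbols of a metric on an open part of a vector space. -/

section BilinearFamily

variable {E : Type*} [NormedAddCommGroup E] [NormedSpace ℝ E] [FiniteDimensional ℝ E]

/-- A family of linear maps which is smooth on constant vectors is smooth. -/
theorem contDiffAt_clm_of_apply {V V₁ V₂ : Type*} [NormedAddCommGroup V] [NormedSpace ℝ V]
    [NormedAddCommGroup V₁] [NormedSpace ℝ V₁] [FiniteDimensional ℝ V₁]
    [NormedAddCommGroup V₂] [NormedSpace ℝ V₂] {n : ℕ∞ω} {T : V → V₁ →L[ℝ] V₂} {x : V}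
    (h : ∀ a, ContDiffAt ℝ n (fun z => T z a) x) : ContDiffAt ℝ n T x := by
  set b := Module.finBasis ℝ V₁
  set c : ∀ i, V₁ →L[ℝ] ℝ := fun i => (b.coord i).toContinuousLinearMap
  have : T = fun z => ∑ i, (c i).smulRight (T z (b i)) := by
    funext z
    ext a
    have : ∑ i, c i a • b i = a := b.sum_repr a
    conv_lhs => rw [← this]
    simp
  rw [this]
  refine ContDiffAt.sum fun i _ => ?_
  exact (ContinuousLinearMap.smulRightL ℝ V₁ V₂ (c i)).contDiff.contDiffAt.comp x (h (b i))


set_option linter.unusedSectionVars false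

variable (g : E → E →L[ℝ] E →L[ℝ] ℝ) {x : E}

/-- The one-form `c ↦ ½ (D_u g(a,c) + D_a g(u,c) - D_c g(u,a))`. -/
def christoffelForm (x u a : E) : E →L[ℝ] ℝ :=
  (1 / 2 : ℝ) • (fderiv ℝ g x u a + fderiv ℝ g x a u - ((fderiv ℝ g x).flip u).flip a)

/-- The Christoffel symbols of a metric on a vector space. -/
def christoffel (x u : E) : E →L[ℝ] E :=
  LinearMap.toContinuousLinearMap
    { toFun := fun a => (g x).inverse (christoffelForm g x u a)
      map_add' := fun a b => by
        rw [← map_add]; congr 1; ext c; simp [christoffelForm]; ring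
      map_smul' := fun r a => by
        rw [RingHom.id_apply, ← map_smul]; congr 1; ext c; simp [christoffelForm]; ring }

theorem christoffel_apply (x u a : E) :
    christoffel g x u a = (g x).inverse (christoffelForm g x u a) := rfl

theorem christoffel_add (x u v : E) :
    christoffel g x (u + v) = christoffel g x u + christoffel g x v := by
  ext a
  rw [add_apply]
  simp only [christoffel_apply]
  rw [← map_add]; congr 1; ext c; simp [christoffelForm]; ring

variable {g}

theorem inverse_apply_self {V W : Type*} [NormedAddCommGroup V] [NormedSpace ℝ V]
    [NormedAddCommGroup W] [NormedSpace ℝ W] {T : V →L[ℝ] W} (hT : T.IsInvertible) (a : V) :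
    T.inverse (T a) = a := by
  obtain ⟨e, rfl⟩ := hT
  rw [ContinuousLinearMap.inverse_equiv]
  simp

theorem self_apply_inverse {V W : Type*} [NormedAddCommGroup V] [NormedSpace ℝ V]
    [NormedAddCommGroup W] [NormedSpace ℝ W] {T : V →L[ℝ] W} (hT : T.IsInvertible) (a : W) :
    T (T.inverse a) = a := by
  obtain ⟨e, rfl⟩ := hT
  rw [ContinuousLinearMap.inverse_equiv]
  simp

theorem contDiffAt_inverse {V V₁ V₂ : Type*} [NormedAddCommGroup V] [NormedSpace ℝ V]
    [NormedAddCommGroup V₁] [NormedSpace ℝ V₁] [CompleteSpace V₁]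
    [NormedAddCommGroup V₂] [NormedSpace ℝ V₂] {n : ℕ∞ω} {T : V → V₁ →L[ℝ] V₂} {x : V}
    (hT : ContDiffAt ℝ n T x) (hi : (T x).IsInvertible) :
    ContDiffAt ℝ n (fun z => (T z).inverse) x := by
  obtain ⟨e, he⟩ := hi
  have h := contDiffAt_map_inverse (𝕜 := ℝ) (n := n) e
  rw [he] at h
  exact h.comp x hT

theorem fderiv_clm_apply₂ (hg : DifferentiableAt ℝ g x) (u a b : E) :
    fderiv ℝ (fun z => g z a b) x u = fderiv ℝ g x u a b := by
  have h1 := (hg.hasFDerivAt.clm_apply (hasFDerivAt_const a x)).clm_apply (hasFDerivAt_const b x)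
  rw [h1.fderiv]
  simp

theorem fderiv_metric_comm (hg : DifferentiableAt ℝ g x) (hs : ∀ z a b, g z a b = g z b a)
    (u a b : E) : fderiv ℝ g x u a b = fderiv ℝ g x u b a := by
  rw [← fderiv_clm_apply₂ hg, ← fderiv_clm_apply₂ hg]
  simp only [hs _ a b]

theorem christoffel_comm (hg : DifferentiableAt ℝ g x) (hs : ∀ z a b, g z a b = g z b a)
    (u a : E) : christoffel g x u a = christoffel g x a u := by
  simp only [christoffel_apply]
  congr 1; ext c; simp [christoffelForm, fderiv_metric_comm hg hs c u a]; ring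

theorem metric_christoffel (hi : (g x).IsInvertible) (u a c : E) :
    g x (christoffel g x u a) c = 1 / 2 * (fderiv ℝ g x u a c
      + fderiv ℝ g x a u c - fderiv ℝ g x c u a) := by
  rw [christoffel_apply, self_apply_inverse hi]
  simp [christoffelForm]

/-- Metric compatibility. -/
theorem fderiv_metric (hg : DifferentiableAt ℝ g x) (hs : ∀ z a b, g z a b = g z b a)
    (hi : (g x).IsInvertible) (u a b : E) :
    fderiv ℝ g x u a b = g x (christoffel g x u a) b + g x a (christoffel g x u b) := by
  rw [hs x a, metric_christoffel hi, metric_christoffel hi, fderiv_metric_comm hg hs a u b,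
    fderiv_metric_comm hg hs b u a, fderiv_metric_comm hg hs u b a]
  ring

theorem contDiffAt_christoffel_apply (hg : ContDiffAt ℝ ∞ g x) (hi : (g x).IsInvertible)
    (u a : E) :
    ContDiffAt ℝ ∞ (fun p : E × E × E => christoffel g p.1 p.2.1 p.2.2) (x, u, a) := by
  have h1 : ContDiffAt ℝ ∞ (fun p : E × E × E => (g p.1).inverse) (x, u, a) :=
    (contDiffAt_inverse hg hi).comp (x, u, a) contDiffAt_fst
  have h2 : ContDiffAt ℝ ∞ (fun p : E × E × E => fderiv ℝ g p.1) (x, u, a) :=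
    (hg.fderiv_right (m := ∞) (by simp)).comp (x, u, a) contDiffAt_fst
  have hu : ContDiffAt ℝ ∞ (fun p : E × E × E => p.2.1) (x, u, a) := by fun_prop
  have ha : ContDiffAt ℝ ∞ (fun p : E × E × E => p.2.2) (x, u, a) := by fun_prop
  simp only [christoffel_apply, christoffelForm]
  have h3 : ContDiffAt ℝ ∞ (fun p : E × E × E => (fderiv ℝ g p.1).flip) (x, u, a) :=
    (ContinuousLinearMap.flipₗᵢ ℝ E E (E →L[ℝ] ℝ)).contDiff.contDiffAt.comp _ h2
  have h4 : ContDiffAt ℝ ∞ (fun p : E × E × E => ((fderiv ℝ g p.1).flip p.2.1).flip) (x, u, a) :=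
    (ContinuousLinearMap.flipₗᵢ ℝ E E ℝ).contDiff.contDiffAt.comp _ (h3.clm_apply hu)
  have h5 := (((h2.clm_apply hu).clm_apply ha).add ((h2.clm_apply ha).clm_apply hu)).sub
    (h4.clm_apply ha)
  exact h1.clm_apply ((contDiffAt_const (c := (1 / 2 : ℝ))).smul h5)

end BilinearFamily

/-! ### The metric and its connection read in a chart. -/

section Metric

set_option linter.unusedSectionVars false

variable {E : Type*} [NormedAddCommGroup E] [NormedSpace ℝ E] [FiniteDimensional ℝ E]
  {M : Type*} [TopologicalSpace M] [ChartedSpace E M] [IsManifold 𝓘(ℝ, E) ∞ M]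
  [RiemannianBundle (TangentSpace 𝓘(ℝ, E) : M → Type _)]
  [IsContMDiffRiemannianBundle 𝓘(ℝ, E) ∞ E (TangentSpace 𝓘(ℝ, E) : M → Type _)]

/-- The point with given coordinates in the chart centred at `o`. -/
def pt (o : M) (x : E) : M := (extChartAt 𝓘(ℝ, E) o).symm x

variable {o : M} {x : E}

theorem pt_mem_dom (hx : x ∈ cod o) : pt o x ∈ dom (E := E) o := symm_mem_dom hx

/-- The metric in coordinates. -/
def metric (o : M) (x : E) : E →L[ℝ] E →L[ℝ] ℝ :=
  (LinearMap.mk₂ ℝ (fun a b => inner ℝ (coordVec o (pt o x) a) (coordVec o (pt o x) b))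
    (by simp [inner_add_left]) (by simp [inner_smul_left])
    (by simp [inner_add_right]) (by simp [inner_smul_right])).toContinuousBilinearMap

theorem metric_apply (o : M) (x a b : E) :
    metric o x a b = inner ℝ (coordVec o (pt o x) a) (coordVec o (pt o x) b) := rfl

theorem metric_comm (o : M) (x a b : E) : metric o x a b = metric o x b a :=
  real_inner_comm (coordVec o (pt o x) b) (coordVec o (pt o x) a)

theorem contMDiffAt_inner {X Y : ∀ x : M, TangentSpace 𝓘(ℝ, E) x} {y : M}
    (hX : ContMDiffAt 𝓘(ℝ, E) 𝓘(ℝ, E).tangent ∞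
      (fun p => (⟨p, X p⟩ : TangentBundle 𝓘(ℝ, E) M)) y)
    (hY : ContMDiffAt 𝓘(ℝ, E) 𝓘(ℝ, E).tangent ∞
      (fun p => (⟨p, Y p⟩ : TangentBundle 𝓘(ℝ, E) M)) y) :
    ContMDiffAt 𝓘(ℝ, E) 𝓘(ℝ, ℝ) ∞ (fun p => inner ℝ (X p) (Y p)) y :=
  ContMDiffAt.inner_bundle hX hY

theorem contMDiffAt_inner_coordVec {y : M} (hy : y ∈ dom (E := E) o) (a b : E) :
    ContMDiffAt 𝓘(ℝ, E) 𝓘(ℝ, ℝ) ∞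
      (fun p : M => inner ℝ (coordVec o p a) (coordVec o p b)) y :=
  contMDiffAt_inner (contMDiffAt_coordVec hy a) (contMDiffAt_coordVec hy b)

theorem contDiffAt_metric (hx : x ∈ cod o) : ContDiffAt ℝ ∞ (metric (E := E) o) x :=
  contDiffAt_clm_of_apply fun a => contDiffAt_clm_of_apply fun b =>
    contDiffAt_chart_symm hx (contMDiffAt_inner_coordVec (symm_mem_dom hx) a b)

theorem metric_injective (hx : x ∈ cod o) : Function.Injective (metric (E := E) o x) := by
  refine (injective_iff_map_eq_zero _).2 fun a ha => ?_
  have h : metric o x a a = 0 := by rw [ha]; rfl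
  rw [metric_apply, inner_self_eq_zero] at h
  rw [← coordMap_coordVec (pt_mem_dom hx) a, h, map_zero]

theorem metric_isInvertible (hx : x ∈ cod o) : (metric (E := E) o x).IsInvertible := by
  have hf : Module.finrank ℝ E = Module.finrank ℝ (E →L[ℝ] ℝ) := by
    rw [← (LinearMap.toContinuousLinearMap (𝕜 := ℝ) (E := E) (F' := ℝ)).finrank_eq]
    exact (Subspace.dual_finrank_eq).symm
  exact ⟨(LinearEquiv.ofInjectiveOfFinrankEq (metric o x).toLinearMap (metric_injective hx)
    hf).toContinuousLinearEquiv, rfl⟩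

theorem differentiableAt_metric (hx : x ∈ cod o) : DifferentiableAt ℝ (metric (E := E) o) x :=
  (contDiffAt_metric hx).differentiableAt (by simp)

theorem koszul_coordVec (hx : x ∈ cod o) (u a c : E) :
    koszul (fun p => coordVec o p u) (fun p => coordVec o p a) (fun p => coordVec o p c) (pt o x)
      = fderiv ℝ (metric o) x u a c + fderiv ℝ (metric o) x a u c
        - fderiv ℝ (metric o) x c u a := by
  have hy := pt_mem_dom hx
  have hd : DifferentiableAt ℝ (metric (E := E) o) x := differentiableAt_metric hx
  have key : ∀ u a b : E, mvfderiv 𝓘(ℝ, E)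
      (fun p : M => inner ℝ (coordVec o p a) (coordVec o p b)) (pt o x) (coordVec o (pt o x) u)
      = fderiv ℝ (metric o) x u a b := by
    intro u a b
    rw [mvfderiv_coordVec hy ((contMDiffAt_inner_coordVec hy a b).mdifferentiableAt (by simp)),
      pt, chart_right_inv hx]
    exact fderiv_clm_apply₂ hd u a b
  simp only [koszul, key]
  rw [mlieBracket_coordVec hy, mlieBracket_coordVec hy, mlieBracket_coordVec hy]
  simp

/-- Coordinate fields commute, so Koszul's formula for them reduces to the derivatives of the metric
coefficients that define `christoffel`. -/
theorem nablaCoord_coordVec (hx : x ∈ cod o) (u a : E) :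
    nablaCoord o (pt o x) (coordVec o (pt o x) u) a = coordVec o (pt o x) (christoffel (metric o) x u a) := by
  have hy := pt_mem_dom hx
  refine ext_inner_right ℝ fun v => ?_
  rw [← coordVec_coordMap hy v, ← metric_apply, metric_christoffel (metric_isInvertible hx), ← koszul_coordVec hx]
  rw [← two_mul_inner_nabla (diffField_coordVec hy u) (diffField_coordVec hy a)
    (diffField_coordVec hy _), nablaCoord]
  ring

variable {Y : ∀ x : M, TangentSpace 𝓘(ℝ, E) x}

/-- A vector field in coordinates. -/
def fieldHat (o : M) (Y : ∀ x : M, TangentSpace 𝓘(ℝ, E) x) (x : E) : E :=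
  coordMap o (pt o x) (Y (pt o x))

/-- The Levi-Civita connection in coordinates. -/
theorem coordMap_nabla (hx : x ∈ cod o) (hY : DiffField Y (pt o x)) (u : E) :
    coordMap o (pt o x) (nabla Y (pt o x) (coordVec o (pt o x) u))
      = fderiv ℝ (fieldHat o Y) x u + christoffel (metric o) x u (fieldHat o Y x) := by
  have hy := pt_mem_dom hx
  rw [nabla_eq_coord hy hY, nablaCoord_coordVec hx, map_add, coordMap_coordVec hy,
    coordMap_coordVec hy, mvfderiv_coordVec hy ((diffField_iff hy).1 hY)]
  simp only [pt, chart_right_inv hx]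
  rfl

end Metric

/-! ### Integral curves, and broken curves filling a neighbourhood. -/

section Curves

set_option linter.unusedSectionVars false

/-- Integral curves of a smooth vector field on an open set. -/
theorem exists_integralCurve {V : Type*} [NormedAddCommGroup V] [NormedSpace ℝ V]
    [CompleteSpace V] {Z : V → V} {U : Set V} (hU : IsOpen U)
    (hZ : ∀ x ∈ U, ContDiffAt ℝ ∞ Z x) {x₀ : V} (hx₀ : x₀ ∈ U) :
    ∃ (w : ℝ → V) (ε : ℝ), 0 < ε ∧ w 0 = x₀ ∧ (∀ t ∈ Ioo (-ε) ε, w t ∈ U) ∧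
      (∀ t ∈ Ioo (-ε) ε, HasDerivAt w (Z (w t)) t) ∧ ContDiffOn ℝ ∞ w (Ioo (-ε) ε) := by
  obtain ⟨w, hw0, ε, hε, hw⟩ :=
    ((hZ x₀ hx₀).of_le (by simp) :
      ContDiffAt ℝ 1 Z x₀).exists_forall_mem_closedBall_exists_eq_forall_mem_Ioo_hasDerivAt₀ 0
  simp only [zero_sub, zero_add] at hw
  have hc : ContinuousAt w 0 := (hw 0 ⟨by linarith, hε⟩).continuousAt
  have hm : w ⁻¹' U ∈ 𝓝 (0 : ℝ) := hc (by rw [hw0]; exact hU.mem_nhds hx₀)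
  obtain ⟨δ, hδ, hδU⟩ := Metric.mem_nhds_iff.1 hm
  set η := min ε δ / 2
  have hη : 0 < η := by positivity
  have hηε : η < ε := lt_of_lt_of_le (half_lt_self (by positivity)) (min_le_left _ _)
  have hηδ : η < δ := lt_of_lt_of_le (half_lt_self (by positivity)) (min_le_right _ _)
  have hIU : ∀ t ∈ Icc (-η) η, w t ∈ U := fun t ht => hδU (by
    rw [Metric.mem_ball, Real.dist_eq, sub_zero, abs_lt]; exact ⟨by linarith [ht.1], by linarith [ht.2]⟩)
  have hD : ∀ t ∈ Icc (-η) η, HasDerivAt w (Z (w t)) t := fun t ht =>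
    hw t ⟨by linarith [ht.1], by linarith [ht.2]⟩
  refine ⟨w, η, hη, hw0, fun t ht => hIU t (Ioo_subset_Icc_self ht),
    fun t ht => hD t (Ioo_subset_Icc_self ht), ?_⟩
  refine ContDiffOn.mono ?_ Ioo_subset_Icc_self
  refine ODE.contDiffOn_enat_Icc_of_hasDerivWithinAt (n := ⊤) (f := fun _ => Z) (u := U) ?_
    (fun t ht => (hD t ht).hasDerivWithinAt) hIU
  intro p hp
  exact ((hZ p.2 hp.2).comp p contDiffAt_snd).contDiffWithinAt

/-- The Picard-Lindelöf theorem, with the solution confined to the ball. -/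
theorem exists_hasDerivWithinAt_mem_closedBall {V : Type*} [NormedAddCommGroup V]
    [NormedSpace ℝ V] [CompleteSpace V] {f : ℝ → V → V} {tmin tmax : ℝ} {t₀ : Icc tmin tmax}
    {x₀ x : V} {a r L K : NNReal} (hf : IsPicardLindelof f t₀ x₀ a r L K)
    (hx : x ∈ Metric.closedBall x₀ r) :
    ∃ α : ℝ → V, α t₀ = x ∧ (∀ t, α t ∈ Metric.closedBall x₀ a) ∧
      ∀ t ∈ Icc tmin tmax, HasDerivWithinAt α (f t (α t)) (Icc tmin tmax) t := by
  obtain ⟨α, hα⟩ := ODE.FunSpace.exists_isFixedPt_next hf hx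
  have hmem : ∀ t, α.compProj t ∈ Metric.closedBall x₀ a := fun t =>
    α.compProj_mem_closedBall hf.mul_max_le
  refine ⟨α.compProj, by rw [ODE.FunSpace.compProj_val, ← hα, ODE.FunSpace.next_apply₀], hmem,
    fun t ht ↦ ?_⟩
  apply ODE.hasDerivWithinAt_picard_Icc t₀.2 hf.continuousOn_uncurry
    α.continuous_compProj.continuousOn (fun _ _ ↦ hmem _) x ht |>.congr_of_mem _ ht
  intro t' ht'
  nth_rw 1 [← hα]
  rw [ODE.FunSpace.compProj_of_mem ht', ODE.FunSpace.next_apply]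

/-- The first half of a smooth monotone path from `0` to `1`, and the second half. -/
def firstRamp (t : ℝ) : ℝ := Real.smoothTransition t

def secondRamp (t : ℝ) : ℝ := Real.smoothTransition (t - 1)

theorem contDiff_firstRamp : ContDiff ℝ ∞ firstRamp := Real.smoothTransition.contDiff

theorem contDiff_secondRamp : ContDiff ℝ ∞ secondRamp :=
  Real.smoothTransition.contDiff.comp (contDiff_id.sub contDiff_const)

/-- The endpoint `t = 1` is included by continuity of the derivative. With
`deriv_firstRamp_eq_zero`, exactly one of the two motions is switched on in each of the closed
intervals `[0,1]` and `[1,2]`. -/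
theorem deriv_secondRamp_eq_zero {t : ℝ} (ht : t ≤ 1) : deriv secondRamp t = 0 := by
  have hc : ContDiff ℝ 1 secondRamp := contDiff_secondRamp.of_le (by simp)
  have h1 : EqOn (deriv secondRamp) (fun _ => 0) (Iio 1) := fun s hs => by
    have : secondRamp =ᶠ[𝓝 s] fun _ => 0 := by
      filter_upwards [Iio_mem_nhds hs] with r hr
      exact Real.smoothTransition.zero_of_nonpos (by linarith [mem_Iio.1 hr])
    rw [this.deriv_eq]; simp
  have h2 := h1.closure (hc.continuous_deriv le_rfl) continuous_const
  rw [closure_Iio] at h2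
  exact h2 ht

theorem deriv_firstRamp_eq_zero {t : ℝ} (ht : 1 ≤ t) : deriv firstRamp t = 0 := by
  have hc : ContDiff ℝ 1 firstRamp := contDiff_firstRamp.of_le (by simp)
  have h1 : EqOn (deriv firstRamp) (fun _ => 0) (Ioi 1) := fun s hs => by
    have : firstRamp =ᶠ[𝓝 s] fun _ => 1 := by
      filter_upwards [Ioi_mem_nhds hs] with r hr
      exact Real.smoothTransition.one_of_one_le (le_of_lt hr)
    rw [this.deriv_eq]; simp
  have h2 := h1.closure (hc.continuous_deriv le_rfl) continuous_const
  rw [closure_Ioi] at h2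
  exact h2 ht

variable {V : Type*} [NormedAddCommGroup V] [NormedSpace ℝ V] [CompleteSpace V]

theorem norm_image_le_of_hasDerivWithinAt {w w' : ℝ → V} {C : ℝ}
    (hw : ∀ t ∈ Icc (0 : ℝ) 2, HasDerivWithinAt w (w' t) (Icc 0 2) t)
    (hC : ∀ t ∈ Icc (0 : ℝ) 2, ‖w' t‖ ≤ C) (h0 : w 0 = 0) {t : ℝ} (ht : t ∈ Icc (0 : ℝ) 2) :
    ‖w t‖ ≤ 2 * C := by
  have := norm_image_sub_le_of_norm_deriv_le_segment' hw (fun t ht => hC t (Ico_subset_Icc_self ht)) t ht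
  rw [h0, sub_zero, sub_zero] at this
  have hC0 : 0 ≤ C := (norm_nonneg _).trans (hC 0 ⟨le_rfl, by norm_num⟩)
  nlinarith [ht.2]

/-- Points near `x₀` are reached from `x₀` by moving first in direction `A s`, then in direction
`(1 - A) s`. -/
theorem exists_broken_curve {A : V → V →L[ℝ] V} {x₀ : V} (hA : ContDiffAt ℝ 1 A x₀)
    {U : Set V} (hU : U ∈ 𝓝 x₀) :
    ∀ᶠ z in 𝓝 x₀, ∃ (s : V) (γ : ℝ → V), γ 0 = x₀ ∧ γ 2 = z ∧ (∀ t ∈ Icc (0 : ℝ) 2, γ t ∈ U) ∧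
      ∀ t ∈ Icc (0 : ℝ) 2, HasDerivWithinAt γ
        (deriv firstRamp t • A (γ t) s + deriv secondRamp t • (s - A (γ t) s)) (Icc 0 2) t := by
  set α := deriv firstRamp
  set β := deriv secondRamp
  have hαc : Continuous α := (contDiff_firstRamp.of_le (by simp) : ContDiff ℝ 1 _).continuous_deriv le_rfl
  have hβc : Continuous β := (contDiff_secondRamp.of_le (by simp) : ContDiff ℝ 1 _).continuous_deriv le_rfl
  obtain ⟨m₁, hm₁⟩ := isCompact_Icc.exists_bound_of_continuousOn
    (s := Icc (0 : ℝ) 2) (hαc.sub hβc).continuousOn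
  obtain ⟨m₂, hm₂⟩ := isCompact_Icc.exists_bound_of_continuousOn
    (s := Icc (0 : ℝ) 2) hβc.continuousOn
  set m := max (max m₁ m₂) 1
  have hm : (1 : ℝ) ≤ m := le_max_right _ _
  have hκ : ∀ t ∈ Icc (0 : ℝ) 2, |α t - β t| ≤ m := fun t ht =>
    (hm₁ t ht).trans ((le_max_left _ _).trans (le_max_left _ _))
  have hβ : ∀ t ∈ Icc (0 : ℝ) 2, |β t| ≤ m := fun t ht =>
    (hm₂ t ht).trans ((le_max_right _ _).trans (le_max_left _ _))
  obtain ⟨L₀, S, hS, hL₀⟩ := hA.exists_lipschitzOnWith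
  set L : ℝ := L₀ + 1
  have hL : 0 < L := by positivity
  obtain ⟨ρ₀, hρ₀, hρS⟩ := Metric.mem_nhds_iff.1 (Filter.inter_mem hS hU)
  -- The first bound keeps the closed ball inside the Lipschitz neighbourhood and `U`. The second
  -- makes the error from freezing `A` at `x₀` at most a quarter of `‖d‖` (`e2` below).
  set ρ : ℝ := min (ρ₀ / 2) (1 / (8 * m * L))
  have hρ : 0 < ρ := by positivity
  have hρ1 : 8 * m * L * ρ ≤ 1 := by
    calc 8 * m * L * ρ ≤ 8 * m * L * (1 / (8 * m * L)) := by gcongr; exact min_le_right _ _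
      _ = 1 := by field_simp
  have hball : Metric.closedBall x₀ ρ ⊆ S ∩ U := by
    refine subset_trans (Metric.closedBall_subset_ball ?_) hρS
    exact (min_le_left _ _).trans_lt (half_lt_self hρ₀)
  have hLip : ∀ x ∈ Metric.closedBall x₀ ρ, ∀ y ∈ Metric.closedBall x₀ ρ,
      ‖A x - A y‖ ≤ L * ‖x - y‖ := fun x hx y hy =>
    (hL₀.norm_sub_le (hball hx).1 (hball hy).1).trans (by gcongr; simp [L])
  set K : ℝ := ‖A x₀‖ + L * ρ
  have hK : ∀ x ∈ Metric.closedBall x₀ ρ, ‖A x‖ ≤ K := fun x hx => by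
    have h1 := hLip x hx x₀ (Metric.mem_closedBall_self hρ.le)
    have h2 : ‖x - x₀‖ ≤ ρ := by rwa [← dist_eq_norm]
    calc ‖A x‖ ≤ ‖A x₀‖ + ‖A x - A x₀‖ := norm_le_insert' _ _
      _ ≤ K := by simp only [K]; gcongr; exact h1.trans (by gcongr)
  have hK0 : 0 ≤ K := by positivity
  set C : ℝ := m * (K + 1)
  have hC : 0 < C := by positivity
  -- For `‖s‖ ≤ δ` the speed is at most `C * δ`, so over time `2` the curve stays within `ρ` of
  -- `x₀`. The other bound serves twice: `4mLδ ≤ 1` absorbs a term in the estimate of `w`, and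
  -- `64mLCδ ≤ 1` makes the remaining error at most an eighth of `‖d‖`.
  set δ : ℝ := min (ρ / (2 * C)) (1 / (64 * m * L * C + 4 * m * L))
  have hδ : 0 < δ := by positivity
  have hδ1 : 2 * C * δ ≤ ρ := by
    calc 2 * C * δ ≤ 2 * C * (ρ / (2 * C)) := by gcongr; exact min_le_left _ _
      _ = ρ := by field_simp
  have hδ2 : (64 * m * L * C + 4 * m * L) * δ ≤ 1 := by
    calc (64 * m * L * C + 4 * m * L) * δ ≤
        (64 * m * L * C + 4 * m * L) * (1 / (64 * m * L * C + 4 * m * L)) := by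
          gcongr; exact min_le_right _ _
      _ = 1 := by field_simp
  have hδ3 : 64 * m * L * C * δ ≤ 1 := by nlinarith [show 0 < 4 * m * L * δ by positivity]
  have hδ4 : 4 * m * L * δ ≤ 1 := by nlinarith [show 0 < 64 * m * L * C * δ by positivity]
  set v : V → ℝ → V → V := fun s t x => α t • A x s + β t • (s - A x s)
  have hv : ∀ s t x, v s t x = (α t - β t) • A x s + β t • s := fun s t x => by
    simp only [v, smul_sub, sub_smul]; abel
  -- The bound on `s` is placed after the existential so that `choose` yields a curve for every `s`,
  -- with a dummy value outside the ball.
  have hex : ∀ s : V, ∃ γ : ℝ → V, s ∈ Metric.closedBall (0 : V) δ → (γ 0 = x₀ ∧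
      (∀ t, γ t ∈ Metric.closedBall x₀ ρ) ∧
      ∀ t ∈ Icc (0 : ℝ) 2, HasDerivWithinAt γ (v s t (γ t)) (Icc 0 2) t) := by
    intro s
    by_cases hs : s ∈ Metric.closedBall (0 : V) δ
    swap
    · exact ⟨0, fun h => absurd h hs⟩
    have hs' : ‖s‖ ≤ δ := by simpa using hs
    have hpl : IsPicardLindelof (v s) (tmin := 0) (tmax := 2) ⟨0, by norm_num⟩ x₀
        (NNReal.mk ρ hρ.le) 0 (NNReal.mk (C * δ) (by positivity))
        (NNReal.mk (m * L * δ) (by positivity)) := by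
      refine ⟨fun t ht => ?_, fun x hx => ?_, fun t ht x hx => ?_, ?_⟩
      · refine LipschitzOnWith.of_dist_le_mul fun x hx y hy => ?_
        rw [dist_eq_norm, dist_eq_norm, hv, hv, add_sub_add_right_eq_sub, ← smul_sub,
          ← sub_apply, norm_smul]
        calc ‖α t - β t‖ * ‖(A x - A y) s‖ ≤ m * ((L * ‖x - y‖) * δ) := by
              gcongr
              · exact hκ t ht
              · exact ((A x - A y).le_opNorm s).trans (by gcongr; exact hLip x hx y hy)
          _ = m * L * δ * ‖x - y‖ := by ring
      · simp only [v]; fun_prop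
      · rw [hv]
        calc ‖(α t - β t) • A x s + β t • s‖ ≤ |α t - β t| * ‖A x s‖ + |β t| * ‖s‖ := by
              refine (norm_add_le _ _).trans ?_
              rw [norm_smul, norm_smul, Real.norm_eq_abs, Real.norm_eq_abs]
          _ ≤ m * (K * δ) + m * δ := by
              gcongr
              · exact hκ t ht
              · exact ((A x).le_opNorm s).trans (by gcongr; exact hK x hx)
              · exact hβ t ht
          _ = C * δ := by simp only [C]; ring
      · have : C * δ * max (2 - 0) (0 - 0) ≤ ρ - 0 := by
          rw [sub_zero, sub_zero, sub_zero, max_eq_left (by norm_num)]; linarith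
        exact this
    obtain ⟨a, h0, h1, h2⟩ := exists_hasDerivWithinAt_mem_closedBall hpl
      (x := x₀) (Metric.mem_closedBall_self le_rfl)
    exact ⟨a, fun _ => ⟨h0, h1, h2⟩⟩
  choose γ hγ using hex
  -- The endpoint map `s ↦ γ s 2` is Lipschitz-close to the identity with constant `1/2`, so it
  -- covers a ball around `x₀`. This replaces differentiability of the flow in the parameter `s`.
  have happ : ApproximatesLinearOn (fun s => γ s 2) (ContinuousLinearEquiv.refl ℝ V : V →L[ℝ] V)
      (Metric.closedBall 0 δ) (1 / 2 : NNReal) := by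
    intro s hs s' hs'
    obtain ⟨h0, hb, hd⟩ := hγ s hs
    obtain ⟨h0', hb', hd'⟩ := hγ s' hs'
    have hsn : ‖s‖ ≤ δ := by simpa using hs
    set d := s - s'
    set w : ℝ → V := fun t => γ s t - γ s' t
    have hw : ∀ t ∈ Icc (0 : ℝ) 2, HasDerivWithinAt w
        (v s t (γ s t) - v s' t (γ s' t)) (Icc 0 2) t := fun t ht => (hd t ht).sub (hd' t ht)
    have hw0 : w 0 = 0 := by simp [w, h0, h0']
    have hcont : ContinuousOn (fun t => ‖w t‖) (Icc 0 2) :=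
      (HasDerivWithinAt.continuousOn hw).norm
    -- Bounding the derivative of `w` by the maximum of `‖w‖` itself allows that maximum to be
    -- absorbed on the left, in place of Grönwall's inequality.
    obtain ⟨τ, hτ, hmax⟩ := isCompact_Icc.exists_isMaxOn ⟨0, by norm_num⟩ hcont
    have hmax' : ∀ t ∈ Icc (0 : ℝ) 2, ‖w t‖ ≤ ‖w τ‖ := fun t ht => hmax ht
    have hsplit : ∀ t, v s t (γ s t) - v s' t (γ s' t)
        = (α t - β t) • ((A (γ s t) - A (γ s' t)) s + A (γ s' t) d) + β t • d := fun t => by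
      simp only [hv, d, map_sub, sub_apply, smul_sub, smul_add, sub_smul]; abel
    have hAw : ∀ t ∈ Icc (0 : ℝ) 2, ‖(A (γ s t) - A (γ s' t)) s‖ ≤ L * ‖w τ‖ * δ := fun t ht =>
      (ContinuousLinearMap.le_opNorm _ s).trans (by
        gcongr
        exact (hLip _ (hb t) _ (hb' t)).trans (by gcongr; exact hmax' t ht))
    have hbound : ∀ t ∈ Icc (0 : ℝ) 2, ‖v s t (γ s t) - v s' t (γ s' t)‖
        ≤ m * (L * ‖w τ‖ * δ + K * ‖d‖) + m * ‖d‖ := fun t ht => by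
      rw [hsplit]
      refine (norm_add_le _ _).trans ?_
      rw [norm_smul, norm_smul]
      gcongr
      · exact hκ t ht
      · refine (norm_add_le _ _).trans ?_
        gcongr
        · exact hAw t ht
        · exact (ContinuousLinearMap.le_opNorm _ d).trans (by gcongr; exact hK _ (hb' t))
      · exact hβ t ht
    have hτ1 := norm_image_le_of_hasDerivWithinAt hw hbound hw0 hτ
    have hτ2 : ‖w τ‖ ≤ 4 * C * ‖d‖ := by
      have : 2 * (m * (L * ‖w τ‖ * δ)) ≤ ‖w τ‖ / 2 := by nlinarith [norm_nonneg (w τ)]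
      have h2 : m * (L * ‖w τ‖ * δ + K * ‖d‖) + m * ‖d‖ = m * (L * ‖w τ‖ * δ) + C * ‖d‖ := by
        simp only [C]; ring
      rw [h2] at hτ1
      linarith
    -- The subtracted term is the motion with `A` frozen at `x₀`. At `t = 2` both ramps equal `1`,
    -- so it is exactly `d`, and `u 2` measures the deviation from the identity.
    set u : ℝ → V := fun t => w t - ((firstRamp t - secondRamp t) • A x₀ d + secondRamp t • d)
    have hu : ∀ t ∈ Icc (0 : ℝ) 2, HasDerivWithinAt u ((v s t (γ s t) - v s' t (γ s' t))
        - ((α t - β t) • A x₀ d + β t • d)) (Icc 0 2) t := fun t ht => by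
      have e1 : HasDerivAt firstRamp (α t) t :=
        ((contDiff_firstRamp.differentiable (by simp)) t).hasDerivAt
      have e2 : HasDerivAt secondRamp (β t) t :=
        ((contDiff_secondRamp.differentiable (by simp)) t).hasDerivAt
      exact (hw t ht).sub (((e1.sub e2).smul_const _).add (e2.smul_const _)).hasDerivWithinAt
    have hu0 : u 0 = 0 := by
      simp [u, hw0, firstRamp, secondRamp, Real.smoothTransition.zero_of_nonpos]
    have hubound : ∀ t ∈ Icc (0 : ℝ) 2, ‖(v s t (γ s t) - v s' t (γ s' t))
        - ((α t - β t) • A x₀ d + β t • d)‖ ≤ m * (L * ‖w τ‖ * δ + L * ρ * ‖d‖) := fun t ht => by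
      have : (v s t (γ s t) - v s' t (γ s' t)) - ((α t - β t) • A x₀ d + β t • d)
          = (α t - β t) • ((A (γ s t) - A (γ s' t)) s + (A (γ s' t) - A x₀) d) := by
        rw [hsplit]; simp only [sub_apply, smul_sub, smul_add]; abel
      rw [this, norm_smul]
      gcongr
      · exact hκ t ht
      · refine (norm_add_le _ _).trans ?_
        gcongr
        · exact hAw t ht
        · refine (ContinuousLinearMap.le_opNorm _ d).trans ?_
          gcongr
          refine (hLip _ (hb' t) _ (Metric.mem_closedBall_self hρ.le)).trans ?_
          gcongr
          rw [← dist_eq_norm]; exact hb' t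
    have h2 := norm_image_le_of_hasDerivWithinAt hu hubound hu0 (t := 2) ⟨by norm_num, le_rfl⟩
    have hu2 : u 2 = γ s 2 - γ s' 2 - (ContinuousLinearEquiv.refl ℝ V : V →L[ℝ] V) (s - s') := by
      simp only [u, w, firstRamp, secondRamp]
      rw [Real.smoothTransition.one_of_one_le (by norm_num),
        Real.smoothTransition.one_of_one_le (by norm_num)]
      simp [d]
    rw [← hu2]
    refine h2.trans ?_
    have e1 : 2 * (m * (L * ‖w τ‖ * δ)) ≤ 1 / 8 * ‖d‖ := by
      calc 2 * (m * (L * ‖w τ‖ * δ)) ≤ 2 * (m * (L * (4 * C * ‖d‖) * δ)) := by gcongr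
        _ = 1 / 8 * ((64 * m * L * C * δ) * ‖d‖) := by ring
        _ ≤ 1 / 8 * (1 * ‖d‖) := by gcongr
        _ = _ := by ring
    have e2 : 2 * (m * (L * ρ * ‖d‖)) ≤ 1 / 4 * ‖d‖ := by
      calc 2 * (m * (L * ρ * ‖d‖)) = 1 / 4 * ((8 * m * L * ρ) * ‖d‖) := by ring
        _ ≤ 1 / 4 * (1 * ‖d‖) := by gcongr
        _ = _ := by ring
    have e3 : (((1 / 2 : NNReal) : ℝ)) = 1 / 2 := by norm_num
    rw [e3]
    nlinarith [norm_nonneg d]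
  have h00 : γ 0 2 = x₀ := by
    obtain ⟨h0, hb, hd⟩ := hγ 0 (Metric.mem_closedBall_self hδ.le)
    have h1 : ∀ t ∈ Icc (0 : ℝ) 2, HasDerivWithinAt (fun t => γ 0 t - x₀) 0 (Icc 0 2) t :=
      fun t ht => by simpa [v] using (hd t ht).sub_const x₀
    have := norm_image_le_of_hasDerivWithinAt h1 (C := 0) (by simp) (by simp [h0]) (t := 2)
      ⟨by norm_num, le_rfl⟩
    simpa [sub_eq_zero] using this
  -- The identity is its own right inverse with norm bound `1`, so the covered ball has radius `(1 -
  -- 1/2) * δ`.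
  let N : ContinuousLinearMap.NonlinearRightInverse
      (ContinuousLinearEquiv.refl ℝ V : V →L[ℝ] V) := ⟨id, 1, fun y => by simp, fun y => rfl⟩
  have hsurj := happ.surjOn_closedBall_of_nonlinearRightInverse N hδ.le subset_rfl
  have hN : N.nnnorm = 1 := rfl
  rw [h00, hN] at hsurj
  have hpos : 0 < (((1 : NNReal) : ℝ)⁻¹ - ((1 / 2 : NNReal) : ℝ)) * δ := by
    have : (((1 : NNReal) : ℝ)⁻¹ - ((1 / 2 : NNReal) : ℝ)) = 1 / 2 := by norm_num
    rw [this]; positivity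
  filter_upwards [Metric.closedBall_mem_nhds x₀ hpos] with z hz
  obtain ⟨s, hs, rfl⟩ := hsurj hz
  obtain ⟨h0, hb, hd⟩ := hγ s hs
  exact ⟨s, γ s, h0, rfl, fun t _ => (hball (hb t)).2, hd⟩

end Curves

/-! ### Smooth endomorphism fields and their covariant derivative in coordinates. -/

section EndFields

set_option linter.unusedSectionVars false

variable {E : Type*} [NormedAddCommGroup E] [NormedSpace ℝ E] [FiniteDimensional ℝ E]
  {M : Type*} [TopologicalSpace M] [ChartedSpace E M] [IsManifold 𝓘(ℝ, E) ∞ M]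
  [RiemannianBundle (TangentSpace 𝓘(ℝ, E) : M → Type _)]
  [IsContMDiffRiemannianBundle 𝓘(ℝ, E) ∞ E (TangentSpace 𝓘(ℝ, E) : M → Type _)]

variable {o : M} {x : E} {Y : ∀ x : M, TangentSpace 𝓘(ℝ, E) x}

theorem chart_pt (hx : x ∈ cod o) : extChartAt 𝓘(ℝ, E) o (pt o x) = x := chart_right_inv hx

theorem pt_chart {y : M} (hy : y ∈ dom (E := E) o) : pt o (extChartAt 𝓘(ℝ, E) o y) = y :=
  chart_left_inv hy

theorem contDiffAt_fieldHat (hx : x ∈ cod o)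
    (hY : ContMDiffAt 𝓘(ℝ, E) 𝓘(ℝ, E).tangent ∞
      (fun p => (⟨p, Y p⟩ : TangentBundle 𝓘(ℝ, E) M)) (pt o x)) :
    ContDiffAt ℝ ∞ (fieldHat o Y) x :=
  contDiffAt_chart_symm hx ((contMDiffAt_field_iff (pt_mem_dom hx)).1 hY)

theorem contMDiffAt_of_fieldHat (hx : x ∈ cod o) (hY : ContDiffAt ℝ ∞ (fieldHat o Y) x) :
    ContMDiffAt 𝓘(ℝ, E) 𝓘(ℝ, E).tangent ∞
      (fun p => (⟨p, Y p⟩ : TangentBundle 𝓘(ℝ, E) M)) (pt o x) := by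
  have hy := pt_mem_dom hx
  rw [contMDiffAt_field_iff hy]
  have h : (fun p => coordMap o p (Y p)) =ᶠ[𝓝 (pt o x)]
      fun p => fieldHat o Y (extChartAt 𝓘(ℝ, E) o p) := by
    filter_upwards [dom_mem_nhds hy] with p hp
    simp only [fieldHat]
    rw [pt_chart hp]
  refine ContMDiffAt.congr_of_eventuallyEq ?_ h
  have h2 : ContMDiffAt 𝓘(ℝ, E) 𝓘(ℝ, E) ∞ (fieldHat o Y) (extChartAt 𝓘(ℝ, E) o (pt o x)) := by
    rw [chart_pt hx]; exact hY.contMDiffAt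
  exact h2.comp _ (contMDiffAt_chart hy)

/-- A field of endomorphisms in coordinates. -/
def endHat (o : M) (T : ∀ y : M, TangentSpace 𝓘(ℝ, E) y →L[ℝ] TangentSpace 𝓘(ℝ, E) y) (x : E) :
    E →L[ℝ] E :=
  coordMap o (pt o x) ∘L T (pt o x) ∘L coordVec o (pt o x)

/-- A field of endomorphisms is smooth if it maps coordinate fields to smooth fields. -/
def SmoothEnd (T : ∀ y : M, TangentSpace 𝓘(ℝ, E) y →L[ℝ] TangentSpace 𝓘(ℝ, E) y) : Prop :=
  ∀ (o : M) (x : E), x ∈ cod o → ContDiffAt ℝ ∞ (endHat o T) x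

variable {T : ∀ y : M, TangentSpace 𝓘(ℝ, E) y →L[ℝ] TangentSpace 𝓘(ℝ, E) y}

theorem endHat_apply (o : M) (x a : E) :
    endHat o T x a = coordMap o (pt o x) (T (pt o x) (coordVec o (pt o x) a)) := rfl

theorem coordVec_endHat (hx : x ∈ cod o) (a : E) :
    coordVec o (pt o x) (endHat o T x a) = T (pt o x) (coordVec o (pt o x) a) := by
  rw [endHat_apply, coordVec_coordMap (pt_mem_dom hx)]

theorem fieldHat_end (hx : x ∈ cod o) :
    fieldHat o (fun p => T p (Y p)) x = endHat o T x (fieldHat o Y x) := by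
  rw [endHat_apply, fieldHat, fieldHat, coordVec_coordMap (pt_mem_dom hx)]

theorem SmoothEnd.field (hT : SmoothEnd T) {o y : M} (hy : y ∈ dom (E := E) o) (a : E) :
    ContMDiffAt 𝓘(ℝ, E) 𝓘(ℝ, E).tangent ∞
      (fun p => (⟨p, T p (coordVec o p a)⟩ : TangentBundle 𝓘(ℝ, E) M)) y := by
  have hx := chart_mem_cod hy
  have h : ContDiffAt ℝ ∞ (fieldHat o fun p => T p (coordVec o p a)) (extChartAt 𝓘(ℝ, E) o y) :=
    (hT o _ hx).clm_apply contDiffAt_const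
  have := contMDiffAt_of_fieldHat hx h
  rwa [pt_chart hy] at this

theorem IsKahler.smoothEnd {P : ∀ y : M, TangentSpace 𝓘(ℝ, E) y →L[ℝ] TangentSpace 𝓘(ℝ, E) y}
    (hP : IsKahler P) : SmoothEnd P := fun o x hx =>
  contDiffAt_clm_of_apply fun a => by
    have h := (hP.smooth (pt o x)).clm_bundle_apply (contMDiffAt_coordVec (pt_mem_dom hx) a)
    exact contDiffAt_fieldHat hx h

/-- The covariant derivative of a field of endomorphisms, in coordinates. -/
def cov (o : M) (T : ∀ y : M, TangentSpace 𝓘(ℝ, E) y →L[ℝ] TangentSpace 𝓘(ℝ, E) y) (x u : E) :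
    E →L[ℝ] E :=
  fderiv ℝ (endHat o T) x u + christoffel (metric o) x u ∘L endHat o T x
    - endHat o T x ∘L christoffel (metric o) x u

theorem cod_mem_nhds (hx : x ∈ cod (E := E) o) : cod (E := E) o ∈ 𝓝 x := (isOpen_cod o).mem_nhds hx

theorem differentiableAt_fieldHat (hx : x ∈ cod o) (hY : DiffField Y (pt o x)) :
    DifferentiableAt ℝ (fieldHat o Y) x := by
  have h := (diffField_iff (pt_mem_dom hx)).1 hY
  exact (MDifferentiableAt.comp (I' := 𝓘(ℝ, E)) x
    (g := fun p => coordMap o p (Y p)) (f := (extChartAt 𝓘(ℝ, E) o).symm) h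
    ((contMDiffAt_chart_symm hx).mdifferentiableAt (by simp))).differentiableAt

/-- The product rule for an endomorphism applied to a vector field. -/
theorem coordMap_nabla_end (hT : SmoothEnd T) (hx : x ∈ cod o) (hY : DiffField Y (pt o x))
    (hTY : DiffField (fun p => T p (Y p)) (pt o x)) (u : E) :
    coordMap o (pt o x) (nabla (fun p => T p (Y p)) (pt o x) (coordVec o (pt o x) u))
      = cov o T x u (fieldHat o Y x)
        + endHat o T x (coordMap o (pt o x) (nabla Y (pt o x) (coordVec o (pt o x) u))) := by
  rw [coordMap_nabla hx hY, coordMap_nabla hx hTY]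
  have h1 : fieldHat o (fun p => T p (Y p)) =ᶠ[𝓝 x] fun z => endHat o T z (fieldHat o Y z) := by
    filter_upwards [cod_mem_nhds hx] with z hz using fieldHat_end hz
  have h2 := (((hT o x hx).differentiableAt (by simp)).hasFDerivAt.clm_apply
    (differentiableAt_fieldHat hx hY).hasFDerivAt).fderiv
  rw [h1.fderiv_eq, h2, h1.self_of_nhds]
  simp [cov]
  abel

variable {T' : ∀ y : M, TangentSpace 𝓘(ℝ, E) y →L[ℝ] TangentSpace 𝓘(ℝ, E) y}

theorem endHat_comp (hx : x ∈ cod o) :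
    endHat o (fun y => T y ∘L T' y) x = endHat o T x ∘L endHat o T' x := by
  ext a
  rw [ContinuousLinearMap.comp_apply, endHat_apply, endHat_apply (T := T), coordVec_endHat hx]
  rfl

theorem endHat_sub : endHat o (fun y => T y - T' y) x = endHat o T x - endHat o T' x := by
  ext a
  simp [endHat_apply]

theorem endHat_id (hx : x ∈ cod o) :
    endHat o (fun y => ContinuousLinearMap.id ℝ (TangentSpace 𝓘(ℝ, E) y)) x
      = ContinuousLinearMap.id ℝ E := by
  ext a
  rw [endHat_apply]
  exact coordMap_coordVec (pt_mem_dom hx) a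

theorem SmoothEnd.comp (hT : SmoothEnd T) (hT' : SmoothEnd T') :
    SmoothEnd fun y => T y ∘L T' y := fun o x hx => by
  refine ((hT o x hx).clm_comp (hT' o x hx)).congr_of_eventuallyEq ?_
  filter_upwards [cod_mem_nhds hx] with z hz using endHat_comp hz

theorem SmoothEnd.sub (hT : SmoothEnd T) (hT' : SmoothEnd T') :
    SmoothEnd fun y => T y - T' y := fun o x hx => by
  refine ((hT o x hx).sub (hT' o x hx)).congr_of_eventuallyEq ?_
  filter_upwards with z using endHat_sub

theorem smoothEnd_id :
    SmoothEnd fun y : M => ContinuousLinearMap.id ℝ (TangentSpace 𝓘(ℝ, E) y) := fun o x hx => by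
  refine (contDiffAt_const (c := ContinuousLinearMap.id ℝ E)).congr_of_eventuallyEq ?_
  filter_upwards [cod_mem_nhds hx] with z hz using endHat_id hz

theorem cov_comp (hT : SmoothEnd T) (hT' : SmoothEnd T') (hx : x ∈ cod o) (u : E) :
    cov o (fun y => T y ∘L T' y) x u
      = cov o T x u ∘L endHat o T' x + endHat o T x ∘L cov o T' x u := by
  have h1 : endHat o (fun y => T y ∘L T' y) =ᶠ[𝓝 x] fun z => endHat o T z ∘L endHat o T' z := by
    filter_upwards [cod_mem_nhds hx] with z hz using endHat_comp hz
  have h2 := (((hT o x hx).differentiableAt (by simp)).hasFDerivAt.clm_comp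
    ((hT' o x hx).differentiableAt (by simp)).hasFDerivAt).fderiv
  simp only [cov]
  rw [h1.fderiv_eq, h2, h1.self_of_nhds]
  ext a
  simp
  abel

theorem cov_sub (hT : SmoothEnd T) (hT' : SmoothEnd T') (hx : x ∈ cod o) (u : E) :
    cov o (fun y => T y - T' y) x u = cov o T x u - cov o T' x u := by
  have h1 : endHat o (fun y => T y - T' y) = fun z => endHat o T z - endHat o T' z :=
    funext fun z => endHat_sub
  simp only [cov]
  rw [h1, fderiv_fun_sub ((hT o x hx).differentiableAt (by simp))
    ((hT' o x hx).differentiableAt (by simp))]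
  ext a
  simp
  abel

theorem cov_id (hx : x ∈ cod o) (u : E) :
    cov o (fun y => ContinuousLinearMap.id ℝ (TangentSpace 𝓘(ℝ, E) y)) x u = 0 := by
  have h1 : endHat o (fun y => ContinuousLinearMap.id ℝ (TangentSpace 𝓘(ℝ, E) y)) =ᶠ[𝓝 x]
      fun _ => ContinuousLinearMap.id ℝ E := by
    filter_upwards [cod_mem_nhds hx] with z hz using endHat_id hz
  simp only [cov]
  rw [h1.fderiv_eq, h1.self_of_nhds]
  ext a
  simp

theorem cov_add_vec (u v : E) : cov o T x (u + v) = cov o T x u + cov o T x v := by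
  simp only [cov, map_add, christoffel_add]
  ext a
  simp
  abel

end EndFields

/-! ### Smoothness of the orthogonal projection onto a distribution. -/

section Projection

set_option linter.unusedSectionVars false

variable {E : Type*} [NormedAddCommGroup E] [NormedSpace ℝ E] [FiniteDimensional ℝ E]
  {M : Type*} [TopologicalSpace M] [ChartedSpace E M] [IsManifold 𝓘(ℝ, E) ∞ M]
  [RiemannianBundle (TangentSpace 𝓘(ℝ, E) : M → Type _)]
  [IsContMDiffRiemannianBundle 𝓘(ℝ, E) ∞ E (TangentSpace 𝓘(ℝ, E) : M → Type _)]

/-- The orthogonal projection onto a distribution. -/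
def proj (R : ∀ y : M, Submodule ℝ (TangentSpace 𝓘(ℝ, E) y)) (y : M) :
    TangentSpace 𝓘(ℝ, E) y →L[ℝ] TangentSpace 𝓘(ℝ, E) y := (R y).starProjection

variable {R : ∀ y : M, Submodule ℝ (TangentSpace 𝓘(ℝ, E) y)} {r : ℕ}

/-- In coordinates, the projection onto the span of a frame is `ι (L ι)⁻¹ L`. -/
theorem smoothEnd_proj (hR : IsSubbundleAlong (E := E) (fun y : M => y) R r) :
    SmoothEnd (proj R) := fun o x hx => by
  obtain ⟨U, hU, e, he, hspan⟩ := hR (pt o x)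
  have hcont : ContinuousAt (pt (E := E) o) x := (contMDiffAt_chart_symm hx).continuousAt
  have hpre : pt o ⁻¹' U ∈ 𝓝 x := hcont hU
  set ê : Fin r → E → E := fun i => fieldHat o (e i)
  have hê : ∀ i, ContDiffAt ℝ ∞ (ê i) x := fun i =>
    contDiffAt_fieldHat hx ((he i).contMDiffAt hU)
  set ι : E → (Fin r → ℝ) →L[ℝ] E := fun z =>
    ∑ i, (ContinuousLinearMap.proj i : (Fin r → ℝ) →L[ℝ] ℝ).smulRight (ê i z)
  have hι_apply : ∀ z c, ι z c = ∑ i, c i • ê i z := fun z c => by simp [ι]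
  have hι : ContDiffAt ℝ ∞ ι x := contDiffAt_clm_of_apply fun c => by
    simp only [hι_apply]
    exact ContDiffAt.sum fun i _ => contDiffAt_const.smul (hê i)
  set L : E → E →L[ℝ] (Fin r → ℝ) := fun z => ContinuousLinearMap.pi fun i => metric o z (ê i z)
  have hL : ContDiffAt ℝ ∞ L x := contDiffAt_clm_of_apply fun a => by
    refine contDiffAt_pi.2 fun i => ?_
    exact ((contDiffAt_metric hx).clm_apply (hê i)).clm_apply contDiffAt_const
  have hinner : ∀ z ∈ cod o, ∀ i a, L z a i
      = inner ℝ (e i (pt o z)) (coordVec o (pt o z) a) := fun z hz i a => by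
    change metric o z (ê i z) a = _
    rw [metric_apply, show ê i z = coordMap o (pt o z) (e i (pt o z)) from rfl,
      coordVec_coordMap (pt_mem_dom hz)]
  have hvec : ∀ z ∈ cod o, ∀ c, coordVec o (pt o z) (ι z c) = ∑ i, c i • e i (pt o z) :=
    fun z hz c => by
      rw [hι_apply, map_sum]
      refine Finset.sum_congr rfl fun i _ => ?_
      rw [map_smul, show ê i z = coordMap o (pt o z) (e i (pt o z)) from rfl,
        coordVec_coordMap (pt_mem_dom hz)]
  -- `L ∘ ι` is the Gram matrix of the frame; a coefficient vector in its kernel gives a combination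
  -- of the frame of norm zero.
  have hinv : ∀ z ∈ cod o, pt o z ∈ U → (L z ∘L ι z).IsInvertible := fun z hz hzU => by
    have hinj : Function.Injective (L z ∘L ι z) := by
      refine (injective_iff_map_eq_zero _).2 fun c hc => ?_
      have h0 : inner ℝ (coordVec o (pt o z) (ι z c)) (coordVec o (pt o z) (ι z c)) = 0 := by
        conv_lhs => enter [2]; rw [hvec z hz]
        rw [sum_inner]
        refine Finset.sum_eq_zero fun i _ => ?_
        rw [inner_smul_left, ← hinner z hz]
        have : L z (ι z c) i = 0 := congrFun hc i
        rw [this, mul_zero]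
      rw [inner_self_eq_zero, hvec z hz] at h0
      exact funext ((Fintype.linearIndependent_iff.1 (hspan _ hzU).1) c h0)
    exact ⟨(LinearEquiv.ofInjectiveEndo (L z ∘L ι z).toLinearMap hinj).toContinuousLinearEquiv,
      rfl⟩
  have hxU : pt o x ∈ U := mem_of_mem_nhds hU
  have hsm : ContDiffAt ℝ ∞ (fun z => ι z ∘L (L z ∘L ι z).inverse ∘L L z) x :=
    hι.clm_comp ((contDiffAt_inverse (hL.clm_comp hι) (hinv x hx hxU)).clm_comp hL)
  refine hsm.congr_of_eventuallyEq ?_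
  filter_upwards [cod_mem_nhds hx, hpre] with z hz hzU
  ext a
  have hzU' : pt o z ∈ U := hzU
  set w : E := (ι z ∘L (L z ∘L ι z).inverse ∘L L z) a
  rw [endHat_apply]
  -- The projection is characterised by two properties: `w` represents a combination of the frame,
  -- and `L w = L a` says that the difference is orthogonal to the frame.
  have hkey : proj R (pt o z) (coordVec o (pt o z) a) = coordVec o (pt o z) w := by
    refine Submodule.eq_starProjection_of_mem_of_inner_eq_zero ?_ ?_
    · rw [show w = ι z ((L z ∘L ι z).inverse (L z a)) from rfl, hvec z hz, ← (hspan _ hzU').2]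
      exact Submodule.sum_mem _ fun i _ =>
        Submodule.smul_mem _ _ (Submodule.subset_span ⟨i, rfl⟩)
    · intro v hv
      rw [← (hspan _ hzU').2] at hv
      have hz0 : ∀ i, inner ℝ (coordVec o (pt o z) a - coordVec o (pt o z) w)
          (e i (pt o z)) = 0 := fun i => by
        rw [← map_sub, real_inner_comm, ← hinner z hz, map_sub]
        have : L z w = L z a := self_apply_inverse (hinv z hz hzU') (L z a)
        rw [this, sub_self]; rfl
      induction hv using Submodule.span_induction with
      | mem v h => obtain ⟨i, rfl⟩ := h; exact hz0 i
      | zero => simp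
      | add u v _ _ h1 h2 => rw [inner_add_right, h1, h2, add_zero]
      | smul c v _ h => rw [inner_smul_right, h, mul_zero]
  rw [hkey, coordMap_coordVec (pt_mem_dom hz)]

theorem proj_mem (y : M) (v : TangentSpace 𝓘(ℝ, E) y) : proj R y v ∈ R y :=
  Submodule.starProjection_apply_mem _ _

theorem proj_eq_self {y : M} {v : TangentSpace 𝓘(ℝ, E) y} (hv : v ∈ R y) : proj R y v = v :=
  Submodule.starProjection_eq_self_iff.2 hv

theorem proj_proj (y : M) (v : TangentSpace 𝓘(ℝ, E) y) : proj R y (proj R y v) = proj R y v :=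
  proj_eq_self (proj_mem y v)

theorem inner_proj_left (y : M) (v w : TangentSpace 𝓘(ℝ, E) y) :
    inner ℝ (proj R y v) w = inner ℝ v (proj R y w) :=
  Submodule.inner_starProjection_left_eq_right _ _ _

theorem proj_eq_zero_iff {y : M} {v : TangentSpace 𝓘(ℝ, E) y} : proj R y v = 0 ↔ v ∈ (R y)ᗮ :=
  Submodule.starProjection_apply_eq_zero_iff _

theorem sub_proj_mem (y : M) (v : TangentSpace 𝓘(ℝ, E) y) : v - proj R y v ∈ (R y)ᗮ :=
  Submodule.sub_starProjection_mem_orthogonal _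

end Projection

/-! ### The covariant derivative of an endomorphism field on tangent vectors. -/

section NablaEnd

set_option linter.unusedSectionVars false

variable {E : Type*} [NormedAddCommGroup E] [NormedSpace ℝ E] [FiniteDimensional ℝ E]
  {M : Type*} [TopologicalSpace M] [ChartedSpace E M] [IsManifold 𝓘(ℝ, E) ∞ M]
  [RiemannianBundle (TangentSpace 𝓘(ℝ, E) : M → Type _)]
  [IsContMDiffRiemannianBundle 𝓘(ℝ, E) ∞ E (TangentSpace 𝓘(ℝ, E) : M → Type _)]

variable {o y : M} {x : E} {Y : ∀ x : M, TangentSpace 𝓘(ℝ, E) x}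
  {T T' : ∀ y : M, TangentSpace 𝓘(ℝ, E) y →L[ℝ] TangentSpace 𝓘(ℝ, E) y}

theorem exists_pt_eq (hy : y ∈ dom (E := E) o) : ∃ x ∈ cod (E := E) o, pt o x = y :=
  ⟨_, chart_mem_cod hy, pt_chart hy⟩

/-- The covariant derivative `∇_v T` of a field of endomorphisms. -/
def nablaEnd (o : M) (T : ∀ y : M, TangentSpace 𝓘(ℝ, E) y →L[ℝ] TangentSpace 𝓘(ℝ, E) y) (y : M)
    (v : TangentSpace 𝓘(ℝ, E) y) : TangentSpace 𝓘(ℝ, E) y →L[ℝ] TangentSpace 𝓘(ℝ, E) y :=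
  coordVec o y ∘L cov o T (extChartAt 𝓘(ℝ, E) o y) (coordMap o y v) ∘L coordMap o y

theorem nablaEnd_apply (v a : TangentSpace 𝓘(ℝ, E) y) : nablaEnd o T y v a
    = coordVec o y (cov o T (extChartAt 𝓘(ℝ, E) o y) (coordMap o y v) (coordMap o y a)) := rfl

theorem nablaEnd_pt (hx : x ∈ cod o) (u a : E) :
    nablaEnd o T (pt o x) (coordVec o (pt o x) u) (coordVec o (pt o x) a)
      = coordVec o (pt o x) (cov o T x u a) := by
  have hy := pt_mem_dom hx
  rw [nablaEnd_apply, coordMap_coordVec hy, coordMap_coordVec hy, chart_pt hx]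

theorem diffField_end (hT : SmoothEnd T) (hy : y ∈ dom (E := E) o) (hY : DiffField Y y) :
    DiffField (fun p => T p (Y p)) y := by
  obtain ⟨x, hx, rfl⟩ := exists_pt_eq hy
  have h1 := ((hT o x hx).differentiableAt (by simp)).clm_apply (differentiableAt_fieldHat hx hY)
  rw [diffField_iff hy]
  have h2 : MDifferentiableAt 𝓘(ℝ, E) 𝓘(ℝ, E)
      (fun z => endHat o T z (fieldHat o Y z)) (extChartAt 𝓘(ℝ, E) o (pt o x)) := by
    rw [chart_pt hx]; exact h1.mdifferentiableAt
  refine (MDifferentiableAt.comp (I' := 𝓘(ℝ, E)) (pt o x) h2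
    ((contMDiffAt_chart hy).mdifferentiableAt (by simp))).congr_of_eventuallyEq ?_
  filter_upwards [dom_mem_nhds hy] with p hp
  have := fieldHat_end (T := T) (Y := Y) (chart_mem_cod hp)
  rw [fieldHat, pt_chart hp] at this
  exact this

theorem nabla_end (hT : SmoothEnd T) (hy : y ∈ dom (E := E) o) (hY : DiffField Y y)
    (v : TangentSpace 𝓘(ℝ, E) y) :
    nabla (fun p => T p (Y p)) y v = nablaEnd o T y v (Y y) + T y (nabla Y y v) := by
  have hTY := diffField_end hT hy hY
  obtain ⟨x, hx, rfl⟩ := exists_pt_eq hy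
  rw [← coordVec_coordMap hy v]
  set u := coordMap o (pt o x) v
  rw [← coordVec_coordMap hy (nabla (fun p => T p (Y p)) (pt o x) _),
    coordMap_nabla_end hT hx hY hTY, map_add, coordVec_endHat hx, coordVec_coordMap hy,
    ← nablaEnd_pt hx, fieldHat, coordVec_coordMap hy, coordVec_coordMap hy]

theorem nablaEnd_comp (hT : SmoothEnd T) (hT' : SmoothEnd T') (hy : y ∈ dom (E := E) o)
    (v a : TangentSpace 𝓘(ℝ, E) y) :
    nablaEnd o (fun y => T y ∘L T' y) y v a
      = nablaEnd o T y v (T' y a) + T y (nablaEnd o T' y v a) := by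
  obtain ⟨x, hx, rfl⟩ := exists_pt_eq hy
  rw [← coordVec_coordMap hy v, ← coordVec_coordMap hy a, nablaEnd_pt hx, cov_comp hT hT' hx,
    nablaEnd_pt hx, ← coordVec_endHat hx, ← coordVec_endHat hx, nablaEnd_pt hx, ← map_add]
  rfl

theorem nablaEnd_sub (hT : SmoothEnd T) (hT' : SmoothEnd T') (hy : y ∈ dom (E := E) o)
    (v a : TangentSpace 𝓘(ℝ, E) y) :
    nablaEnd o (fun y => T y - T' y) y v a = nablaEnd o T y v a - nablaEnd o T' y v a := by
  rw [nablaEnd_apply, cov_sub hT hT' (chart_mem_cod hy), sub_apply, map_sub]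
  rfl

theorem nablaEnd_id (hy : y ∈ dom (E := E) o) (v a : TangentSpace 𝓘(ℝ, E) y) :
    nablaEnd o (fun y : M => ContinuousLinearMap.id ℝ (TangentSpace 𝓘(ℝ, E) y)) y v a = 0 := by
  rw [nablaEnd_apply, cov_id (chart_mem_cod hy), zero_apply, map_zero]

theorem nablaEnd_add_vec (v w a : TangentSpace 𝓘(ℝ, E) y) :
    nablaEnd o T y (v + w) a = nablaEnd o T y v a + nablaEnd o T y w a := by
  rw [nablaEnd_apply, map_add, cov_add_vec, add_apply, map_add]
  rfl

/-- The covariant derivative of a self-adjoint field is self-adjoint. -/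
theorem inner_nablaEnd (hT : SmoothEnd T) (hs : ∀ y v w, inner ℝ (T y v) w = inner ℝ v (T y w))
    (hy : y ∈ dom (E := E) o) (v a b : TangentSpace 𝓘(ℝ, E) y) :
    inner ℝ (nablaEnd o T y v a) b = inner ℝ a (nablaEnd o T y v b) := by
  set X : ∀ p : M, TangentSpace 𝓘(ℝ, E) p := fun p => coordVec o p (coordMap o y a)
  set Z : ∀ p : M, TangentSpace 𝓘(ℝ, E) p := fun p => coordVec o p (coordMap o y b)
  have hX : DiffField X y := diffField_coordVec hy _
  have hZ : DiffField Z y := diffField_coordVec hy _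
  have eX : X y = a := coordVec_coordMap hy a
  have eZ : Z y = b := coordVec_coordMap hy b
  -- The function `⟨T X, Z⟩ = ⟨X, T Z⟩` is differentiated in two ways; the terms containing `∇X` and
  -- `∇Z` match because `T` is self-adjoint.
  have h1 := mvfderiv_inner (diffField_end hT hy hX) hZ v
  have h2 := mvfderiv_inner hX (diffField_end hT hy hZ) v
  simp only [hs _ (X _)] at h1
  rw [h2, nabla_end hT hy hX, nabla_end hT hy hZ, eX, eZ, inner_add_left, inner_add_right,
    hs] at h1
  linarith

end NablaEnd

/-! ### Geodesics and the infinitesimal Clairaut relation. -/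

section ClairautRelation

set_option linter.unusedSectionVars false

variable {E : Type*} [NormedAddCommGroup E] [NormedSpace ℝ E] [FiniteDimensional ℝ E]
  {M : Type*} [TopologicalSpace M] [ChartedSpace E M] [IsManifold 𝓘(ℝ, E) ∞ M]
  [RiemannianBundle (TangentSpace 𝓘(ℝ, E) : M → Type _)]
  [IsContMDiffRiemannianBundle 𝓘(ℝ, E) ∞ E (TangentSpace 𝓘(ℝ, E) : M → Type _)]

variable {o y : M} {x : E} {R : ∀ y : M, Submodule ℝ (TangentSpace 𝓘(ℝ, E) y)} {r : ℕ}

/-- With `n` the normal part, `⟨v, n⟩ = |n|²` gives `cos² θ |v|² = |n|²`, and Pythagoras leaves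
`|Kv|²`. For `n = 0` the convention `θ = π/2` agrees with this. Squaring removes the angle from
Clairaut's relation. -/
theorem sin_sq_angle_mul {V : Type*} [NormedAddCommGroup V] [InnerProductSpace ℝ V]
    (K : Submodule ℝ V) [K.HasOrthogonalProjection] (v : V) :
    Real.sin (InnerProductGeometry.angle v (Kᗮ.starProjection v)) ^ 2 * inner ℝ v v
      = inner ℝ (K.starProjection v) (K.starProjection v) := by
  set p := K.starProjection v
  set n := Kᗮ.starProjection v
  have hvn : v = p + n := (Submodule.starProjection_add_starProjection_orthogonal _).symm
  have hpn : inner ℝ p n = 0 :=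
    (Submodule.mem_orthogonal _ _).1 (Submodule.starProjection_apply_mem Kᗮ v) p
      (Submodule.starProjection_apply_mem K v)
  have h1 : inner ℝ v n = inner ℝ n n := by
    conv_lhs => rw [hvn]
    rw [inner_add_left, hpn, zero_add]
  have h2 : inner ℝ v v = inner ℝ p p + inner ℝ n n := by
    conv_lhs => rw [hvn]
    rw [inner_add_left, inner_add_right, inner_add_right, hpn, real_inner_comm p n, hpn]; ring
  by_cases hn : n = 0
  · rw [hn, InnerProductGeometry.angle_zero_right, Real.sin_pi_div_two, h2, hn]; simp
  · have hn' : inner ℝ n n ≠ 0 := fun h => hn (inner_self_eq_zero.1 h)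
    have hc := InnerProductGeometry.cos_angle_mul_norm_mul_norm v n
    rw [h1] at hc
    have hc2 := congrArg (· ^ 2) hc
    simp only [mul_pow, ← real_inner_self_eq_norm_sq] at hc2
    rw [Real.sin_sq, sub_mul, one_mul]
    have : Real.cos (InnerProductGeometry.angle v n) ^ 2 * inner ℝ v v = inner ℝ n n := by
      apply mul_right_cancel₀ hn'
      linarith
    rw [this, h2]; ring

/-- The velocity of a curve given in coordinates. -/
theorem velocity_pt {γ : ℝ → E} {t : ℝ} {u : E} (hγ : HasDerivAt γ u t) (hx : γ t ∈ cod o) :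
    velocity (E' := E) (fun s => pt o (γ s)) t = coordVec o (pt o (γ t)) u := by
  have hy := pt_mem_dom hx
  have hc : MDifferentiableAt 𝓘(ℝ, ℝ) 𝓘(ℝ, E) (fun s => pt o (γ s)) t :=
    MDifferentiableAt.comp (I' := 𝓘(ℝ, E)) t
      ((contMDiffAt_chart_symm hx).mdifferentiableAt (by simp))
      hγ.differentiableAt.mdifferentiableAt
  rw [← coordVec_coordMap hy (velocity _ t), velocity, coordMap_eq_mfderiv hy]
  congr 1
  have h1 : γ =ᶠ[𝓝 t] extChartAt 𝓘(ℝ, E) o ∘ fun s => pt o (γ s) := by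
    filter_upwards [hγ.continuousAt (cod_mem_nhds hx)] with s hs
    exact (chart_pt hs).symm
  have h2 : mfderiv 𝓘(ℝ, ℝ) 𝓘(ℝ, E) (extChartAt 𝓘(ℝ, E) o ∘ fun s => pt o (γ s)) t
      = (mfderiv 𝓘(ℝ, E) 𝓘(ℝ, E) (extChartAt 𝓘(ℝ, E) o) (pt o (γ t))).comp
        (mfderiv 𝓘(ℝ, ℝ) 𝓘(ℝ, E) (fun s => pt o (γ s)) t) :=
    mfderiv_comp t ((contMDiffAt_chart hy).mdifferentiableAt (by simp)) hc
  rw [← h1.mfderiv_eq, mfderiv_eq_fderiv] at h2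
  refine Eq.trans (congrArg (fun L => L (1 : ℝ)) h2).symm ?_
  change (fderiv ℝ γ t) 1 = u
  rw [hγ.hasFDerivAt.fderiv]
  simp

/-- Geodesics with given initial velocity. -/
theorem exists_geodesic (hx : x ∈ cod (E := E) o) (u : E) :
    ∃ (γ w : ℝ → E) (ε : ℝ), 0 < ε ∧ γ 0 = x ∧ w 0 = u ∧ (∀ t ∈ Ioo (-ε) ε, γ t ∈ cod o) ∧
      (∀ t ∈ Ioo (-ε) ε, HasDerivAt γ (w t) t) ∧
      (∀ t ∈ Ioo (-ε) ε, HasDerivAt w (-christoffel (metric o) (γ t) (w t) (w t)) t) ∧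
      IsGeodesicOn (E' := E) (fun t => pt o (γ t)) (-ε) ε := by
  -- The geodesic equation is solved as the first-order system `(x, v)' = (v, -Γ(v, v))`.
  obtain ⟨W, ε, hε, hW0, hWU, hWd, hWs⟩ := exists_integralCurve
    (Z := fun p : E × E => (p.2, -christoffel (metric o) p.1 p.2 p.2))
    (U := cod o ×ˢ univ) ((isOpen_cod o).prod isOpen_univ) (fun p hp => by
      refine contDiffAt_snd.prodMk (ContDiffAt.neg ?_)
      exact (contDiffAt_christoffel_apply (contDiffAt_metric hp.1) (metric_isInvertible hp.1)
        p.2 p.2).comp p (contDiffAt_fst.prodMk (contDiffAt_snd.prodMk contDiffAt_snd)))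
    (x₀ := (x, u)) ⟨hx, trivial⟩
  have hcod : ∀ t ∈ Ioo (-ε) ε, (W t).1 ∈ cod o := fun t ht => (hWU t ht).1
  have hγ : ∀ t ∈ Ioo (-ε) ε, HasDerivAt (fun t => (W t).1) (W t).2 t := fun t ht =>
    (hWd t ht).fst
  have hw : ∀ t ∈ Ioo (-ε) ε, HasDerivAt (fun t => (W t).2)
      (-christoffel (metric o) (W t).1 (W t).2 (W t).2) t := fun t ht => (hWd t ht).snd
  refine ⟨fun t => (W t).1, fun t => (W t).2, ε, hε, congrArg Prod.fst hW0, congrArg Prod.snd hW0, hcod, hγ, hw,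
    ?_, fun t ht => ?_⟩
  · intro t ht
    have h1 : ContMDiffWithinAt 𝓘(ℝ, ℝ) 𝓘(ℝ, E) ∞ (fun t => (W t).1) (Ioo (-ε) ε) t :=
      (hWs.fst t ht).contMDiffWithinAt
    exact (contMDiffAt_chart_symm (hcod t ht)).comp_contMDiffWithinAt t h1
  · have hy := pt_mem_dom (hcod t ht)
    have hev : ∀ᶠ s in 𝓝 t, coordMap o (pt o (W s).1) (velocity (E' := E)
        (fun t => pt o (W t).1) s) = (W s).2 := by
      filter_upwards [isOpen_Ioo.mem_nhds ht] with s hs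
      rw [velocity_pt (hγ s hs) (hcod s hs), coordMap_coordVec (pt_mem_dom (hcod s hs))]
    have hb : MDifferentiableAt 𝓘(ℝ, ℝ) 𝓘(ℝ, E) (fun t => pt o (W t).1) t :=
      MDifferentiableAt.comp (I' := 𝓘(ℝ, E)) t
        ((contMDiffAt_chart_symm (hcod t ht)).mdifferentiableAt (by simp))
        (hγ t ht).differentiableAt.mdifferentiableAt
    have hD : DiffAlong (E := ℝ) (fun t => pt o (W t).1)
        (velocity (E' := E) (fun t => pt o (W t).1)) t := by
      refine (diffAlong_iff (F := fun t => pt o (W t).1) (o := o) hy hb).2 ?_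
      exact (hw t ht).differentiableAt.mdifferentiableAt.congr_of_eventuallyEq hev
    have hvel : mfderiv 𝓘(ℝ, ℝ) 𝓘(ℝ, E) (fun t => pt o (W t).1) t (1 : ℝ)
        = coordVec o (pt o (W t).1) (W t).2 := velocity_pt (hγ t ht) (hcod t ht)
    refine (nablaAlong_eq_coord (F := fun t => pt o (W t).1) (o := o) hy hD _).trans ?_
    rw [hvel, velocity_pt (hγ t ht) (hcod t ht),
      coordMap_coordVec hy, nablaCoord_coordVec (hcod t ht), ← map_add, mvfderiv_congr hev]
    have : mvfderiv 𝓘(ℝ, ℝ) (fun t => (W t).2) t (1 : ℝ)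
        = -christoffel (metric o) (W t).1 (W t).2 (W t).2 := by
      have h3 := mfderiv_eq_fderiv (𝕜 := ℝ) (f := fun t => (W t).2) (x := t)
      refine Eq.trans (congrArg (fun L => L (1 : ℝ)) h3) ?_
      change (fderiv ℝ (fun t => (W t).2) t) 1 = _
      rw [(hw t ht).hasFDerivAt.fderiv]
      simp
    rw [this, neg_add_cancel, map_zero]

/-- The derivative of the inner product of two fields along a curve, in coordinates. -/
theorem hasDerivAt_metric {γ a b : ℝ → E} {t : ℝ} {u a' b' : E} (hx : γ t ∈ cod (E := E) o)
    (hγ : HasDerivAt γ u t) (ha : HasDerivAt a a' t) (hb : HasDerivAt b b' t) :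
    HasDerivAt (fun s => metric o (γ s) (a s) (b s))
      (metric o (γ t) (a' + christoffel (metric o) (γ t) u (a t)) (b t)
        + metric o (γ t) (a t) (b' + christoffel (metric o) (γ t) u (b t))) t := by
  have h1 : HasDerivAt (fun s => metric o (γ s)) (fderiv ℝ (metric o) (γ t) u) t :=
    (differentiableAt_metric hx).hasFDerivAt.comp_hasDerivAt t hγ
  have h2 := (h1.clm_apply ha).clm_apply hb
  refine h2.congr_deriv ?_
  rw [add_apply, fderiv_metric (differentiableAt_metric hx) (metric_comm o)
    (metric_isInvertible hx)]
  simp only [map_add, add_apply]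
  ring

/-- The infinitesimal form of Clairaut's relation. -/
theorem clairaut_deriv (hR : IsSubbundleAlong (E := E) (fun y : M => y) R r) {f : M → ℝ}
    (hf : ContMDiff 𝓘(ℝ, E) 𝓘(ℝ, ℝ) ∞ f) (hCl : IsClairaut R f) (hy : y ∈ dom (E := E) o)
    (v : TangentSpace 𝓘(ℝ, E) y) :
    mvfderiv 𝓘(ℝ, E) f y v * inner ℝ (proj R y v) (proj R y v)
      + inner ℝ (nablaEnd o (proj R) y v v) (proj R y v) = 0 := by
  have hπ := smoothEnd_proj hR
  obtain ⟨x, hx, rfl⟩ := exists_pt_eq hy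
  set u := coordMap o (pt o x) v
  obtain ⟨γ, w, ε, hε, hγ0, hw0, hcod, hγ, hw, hgeo⟩ := exists_geodesic hx u
  obtain ⟨c, hc⟩ := hCl _ _ _ hgeo
  have h0 : (0 : ℝ) ∈ Ioo (-ε) ε := ⟨by linarith, hε⟩
  set fh : E → ℝ := fun z => f (pt o z)
  have hfh : DifferentiableAt ℝ fh x :=
    (contDiffAt_chart_symm hx (hf _)).differentiableAt (by simp)
  -- Clairaut's relation squared and multiplied by `|β'|²`, that is `e^{2f} |πβ'|² = c² |β'|²`, has
  -- both sides differentiable.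
  have hrel : ∀ t ∈ Ioo (-ε) ε, Real.exp (2 * fh (γ t)) * metric o (γ t)
      (endHat o (proj R) (γ t) (w t)) (endHat o (proj R) (γ t) (w t))
      = c ^ 2 * metric o (γ t) (w t) (w t) := fun t ht => by
    have h1 := hc t ht
    rw [velocity_pt (hγ t ht) (hcod t ht)] at h1
    have h2 := sin_sq_angle_mul (R (pt o (γ t))) (coordVec o (pt o (γ t)) (w t))
    rw [metric_apply, coordVec_endHat (hcod t ht)]
    refine Eq.trans (congrArg (Real.exp (2 * fh (γ t)) * ·) h2.symm) ?_
    rw [metric_apply, ← h1, two_mul, Real.exp_add]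
    ring
  have hγd : HasDerivAt γ u 0 := by simpa [hw0] using hγ 0 h0
  have hwd : HasDerivAt w (-christoffel (metric o) x u u) 0 := by
    simpa [hγ0, hw0] using hw 0 h0
  have hx0 : γ 0 ∈ cod o := by rwa [hγ0]
  have hE := hasDerivAt_metric hx0 hγd hwd hwd
  have hπd : HasDerivAt (fun t => endHat o (proj R) (γ t) (w t))
      (fderiv ℝ (endHat o (proj R)) x u u
        + endHat o (proj R) x (-christoffel (metric o) x u u)) 0 := by
    have h1 : HasFDerivAt (endHat o (proj R)) (fderiv ℝ (endHat o (proj R)) x) (γ 0) := by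
      rw [hγ0]; exact ((hπ o x hx).differentiableAt (by simp)).hasFDerivAt
    have h2 := (h1.comp_hasDerivAt 0 hγd).clm_apply hwd
    simpa [hγ0, hw0] using h2
  have hA := hasDerivAt_metric hx0 hγd hπd hπd
  have hexp : HasDerivAt (fun t => Real.exp (2 * fh (γ t)))
      (Real.exp (2 * fh x) * (2 * fderiv ℝ fh x u)) 0 := by
    have h1 : HasFDerivAt fh (fderiv ℝ fh x) (γ 0) := by rw [hγ0]; exact hfh.hasFDerivAt
    have h2 := ((h1.comp_hasDerivAt 0 hγd).const_mul 2).exp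
    simpa [hγ0] using h2
  have hL := hexp.mul hA
  have hRd := hE.const_mul (c ^ 2)
  have hev : (fun t => Real.exp (2 * fh (γ t)) * metric o (γ t)
      (endHat o (proj R) (γ t) (w t)) (endHat o (proj R) (γ t) (w t))) =ᶠ[𝓝 0]
      fun t => c ^ 2 * metric o (γ t) (w t) (w t) := by
    filter_upwards [isOpen_Ioo.mem_nhds h0] with t ht using hrel t ht
  have hu := hL.unique (hRd.congr_of_eventuallyEq hev)
  -- The right-hand side has derivative zero: the covariant acceleration `w' + Γ(w, w)` vanishes, so
  -- the speed is constant.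
  rw [hγ0, hw0, neg_add_cancel] at hu
  -- For the same reason the covariant derivative of `πw` along the geodesic is just `(∇_u π)u`.
  have hcov : fderiv ℝ (endHat o (proj R)) x u u
        + endHat o (proj R) x (-christoffel (metric o) x u u)
        + christoffel (metric o) x u (endHat o (proj R) x u) = cov o (proj R) x u u := by
    simp [cov]; abel
  rw [hcov, metric_comm o x (endHat o (proj R) x u) (cov o (proj R) x u u)] at hu
  simp only [map_zero, zero_apply, add_zero, mul_zero] at hu
  have hpos := Real.exp_pos (2 * fh x)
  have hfin : fderiv ℝ fh x u * metric o x (endHat o (proj R) x u) (endHat o (proj R) x u)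
      + metric o x (cov o (proj R) x u u) (endHat o (proj R) x u) = 0 := by
    have : Real.exp (2 * fh x) * (2 * (fderiv ℝ fh x u * metric o x (endHat o (proj R) x u)
        (endHat o (proj R) x u) + metric o x (cov o (proj R) x u u) (endHat o (proj R) x u)))
        = 0 := by linarith
    rcases mul_eq_zero.1 this with h | h
    · exact absurd h hpos.ne'
    · linarith
  rw [metric_apply, metric_apply, coordVec_endHat hx, ← nablaEnd_pt hx, coordVec_coordMap hy]
    at hfin
  rw [mvfderiv_eq_fderiv hy (hf.mdifferentiable (by simp) _), chart_pt hx]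
  exact hfin

end ClairautRelation

/-! ### Linear algebra at one point: the shape of `∇π` and the vanishing gradient. -/

section PointwiseAlgebra

variable {V : Type*} [NormedAddCommGroup V] [InnerProductSpace ℝ V]

/-- The covariant derivative of the projection of a Clairaut distribution with totally geodesic
orthogonal complement. -/
theorem projection_derivative_eq {p : V →L[ℝ] V} {A : V → V →L[ℝ] V} {l : V →L[ℝ] ℝ} {ξ : V}
    (hp : ∀ v, p (p v) = p v) (hps : ∀ v w, inner ℝ (p v) w = inner ℝ v (p w))
    (hAadd : ∀ v w a, A (v + w) a = A v a + A w a)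
    (hA : ∀ v a, A v (p a) + p (A v a) = A v a)
    (hAs : ∀ v a b, inner ℝ (A v a) b = inner ℝ a (A v b))
    (hC : ∀ v, l v * inner ℝ (p v) (p v) + inner ℝ (A v v) (p v) = 0)
    (hperp : ∀ w w', p w = 0 → p w' = 0 → p (A w w') = 0)
    (hinv : ∀ u u', p u = u → p u' = u' → p (A u u' - A u' u) = A u u' - A u' u)
    (hξ : ∀ v, inner ℝ ξ v = l v) :
    p ξ = 0 ∧ ∀ v a, A v a = -(l a • p v + inner ℝ (p v) a • ξ) := by
  -- Differentiating `p² = p` shows that `A v` exchanges the range and the kernel of `p`: both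
  -- diagonal blocks vanish.
  have hpAp : ∀ v a b, p a = a → p b = b → inner ℝ (A v a) b = 0 := fun v a b ha hb => by
    have h1 := hA v a
    rw [ha] at h1
    rw [← hb, ← hps, left_eq_add.1 h1.symm, inner_zero_left]
  have hqAq : ∀ v a b, p a = 0 → p b = 0 → inner ℝ (A v a) b = 0 := fun v a b ha hb => by
    have h1 := hA v a
    rw [ha, map_zero, zero_add] at h1
    rw [← h1, hps, hb, inner_zero_right]
  have horth : ∀ u w, p u = u → p w = 0 → inner ℝ u w = 0 := fun u w hu hw => by
    rw [← hu, hps, hw, inner_zero_right]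
  have hl : ∀ u, p u = u → l u = 0 := fun u hu => by
    have h1 := hC u
    rw [hu, hpAp u u u hu hu, add_zero] at h1
    rcases mul_eq_zero.1 h1 with h | h
    · exact h
    · rw [inner_self_eq_zero.1 h, map_zero]
  -- The Clairaut identity is applied to `u + w`. Of its second term only `⟨A u w, u⟩` survives: the
  -- diagonal blocks vanish and `hperp` kills `⟨A w w, u⟩`.
  have hd : ∀ u w, p u = u → p w = 0 → inner ℝ (A u w) u = -(l w * inner ℝ u u) :=
    fun u w hu hw => by
      have h1 := hC (u + w)
      have hpu : p (u + w) = u := by rw [map_add, hu, hw, add_zero]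
      have h2 : inner ℝ (A w w) u = 0 := by
        rw [← hu, ← hps, hperp w w hw hw, inner_zero_left]
      rw [hpu, hAadd, map_add, map_add, map_add, hl u hu, inner_add_left, inner_add_left,
        inner_add_left, hpAp u u u hu hu, hpAp w u u hu hu, h2] at h1
      linarith
  -- Polarisation determines only the symmetric part in `u, u'`; involutivity says that the
  -- antisymmetric part is tangent, hence invisible to `w`.
  have hoff : ∀ u u' w, p u = u → p u' = u' → p w = 0 →
      inner ℝ (A u u') w = -(l w * inner ℝ u u') := fun u u' w hu hu' hw => by
    have h1 := hd (u + u') w (by rw [map_add, hu, hu']) hw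
    have h2 := hd u w hu hw
    have h3 := hd u' w hu' hw
    have h4 := horth _ w (hinv u u' hu hu') hw
    simp only [hAadd, inner_add_left, inner_add_right, inner_sub_left] at h1 h4
    rw [hAs u w u', hAs u' w u, real_inner_comm (A u u') w, real_inner_comm (A u' u) w,
      real_inner_comm u u'] at h1
    linarith
  refine ⟨?_, fun v a => ext_inner_right ℝ fun b => ?_⟩
  · rw [← inner_self_eq_zero (𝕜 := ℝ), hps, hp, hξ, hl _ (hp ξ)]
  have hdec : ∀ v, ∃ u w, p u = u ∧ p w = 0 ∧ v = u + w := fun v =>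
    ⟨p v, v - p v, hp v, by rw [map_sub, hp, sub_self], by abel⟩
  obtain ⟨u, w, hu, hw, rfl⟩ := hdec v
  obtain ⟨a₁, a₂, ha₁, ha₂, rfl⟩ := hdec a
  obtain ⟨b₁, b₂, hb₁, hb₂, rfl⟩ := hdec b
  have hpv : p (u + w) = u := by rw [map_add, hu, hw, add_zero]
  have e1 := hoff u a₁ b₂ hu ha₁ hb₂
  have e2 := hoff u b₁ a₂ hu hb₁ ha₂
  rw [real_inner_comm, ← hAs] at e2
  have e3 : inner ℝ (A w a₂) b₁ = 0 := by
    rw [← hb₁, ← hps, hperp w a₂ hw ha₂, inner_zero_left]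
  have e4 : inner ℝ (A w a₁) b₂ = 0 := by
    rw [hAs, ← ha₁, hps, hperp w b₂ hw hb₂, inner_zero_right]
  rw [hpv, inner_neg_left, inner_add_left, inner_smul_left, inner_smul_left, hξ]
  simp only [hAadd, map_add, inner_add_left, inner_add_right, hpAp _ a₁ b₁ ha₁ hb₁,
    hqAq _ a₂ b₂ ha₂ hb₂, e1, e2, e3, e4, hl a₁ ha₁, hl b₁ hb₁, horth u a₂ hu ha₂,
    horth u b₂ hu hb₂]
  simp
  ring

/-- The range of an idempotent has dimension its trace. -/
theorem finrank_range_of_idempotent [FiniteDimensional ℝ V] {Q : V →L[ℝ] V}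
    (hQ : ∀ v, Q (Q v) = Q v) :
    LinearMap.trace ℝ V Q.toLinearMap = Module.finrank ℝ (LinearMap.range Q.toLinearMap) := by
  refine LinearMap.IsProj.trace ⟨fun v => ⟨v, rfl⟩, ?_⟩
  rintro _ ⟨v, rfl⟩
  exact hQ v

variable {p J : V →L[ℝ] V}

/-- The hypothesis `hS` says `pJpJ = pJpJp`. So the middle projection in the square can be dropped,
after which `J² = -1` shortens the product. Thus `-pJpJp` is idempotent; it is the projection onto
the invariant part. -/
theorem idempotent_of_semiInvariant (hp : ∀ v, p (p v) = p v) (hJ : ∀ v, J (J v) = -v)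
    (hS : ∀ v, p (J (p (J (v - p v)))) = 0) (v : V) :
    p (J (p (J (p (p (J (p (J (p v))))))))) = -p (J (p (J (p v)))) := by
  have h1 : ∀ v, p (J (p (J v))) = p (J (p (J (p v)))) := fun v => by
    have := hS v
    rwa [map_sub, map_sub, map_sub, map_sub, sub_eq_zero] at this
  rw [hp, ← h1, hJ, map_neg, map_neg, map_neg, hp]

/-- The gradient of a Clairaut function vanishes where the distribution is semi-invariant to first
order, with an invariant part of positive rank and an anti-invariant part of rank at least two. -/
theorem gradient_eq_zero [FiniteDimensional ℝ V] {ξ : V} {r d : ℕ}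
    (hp : ∀ v, p (p v) = p v) (hps : ∀ v w, inner ℝ (p v) w = inner ℝ v (p w))
    (hJ : ∀ v, J (J v) = -v) (hJi : ∀ v w, inner ℝ (J v) (J w) = inner ℝ v w)
    (hξ : p ξ = 0) (hS : ∀ v, p (J (p (J (v - p v)))) = 0) {D : V → V →L[ℝ] V}
    (hD : ∀ u a, p u = u → D u a = -(inner ℝ ξ a • u + inner ℝ u a • ξ))
    (hS' : ∀ u, p u = u → D u (J (p (J ξ))) + p (J (D u (J ξ))) - p (J (p (J (D u ξ)))) = 0)
    (htp : LinearMap.trace ℝ V p.toLinearMap = r)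
    (htJ : LinearMap.trace ℝ V (p ∘L J ∘L p ∘L J ∘L p).toLinearMap = -d)
    (hd : 0 < d) (hr : d + 1 < r) : ξ = 0 := by
  have hskew : ∀ v w, inner ℝ (J v) w = -inner ℝ v (J w) := fun v w => by
    rw [← hJi v (J w), hJ, inner_neg_right, neg_neg]
  have hskew0 : ∀ v, inner ℝ (J v) v = 0 := fun v => by
    have := hskew v v; rw [real_inner_comm] at this ⊢; linarith
  -- Insert the formula for `D` in `hS' u` and pair with `u`; skewness of `J` and `ξ ⟂ u` remove all
  -- but three terms.
  have hkey : ∀ u, p u = u → inner ℝ (p (J ξ)) (p (J ξ)) * inner ℝ u u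
      - inner ℝ u (J ξ) ^ 2 - inner ℝ ξ ξ * inner ℝ (p (J u)) (p (J u)) = 0 := fun u hu => by
    have hξu : inner ℝ ξ u = 0 := by rw [← hu, ← hps, hξ, inner_zero_left]
    have h := congrArg (fun z => inner ℝ z u) (hS' u hu)
    simp only [inner_zero_left, inner_sub_left, inner_add_left, hD u _ hu, map_neg, map_add,
      map_smul, inner_neg_left, inner_smul_left, conj_trivial, hξu, real_inner_comm ξ u] at h
    have e1 : inner ℝ ξ (J (p (J ξ))) = -inner ℝ (p (J ξ)) (p (J ξ)) := by
      have := hskew ξ (p (J ξ))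
      rw [hps, hp]; linarith
    have e2 : inner ℝ ξ (J ξ) = 0 := by rw [real_inner_comm]; exact hskew0 ξ
    have e3 : inner ℝ (p (J ξ)) u = inner ℝ u (J ξ) := by rw [hps, hu, real_inner_comm]
    have e4 : inner ℝ (p (J (p (J u)))) u = -inner ℝ (p (J u)) (p (J u)) := by
      rw [hps, hu, hskew]
      congr 1
      rw [hps (J u) (p (J u)), hp, hps]
    rw [e1, e2, e3, e4] at h
    nlinarith
  -- `Q` and `p - Q` are idempotents onto the invariant and anti-invariant parts of the range of
  -- `p`. Their ranks `d` and `r - d` come from traces.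
  set Q : V →L[ℝ] V := -(p ∘L J ∘L p ∘L J ∘L p) with hQdef
  have hQ : ∀ v, Q v = -p (J (p (J (p v)))) := fun v => rfl
  have hQQ : ∀ v, Q (Q v) = Q v := fun v => by
    have := idempotent_of_semiInvariant hp hJ hS v
    rw [hp] at this
    simp only [hQ, map_neg, neg_neg, hp, this]
  have hpQ : ∀ v, p (Q v) = Q v := fun v => by rw [hQ, map_neg, hp]
  have hQp : ∀ v, Q (p v) = Q v := fun v => by rw [hQ, hQ, hp]
  have hQJ : ∀ v w, p v = v → p w = w → inner ℝ (Q v) w = inner ℝ (p (J v)) (p (J w)) :=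
    fun v w hv hw => by
      rw [hQ, inner_neg_left, hps, hw, hskew, neg_neg, hv, hps (J v) (p (J w)), hp, hps]
  have htQ : LinearMap.trace ℝ V Q.toLinearMap = d := by
    have : Q.toLinearMap = -(p ∘L J ∘L p ∘L J ∘L p).toLinearMap := rfl
    rw [this, map_neg, htJ, neg_neg]
  have hrQ : Module.finrank ℝ (LinearMap.range Q.toLinearMap) = d := by
    have := finrank_range_of_idempotent hQQ
    rw [htQ] at this
    exact_mod_cast this.symm
  have hpQp : ∀ v, (p - Q) ((p - Q) v) = (p - Q) v := fun v => by
    simp only [sub_apply, map_sub, hp, hpQ, hQp, hQQ]; abel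
  have hrpQ : Module.finrank ℝ (LinearMap.range (p - Q).toLinearMap) + d = r := by
    have := finrank_range_of_idempotent hpQp
    have h2 : (p - Q).toLinearMap = p.toLinearMap - Q.toLinearMap := rfl
    rw [h2, map_sub, htp, htQ] at this
    have h3 : (r : ℝ) = Module.finrank ℝ (LinearMap.range (p - Q).toLinearMap) + d := by
      rw [h2]; linarith
    exact_mod_cast h3.symm
  -- Test `hkey` on a nonzero invariant vector `u`. Here `|pJu| = |u| = |Ju|`, so `Ju` lies in the
  -- range of `p` and is orthogonal to `ξ`.
  have hnorm : inner ℝ (p (J ξ)) (p (J ξ)) = inner ℝ ξ ξ := by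
    have hne : LinearMap.range Q.toLinearMap ≠ ⊥ := fun h => by
      rw [h, finrank_bot] at hrQ; omega
    obtain ⟨u, ⟨v, rfl⟩, hu⟩ := Submodule.exists_mem_ne_zero_of_ne_bot hne
    change Q v ≠ 0 at hu
    have h1 := hkey (Q v) (hpQ v)
    have h2 := hQJ (Q v) (Q v) (hpQ v) (hpQ v)
    rw [hQQ] at h2
    have h3 : inner ℝ (p (J (Q v)) - J (Q v)) (p (J (Q v)) - J (Q v)) = 0 := by
      simp only [inner_sub_left, inner_sub_right]
      rw [hJi, real_inner_comm (p (J (Q v))) (J (Q v)), hps, hp, ← hps,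
        real_inner_comm, ← hps] 
      have : inner ℝ (p (J (Q v))) (J (Q v)) = inner ℝ (p (J (Q v))) (p (J (Q v))) := by
        rw [hps (J (Q v)) (p (J (Q v))), hp, ← hps]
      rw [this, ← h2]; ring
    have h4 : p (J (Q v)) = J (Q v) := sub_eq_zero.1 (inner_self_eq_zero.1 h3)
    have h5 : inner ℝ (Q v) (J ξ) = 0 := by
      have := hskew (Q v) ξ
      rw [← h4, hps, hξ, inner_zero_right] at this
      linarith
    rw [h5, ← h2] at h1
    have h6 : inner ℝ (Q v) (Q v) ≠ 0 := fun h => hu (inner_self_eq_zero.1 h)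
    apply mul_right_cancel₀ h6
    linarith
  -- Test `hkey` on an anti-invariant `u`, for which `pJu = 0`. As `r - d ≥ 2`, the functional `⟨Jξ,
  -- ·⟩` has a nonzero kernel vector among these, which removes the middle term.
  have hzero : inner ℝ (p (J ξ)) (p (J ξ)) = 0 := by
    set K := LinearMap.range (p - Q).toLinearMap
    let φ : K →ₗ[ℝ] ℝ := (innerSL ℝ (J ξ)).toLinearMap ∘ₗ K.subtype
    have hker : LinearMap.ker φ ≠ ⊥ := by
      refine LinearMap.ker_ne_bot_of_finrank_lt ?_
      rw [Module.finrank_self]; omega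
    obtain ⟨⟨u, v, rfl⟩, hu, hu0⟩ := Submodule.exists_mem_ne_zero_of_ne_bot hker
    set u := (p - Q) v
    have hu0' : u ≠ 0 := fun h => hu0 (Subtype.ext h)
    have hpu : p u = u := by simp only [u, sub_apply, map_sub, hp, hpQ]
    have hQu : Q u = 0 := by simp only [u, sub_apply, map_sub, hQp, hQQ, sub_self]
    have h1 : inner ℝ u (J ξ) = 0 := by
      rw [real_inner_comm]; exact hu
    have h2 := hQJ u u hpu hpu
    rw [hQu, inner_zero_left] at h2
    have h3 := hkey u hpu
    rw [h1, ← h2] at h3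
    have h6 : inner ℝ u u ≠ 0 := fun h => hu0' (inner_self_eq_zero.1 h)
    apply mul_right_cancel₀ h6
    linarith
  exact inner_self_eq_zero.1 (hnorm.symm.trans hzero)

end PointwiseAlgebra

/-! ### From the global hypotheses on `N` to the pointwise identities. -/

section Sections

set_option linter.unusedSectionVars false

variable {E : Type*} [NormedAddCommGroup E] [NormedSpace ℝ E] [FiniteDimensional ℝ E]
  {M : Type*} [TopologicalSpace M] [T2Space M] [ChartedSpace E M] [IsManifold 𝓘(ℝ, E) ∞ M]
  [RiemannianBundle (TangentSpace 𝓘(ℝ, E) : M → Type _)]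
  [IsContMDiffRiemannianBundle 𝓘(ℝ, E) ∞ E (TangentSpace 𝓘(ℝ, E) : M → Type _)]
  {o y : M} {Y : ∀ x : M, TangentSpace 𝓘(ℝ, E) x} {R : ∀ y : M, Submodule ℝ (TangentSpace 𝓘(ℝ, E) y)}
  {T : ∀ y : M, TangentSpace 𝓘(ℝ, E) y →L[ℝ] TangentSpace 𝓘(ℝ, E) y}
  {r : ℕ} {f : M → ℝ} {P : ∀ y : M, TangentSpace 𝓘(ℝ, E) y →L[ℝ] TangentSpace 𝓘(ℝ, E) y}

/-- A local smooth section of a distribution agrees near a point with a global one. -/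
theorem exists_section_eq {U : Set M} (hU : IsOpen U) (hy : y ∈ U)
    (hY : ∀ p ∈ U, ContMDiffAt 𝓘(ℝ, E) 𝓘(ℝ, E).tangent ∞
      (fun p => (⟨p, Y p⟩ : TangentBundle 𝓘(ℝ, E) M)) p) (hYR : ∀ p, Y p ∈ R p) :
    ∃ X : ∀ x : M, TangentSpace 𝓘(ℝ, E) x, IsSectionOf (E := E) (fun x => x) R X ∧
      ∀ᶠ p in 𝓝 y, X p = Y p := by
  -- Involutivity, total geodesy and `∇P = 0` are stated for global fields, so local ones are cut
  -- off by a bump function equal to `1` near `y`.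
  obtain ⟨χ, -, hχ⟩ := (SmoothBumpFunction.nhds_basis_tsupport (I := 𝓘(ℝ, E)) y).mem_iff.1
    (hU.mem_nhds hy)
  refine ⟨fun p => χ p • Y p, ⟨?_, fun p => (R p).smul_mem _ (hYR p)⟩, ?_⟩
  · exact ContMDiffOn.smul_section_of_tsupport (V := (TangentSpace 𝓘(ℝ, E) : M → Type _))
      χ.contMDiff.contMDiffOn hU hχ (fun p hp => (hY p hp).contMDiffWithinAt)
  · filter_upwards [χ.eventuallyEq_one] with p hp
    rw [hp]; exact one_smul _ _

theorem exists_section_end (hT : SmoothEnd T) (hTR : ∀ p v, T p v ∈ R p) (hy : y ∈ dom (E := E) o)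
    (a : E) : ∃ X : ∀ x : M, TangentSpace 𝓘(ℝ, E) x, IsSectionOf (E := E) (fun x => x) R X ∧
      ∀ᶠ p in 𝓝 y, X p = T p (coordVec o p a) :=
  exists_section_eq (isOpen_dom o) hy (fun _ hp => hT.field hp a) fun p => hTR p _

theorem nablaEnd_kahler (hP : IsKahler P) (hy : y ∈ dom (E := E) o)
    (v a : TangentSpace 𝓘(ℝ, E) y) : nablaEnd o P y v a = 0 := by
  obtain ⟨X, hX, hXe⟩ := exists_section_end (R := fun _ => ⊤) smoothEnd_id
    (fun _ _ => Submodule.mem_top) hy (coordMap o y a)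
  have hXy : X y = a := by rw [hXe.self_of_nhds]; exact coordVec_coordMap hy a
  have hd : DiffField X y := (hX.1 y).mdifferentiableAt (by simp)
  have h1 := hP.parallel X hX.1 y v
  rw [nabla_end hP.smoothEnd hy hd, hXy] at h1
  simpa using h1

/-- `R` is a Clairaut distribution for `f`, with totally geodesic orthogonal complement. -/
structure IsClairautFoliation (R : ∀ y : M, Submodule ℝ (TangentSpace 𝓘(ℝ, E) y)) (r : ℕ)
    (f : M → ℝ) : Prop where
  subbundle : IsSubbundleAlong (E := E) (fun y : M => y) R r
  involutive : IsInvolutive R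
  orthogonal : IsTotallyGeodesicFoliation fun y : M => (R y)ᗮ
  smooth : ContMDiff 𝓘(ℝ, E) 𝓘(ℝ, ℝ) ∞ f
  clairaut : IsClairaut R f

/-- Apply total geodesy of `Rᗮ` to sections `(1 - π)` of coordinate fields: modulo `Rᗮ`, the
derivative of such a section is `-(∇_w π)w'`. -/
theorem proj_nablaEnd_orthogonal (h : IsClairautFoliation R r f) (hy : y ∈ dom (E := E) o)
    {w : TangentSpace 𝓘(ℝ, E) y} (hw : proj R y w = 0) (w' : TangentSpace 𝓘(ℝ, E) y) :
    proj R y (nablaEnd o (proj R) y w w') = 0 := by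
  have hπ := smoothEnd_proj h.subbundle
  have hT := smoothEnd_id.sub hπ
  have hTR : ∀ p v, (ContinuousLinearMap.id ℝ (TangentSpace 𝓘(ℝ, E) p) - proj R p) v ∈ (R p)ᗮ :=
    fun p v => sub_proj_mem p v
  obtain ⟨X, hX, hXe⟩ := exists_section_end hT hTR hy (coordMap o y w)
  obtain ⟨Y, hY, hYe⟩ := exists_section_end hT hTR hy (coordMap o y w')
  have hXy : X y = w := by
    rw [hXe.self_of_nhds, coordVec_coordMap hy, sub_apply, hw]; exact sub_zero _
  have h1 := h.orthogonal.2 X Y hX hY y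
  rw [hXy] at h1
  rw [show nabla Y y w = _ from nabla_congr hYe w,
    nabla_end hT hy (diffField_coordVec hy _), coordVec_coordMap hy,
    nablaEnd_sub smoothEnd_id hπ hy, nablaEnd_id hy, zero_sub] at h1
  have h2 := (R y)ᗮ.sub_mem h1 (hTR y (nabla (fun p => coordVec o p (coordMap o y w')) y w))
  rw [add_sub_cancel_right] at h2
  exact proj_eq_zero_iff.2 (by simpa using (R y)ᗮ.neg_mem h2)

/-- For sections `π` of coordinate fields, the bracket `∇_X Y - ∇_Y X` equals this difference modulo
`R`. -/
theorem nablaEnd_sub_nablaEnd_mem (h : IsClairautFoliation R r f) (hy : y ∈ dom (E := E) o)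
    {u u' : TangentSpace 𝓘(ℝ, E) y} (hu : proj R y u = u) (hu' : proj R y u' = u') :
    nablaEnd o (proj R) y u u' - nablaEnd o (proj R) y u' u ∈ R y := by
  have hπ := smoothEnd_proj h.subbundle
  obtain ⟨X, hX, hXe⟩ := exists_section_end hπ proj_mem hy (coordMap o y u)
  obtain ⟨Y, hY, hYe⟩ := exists_section_end hπ proj_mem hy (coordMap o y u')
  have hXy : X y = u := by rw [hXe.self_of_nhds, coordVec_coordMap hy, hu]
  have hYy : Y y = u' := by rw [hYe.self_of_nhds, coordVec_coordMap hy, hu']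
  have h1 := h.involutive X Y hX hY y
  rw [← nabla_sub_nabla ((hX.1 y).mdifferentiableAt (by simp))
    ((hY.1 y).mdifferentiableAt (by simp)), hXy, hYy,
    show nabla Y y u = _ from nabla_congr hYe u, show nabla X y u' = _ from nabla_congr hXe u',
    nabla_end hπ hy (diffField_coordVec hy _), nabla_end hπ hy (diffField_coordVec hy _),
    coordVec_coordMap hy, coordVec_coordMap hy] at h1
  have h2 := (R y).add_mem ((R y).sub_mem h1
    (proj_mem y (nabla (fun p => coordVec o p (coordMap o y u')) y u)))
    (proj_mem y (nabla (fun p => coordVec o p (coordMap o y u)) y u'))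
  convert h2 using 1
  abel

/-- `∇_v π = -(df ⊗ π v + g(π v, ·) grad f)`. -/
theorem nablaEnd_proj (h : IsClairautFoliation R r f) (hy : y ∈ dom (E := E) o)
    {ξ : TangentSpace 𝓘(ℝ, E) y} (hξ : ∀ v, inner ℝ ξ v = mvfderiv 𝓘(ℝ, E) f y v) :
    proj R y ξ = 0 ∧ ∀ v a, nablaEnd o (proj R) y v a
      = -(mvfderiv 𝓘(ℝ, E) f y a • proj R y v + inner ℝ (proj R y v) a • ξ) := by
  have hπ := smoothEnd_proj h.subbundle
  have hππ : (fun y => proj R y ∘L proj R y) = proj R := by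
    funext y; ext v; exact proj_proj y v
  refine projection_derivative_eq (l := mvfderiv 𝓘(ℝ, E) f y) (proj_proj y) (inner_proj_left y)
    nablaEnd_add_vec (fun v a => ?_) (inner_nablaEnd hπ inner_proj_left hy)
    (clairaut_deriv h.subbundle h.smooth h.clairaut hy)
    (fun w w' hw _ => proj_nablaEnd_orthogonal h hy hw w')
    (fun u u' hu hu' => proj_eq_self (nablaEnd_sub_nablaEnd_mem h hy hu hu')) hξ
  have := nablaEnd_comp hπ hπ hy v a
  rw [hππ] at this
  exact this.symm

theorem exists_gradient (f : M → ℝ) (y : M) :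
    ∃ ξ : TangentSpace 𝓘(ℝ, E) y, ∀ v, inner ℝ ξ v = mvfderiv 𝓘(ℝ, E) f y v := by
  have : CompleteSpace (TangentSpace 𝓘(ℝ, E) y) := FiniteDimensional.complete ℝ _
  let l : TangentSpace 𝓘(ℝ, E) y →L[ℝ] ℝ := mvfderiv 𝓘(ℝ, E) f y
  exact ⟨(InnerProductSpace.toDual ℝ (TangentSpace 𝓘(ℝ, E) y)).symm l,
    fun v => InnerProductSpace.toDual_symm_apply⟩

theorem mvfderiv_proj (h : IsClairautFoliation R r f) (v : TangentSpace 𝓘(ℝ, E) y) :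
    mvfderiv 𝓘(ℝ, E) f y (proj R y v) = 0 := by
  obtain ⟨ξ, hξ⟩ := exists_gradient (E := E) f y
  have h1 := (nablaEnd_proj h (self_mem_dom y) hξ).1
  rw [← hξ, ← inner_proj_left, h1, inner_zero_left]

/-- The obstruction `π P π P (1 - π)` to semi-invariance. -/
def semi (R : ∀ y : M, Submodule ℝ (TangentSpace 𝓘(ℝ, E) y))
    (P : ∀ y : M, TangentSpace 𝓘(ℝ, E) y →L[ℝ] TangentSpace 𝓘(ℝ, E) y) (y : M) :
    TangentSpace 𝓘(ℝ, E) y →L[ℝ] TangentSpace 𝓘(ℝ, E) y :=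
  proj R y ∘L P y ∘L proj R y ∘L P y ∘L
    (ContinuousLinearMap.id ℝ (TangentSpace 𝓘(ℝ, E) y) - proj R y)

/-- `(π P π)²`. -/
def phiSq (R : ∀ y : M, Submodule ℝ (TangentSpace 𝓘(ℝ, E) y))
    (P : ∀ y : M, TangentSpace 𝓘(ℝ, E) y →L[ℝ] TangentSpace 𝓘(ℝ, E) y) (y : M) :
    TangentSpace 𝓘(ℝ, E) y →L[ℝ] TangentSpace 𝓘(ℝ, E) y :=
  proj R y ∘L P y ∘L proj R y ∘L P y ∘L proj R y

theorem smoothEnd_semi (hπ : SmoothEnd (proj R)) (hP : SmoothEnd P) : SmoothEnd (semi R P) :=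
  hπ.comp (hP.comp (hπ.comp (hP.comp (smoothEnd_id.sub hπ))))

theorem smoothEnd_phiSq (hπ : SmoothEnd (proj R)) (hP : SmoothEnd P) : SmoothEnd (phiSq R P) :=
  hπ.comp (hP.comp (hπ.comp (hP.comp hπ)))

/-- As `∇P = 0`, the product rule differentiates only the three occurrences of `π`; the last, in `1
- π`, brings the minus sign. -/
theorem nablaEnd_semi (hπ : SmoothEnd (proj R)) (hP : IsKahler P) (hy : y ∈ dom (E := E) o)
    (u a : TangentSpace 𝓘(ℝ, E) y) :
    nablaEnd o (semi R P) y u a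
      = nablaEnd o (proj R) y u (P y (proj R y (P y (a - proj R y a))))
        + proj R y (P y (nablaEnd o (proj R) y u (P y (a - proj R y a))))
        - proj R y (P y (proj R y (P y (nablaEnd o (proj R) y u a)))) := by
  have hP' := hP.smoothEnd
  have h1 := smoothEnd_id.sub hπ
  have h2 := hP'.comp h1
  have h3 := hπ.comp h2
  have h4 := hP'.comp h3
  refine (nablaEnd_comp hπ h4 hy u a).trans ?_
  rw [nablaEnd_comp hP' h3 hy, nablaEnd_kahler hP hy, nablaEnd_comp hπ h2 hy,
    nablaEnd_comp hP' h1 hy, nablaEnd_kahler hP hy, nablaEnd_sub smoothEnd_id hπ hy,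
    nablaEnd_id hy]
  simp only [zero_add, zero_sub, map_neg, map_add, ContinuousLinearMap.comp_apply, sub_apply,
    ContinuousLinearMap.id_apply]
  abel

theorem trace_proj (hR : IsSubbundleAlong (E := E) (fun y : M => y) R r) (y : M) :
    LinearMap.trace ℝ (TangentSpace 𝓘(ℝ, E) y) (proj R y).toLinearMap = r := by
  have h1 : LinearMap.IsProj (R y) (proj R y).toLinearMap :=
    ⟨proj_mem y, fun v hv => proj_eq_self hv⟩
  rw [h1.trace]
  obtain ⟨U, hU, e, -, he⟩ := hR y
  obtain ⟨hli, hsp⟩ := he y (mem_of_mem_nhds hU)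
  rw [← hsp, finrank_span_eq_card hli, Fintype.card_fin]

/-- The differential of `f` vanishes where the distribution is semi-invariant to first order. -/
theorem mvfderiv_eq_zero_of_semi (h : IsClairautFoliation R r f) (hP : IsKahler P)
    (hy : y ∈ dom (E := E) o) (hS : semi R P y = 0)
    (hS' : ∀ u, proj R y u = u → nablaEnd o (semi R P) y u = 0) {d : ℕ}
    (ht : LinearMap.trace ℝ (TangentSpace 𝓘(ℝ, E) y) (phiSq R P y).toLinearMap = -d)
    (hd : 0 < d) (hr : d + 1 < r) : mvfderiv 𝓘(ℝ, E) f y = 0 := by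
  obtain ⟨ξ, hξ⟩ := exists_gradient (E := E) f y
  have hπ := smoothEnd_proj h.subbundle
  obtain ⟨hpξ, hA⟩ := nablaEnd_proj h hy hξ
  have h0 : ξ = 0 := by
    refine gradient_eq_zero (p := proj R y) (J := P y) (D := nablaEnd o (proj R) y)
      (proj_proj y) (inner_proj_left y) (hP.sq_eq y) (hP.inner_eq y) hpξ
      (fun v => congrArg (fun T => T v) hS) (fun u a hu => ?_) (fun u hu => ?_)
      (trace_proj h.subbundle y) ht hd hr
    · rw [hA, hu, hξ]
    · have h1 : nablaEnd o (semi R P) y u ξ = 0 := by rw [hS' u hu]; rfl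
      rw [nablaEnd_semi hπ hP hy, hpξ, sub_zero] at h1
      exact h1
  ext v
  rw [← hξ, h0, inner_zero_left]
  rfl

end Sections

/-! ### Propagation of semi-invariance away from a critical point of `f`. -/

section Propagation

set_option linter.unusedSectionVars false

/-- Grönwall's inequality, with the continuous coefficient replaced by its bound on the compact
interval. -/
theorem eq_zero_of_linear_ode {W : Type*} [NormedAddCommGroup W] [NormedSpace ℝ W]
    {w w' : ℝ → W} {k : ℝ → ℝ} {a b : ℝ}
    (hw : ∀ t ∈ Icc a b, HasDerivWithinAt w (w' t) (Icc a b) t) (hk : ContinuousOn k (Icc a b))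
    (hb : ∀ t ∈ Icc a b, ‖w' t‖ ≤ k t * ‖w t‖) (h0 : w a = 0) : ∀ t ∈ Icc a b, w t = 0 := by
  obtain ⟨K, hK⟩ := isCompact_Icc.exists_bound_of_continuousOn hk
  refine eq_zero_of_abs_deriv_le_mul_abs_self_of_eq_zero_right (f' := w') (K := K)
    (HasDerivWithinAt.continuousOn hw) (fun t ht => ?_) h0 fun t ht => ?_
  · exact (hw t (Ico_subset_Icc_self ht)).mono_of_mem_nhdsWithin (Icc_mem_nhdsGE_of_mem ht)
  · have ht' := Ico_subset_Icc_self ht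
    refine (hb t ht').trans ?_
    gcongr
    exact (le_abs_self _).trans (hK t ht')

variable {E : Type*} [NormedAddCommGroup E] [NormedSpace ℝ E] [FiniteDimensional ℝ E]
  {M : Type*} [TopologicalSpace M] [T2Space M] [ChartedSpace E M] [IsManifold 𝓘(ℝ, E) ∞ M]
  [RiemannianBundle (TangentSpace 𝓘(ℝ, E) : M → Type _)]
  [IsContMDiffRiemannianBundle 𝓘(ℝ, E) ∞ E (TangentSpace 𝓘(ℝ, E) : M → Type _)]
  {o y : M} {x : E} {R : ∀ y : M, Submodule ℝ (TangentSpace 𝓘(ℝ, E) y)}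
  {T : ∀ y : M, TangentSpace 𝓘(ℝ, E) y →L[ℝ] TangentSpace 𝓘(ℝ, E) y}
  {r : ℕ} {f : M → ℝ} {P : ∀ y : M, TangentSpace 𝓘(ℝ, E) y →L[ℝ] TangentSpace 𝓘(ℝ, E) y}

theorem endHat_eq_zero_iff (hx : x ∈ cod o) : endHat o T x = 0 ↔ T (pt o x) = 0 := by
  constructor
  · intro h
    ext v
    rw [← coordVec_coordMap (pt_mem_dom hx) v, ← coordVec_endHat hx, h]
    simp
  · intro h
    ext a
    rw [endHat_apply, h]
    simp

theorem contDiffAt_comp_pt (hf : ContMDiff 𝓘(ℝ, E) 𝓘(ℝ, ℝ) ∞ f) (hx : x ∈ cod o) :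
    ContDiffAt ℝ ∞ (fun z => f (pt o z)) x := contDiffAt_chart_symm hx (hf _)

theorem fderiv_comp_pt (hf : ContMDiff 𝓘(ℝ, E) 𝓘(ℝ, ℝ) ∞ f) (hx : x ∈ cod o) (a : E) :
    fderiv ℝ (fun z => f (pt o z)) x a
      = mvfderiv 𝓘(ℝ, E) f (pt o x) (coordVec o (pt o x) a) := by
  rw [mvfderiv_coordVec (pt_mem_dom hx) (hf.mdifferentiable (by simp) _), chart_pt hx]
  rfl

theorem fderiv_comp_pt_eq_zero_iff (hf : ContMDiff 𝓘(ℝ, E) 𝓘(ℝ, ℝ) ∞ f) (hx : x ∈ cod o) :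
    fderiv ℝ (fun z => f (pt o z)) x = 0 ↔ mvfderiv 𝓘(ℝ, E) f (pt o x) = 0 := by
  constructor
  · intro h
    ext v
    rw [← coordVec_coordMap (pt_mem_dom hx) v, ← fderiv_comp_pt hf hx, h]
    simp
  · intro h
    ext a
    rw [fderiv_comp_pt hf hx, h]
    simp

/-- By `nablaEnd_proj`, every term of `∇_u π` contains `πu` and one of `df`, `ξ`. So it vanishes in
either case, and with it `∇_u S`. -/
theorem cov_semi_eq_zero (h : IsClairautFoliation R r f) (hP : IsKahler P) (hx : x ∈ cod o)
    {u : E} (hu : mvfderiv 𝓘(ℝ, E) f (pt o x) = 0 ∨ endHat o (proj R) x u = 0) :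
    cov o (semi R P) x u = 0 := by
  have hy := pt_mem_dom hx
  have hπ := smoothEnd_proj h.subbundle
  obtain ⟨ξ, hξ⟩ := exists_gradient (E := E) f (pt o x)
  have hA : ∀ a, nablaEnd o (proj R) (pt o x) (coordVec o (pt o x) u) a = 0 := fun a => by
    rw [(nablaEnd_proj h hy hξ).2]
    rcases hu with hu | hu
    · have h0 : ξ = 0 := by
        rw [← inner_self_eq_zero (𝕜 := ℝ), hξ, hu]; rfl
      rw [hu, h0]
      simp
    · rw [← coordVec_endHat hx, hu]
      simp
  ext a
  have h1 := nablaEnd_semi hπ hP hy (coordVec o (pt o x) u) (coordVec o (pt o x) a)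
  rw [nablaEnd_pt hx] at h1
  simp only [hA, map_zero, add_zero, sub_zero] at h1
  rw [← coordMap_coordVec hy (cov o (semi R P) x u a), h1, map_zero]
  rfl

theorem continuousAt_christoffel (hx : x ∈ cod (E := E) o) (u : E) :
    ContinuousAt (fun p : E × E => christoffel (metric o) p.1 p.2) (x, u) := by
  have : ContDiffAt ℝ ∞ (fun p : E × E => christoffel (metric o) p.1 p.2) (x, u) :=
    contDiffAt_clm_of_apply fun a =>
      (contDiffAt_christoffel_apply (contDiffAt_metric hx) (metric_isInvertible hx) u a).comp (x, u)
        (contDiffAt_fst.prodMk (contDiffAt_snd.prodMk contDiffAt_const))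
  exact this.continuousAt

theorem contDiffAt_fderiv_of_top {V W : Type*} [NormedAddCommGroup V] [NormedSpace ℝ V]
    [NormedAddCommGroup W] [NormedSpace ℝ W] {g : V → W} {x : V} (hg : ContDiffAt ℝ ∞ g x) :
    ContDiffAt ℝ ∞ (fderiv ℝ g) x := hg.fderiv_right (by simp)

/-- Semi-invariance propagates from a critical point of `f`: the differential of `f` stays zero
along `R`, and the obstruction to semi-invariance is parallel along such curves and along `Rᗮ`. -/
theorem eventually_semi_eq_zero (h : IsClairautFoliation R r f) (hP : IsKahler P)
    (hdf : mvfderiv 𝓘(ℝ, E) f y = 0) (hS : semi R P y = 0) :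
    ∀ᶠ p in 𝓝 y, semi R P p = 0 := by
  have hyd := self_mem_dom (E := E) y
  have hπ := smoothEnd_proj h.subbundle
  have hSs := smoothEnd_semi hπ hP.smoothEnd
  set x₀ := extChartAt 𝓘(ℝ, E) y y
  have hx₀ : x₀ ∈ cod y := chart_mem_cod hyd
  have hpt : pt y x₀ = y := pt_chart hyd
  set fh : E → ℝ := fun z => f (pt y z)
  set pH := endHat y (proj R)
  set sH := endHat y (semi R P)
  have hfh : ∀ z ∈ cod y, ContDiffAt ℝ ∞ fh z := fun z hz => contDiffAt_comp_pt h.smooth hz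
  have hpH : ∀ z ∈ cod y, ContDiffAt ℝ ∞ pH z := fun z hz => hπ y z hz
  have hpp : ∀ z ∈ cod y, ∀ s, pH z (pH z s) = pH z s := fun z hz s => by
    simp only [pH]
    rw [endHat_apply, coordVec_endHat hz, proj_proj]
    rfl
  have hvan : ∀ z ∈ cod y, ∀ s, fderiv ℝ fh z (pH z s) = 0 := fun z hz s => by
    rw [fderiv_comp_pt h.smooth hz, coordVec_endHat hz, mvfderiv_proj h]
  -- Differentiate `df(πs) = 0` in the direction `a` and use symmetry of the second derivative.
  -- Along `R` this bounds the derivative of `df` linearly by `df`.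
  have hsecond : ∀ z ∈ cod y, ∀ s a, fderiv ℝ (fderiv ℝ fh) z (pH z s) a
      = -fderiv ℝ fh z (fderiv ℝ pH z a s) := fun z hz s a => by
    have h1 := (((contDiffAt_fderiv_of_top (hfh z hz)).differentiableAt (by simp)).hasFDerivAt.clm_apply
      (((hpH z hz).differentiableAt (by simp)).hasFDerivAt.clm_apply (hasFDerivAt_const s z)))
    have h2 : (fun z => fderiv ℝ fh z (pH z s)) =ᶠ[𝓝 z] fun _ => 0 := by
      filter_upwards [cod_mem_nhds hz] with q hq using hvan q hq s
    have h3 := h1.unique ((hasFDerivAt_const (0 : ℝ) z).congr_of_eventuallyEq h2)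
    have h4 := congrArg (fun L => L a) h3
    have hsym : IsSymmSndFDerivAt ℝ fh z := (hfh z hz).isSymmSndFDerivAt (by
      simp only [minSmoothness_of_isRCLikeNormedField]
      exact WithTop.coe_le_coe.2 (le_top : (2 : ℕ∞) ≤ ⊤))
    rw [hsym.eq]
    simp at h4
    linarith
  have hmain : ∀ᶠ z in 𝓝 x₀, sH z = 0 := by
    filter_upwards [exists_broken_curve ((hpH x₀ hx₀).of_le (by simp)) (cod_mem_nhds hx₀)]
    rintro z ⟨s, γ, hγ0, hγ2, hcod, hγ⟩
    -- The velocity lies in `R` for `t ≤ 1` and in `Rᗮ` for `t ≥ 1`.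
    set γ' : ℝ → E := fun t =>
      deriv firstRamp t • pH (γ t) s + deriv secondRamp t • (s - pH (γ t) s)
    have hγc : ContinuousOn γ (Icc 0 2) := HasDerivWithinAt.continuousOn hγ
    have hαc : Continuous (deriv firstRamp) :=
      (contDiff_firstRamp.of_le (by simp) : ContDiff ℝ 1 _).continuous_deriv le_rfl
    have hβc : Continuous (deriv secondRamp) :=
      (contDiff_secondRamp.of_le (by simp) : ContDiff ℝ 1 _).continuous_deriv le_rfl
    have hpγ : ContinuousOn (fun t => pH (γ t) s) (Icc 0 2) := fun t ht =>
      ((((hpH _ (hcod t ht)).continuousAt).comp_continuousWithinAt (hγc t ht)).clm_apply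
        continuousWithinAt_const)
    have hγ'c : ContinuousOn γ' (Icc 0 2) :=
      (hαc.continuousOn.smul hpγ).add (hβc.continuousOn.smul (continuousOn_const.sub hpγ))
    have hsub : Icc (0 : ℝ) 1 ⊆ Icc 0 2 := Icc_subset_Icc le_rfl (by norm_num)
    have hγ'1 : ∀ t ≤ (1 : ℝ), γ' t = deriv firstRamp t • pH (γ t) s := fun t ht => by
      simp [γ', deriv_secondRamp_eq_zero ht]
    have hγ'2 : ∀ t, (1 : ℝ) ≤ t → γ' t = deriv secondRamp t • (s - pH (γ t) s) := fun t ht => by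
      simp [γ', deriv_firstRamp_eq_zero ht]
    have hgrad : ∀ t ∈ Icc (0 : ℝ) 1, fderiv ℝ fh (γ t) = 0 := by
      refine eq_zero_of_linear_ode (k := fun t => |deriv firstRamp t| * (‖fderiv ℝ pH (γ t)‖ * ‖s‖))
        (w' := fun t => fderiv ℝ (fderiv ℝ fh) (γ t) (γ' t)) (fun t ht => ?_) ?_ (fun t ht => ?_) ?_
      · exact ((contDiffAt_fderiv_of_top (hfh _ (hcod t (hsub ht)))).differentiableAt
          (by simp)).hasFDerivAt.comp_hasDerivWithinAt t ((hγ t (hsub ht)).mono hsub)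
      · refine (hαc.abs.continuousOn).mul (ContinuousOn.mul (ContinuousOn.norm fun t ht => ?_)
          continuousOn_const)
        exact (contDiffAt_fderiv_of_top (hpH _ (hcod t (hsub ht)))).continuousAt.comp_continuousWithinAt
          ((hγc t (hsub ht)).mono hsub)
      · refine ContinuousLinearMap.opNorm_le_bound _ (by positivity) fun a => ?_
        rw [hγ'1 t ht.2, map_smul, smul_apply, hsecond _ (hcod t (hsub ht)), norm_smul, norm_neg]
        calc ‖deriv firstRamp t‖ * ‖fderiv ℝ fh (γ t) (fderiv ℝ pH (γ t) a s)‖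
            ≤ |deriv firstRamp t| * (‖fderiv ℝ fh (γ t)‖ * (‖fderiv ℝ pH (γ t)‖ * ‖a‖ * ‖s‖)) := by
              rw [Real.norm_eq_abs]
              gcongr
              refine (ContinuousLinearMap.le_opNorm _ _).trans ?_
              gcongr
              refine (ContinuousLinearMap.le_opNorm _ _).trans ?_
              gcongr
              exact ContinuousLinearMap.le_opNorm _ _
          _ = _ := by ring
      · rw [hγ0]
        exact (fderiv_comp_pt_eq_zero_iff h.smooth hx₀).2 (by rw [hpt]; exact hdf)
    have hcov : ∀ t ∈ Icc (0 : ℝ) 2, cov y (semi R P) (γ t) (γ' t) = 0 := fun t ht => by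
      rcases le_total t 1 with h1 | h1
      · exact cov_semi_eq_zero h hP (hcod t ht) (Or.inl
          ((fderiv_comp_pt_eq_zero_iff h.smooth (hcod t ht)).1 (hgrad t ⟨ht.1, h1⟩)))
      · refine cov_semi_eq_zero h hP (hcod t ht) (Or.inr ?_)
        rw [hγ'2 t h1, map_smul, map_sub, hpp _ (hcod t ht), sub_self, smul_zero]
    -- Being parallel along `γ` means `S' = SΓ - ΓS` in coordinates, a linear ODE with zero initial
    -- value; this explains the factor `2` in `k`.
    have hSγ : ∀ t ∈ Icc (0 : ℝ) 2, sH (γ t) = 0 := by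
      refine eq_zero_of_linear_ode
        (k := fun t => 2 * ‖christoffel (metric y) (γ t) (γ' t)‖)
        (w' := fun t => fderiv ℝ sH (γ t) (γ' t)) (fun t ht => ?_) ?_ (fun t ht => ?_) ?_
      · exact ((hSs y _ (hcod t ht)).differentiableAt
          (by simp)).hasFDerivAt.comp_hasDerivWithinAt t (hγ t ht)
      · refine continuousOn_const.mul (ContinuousOn.norm fun t ht => ?_)
        exact ContinuousAt.comp_continuousWithinAt (f := fun t => (γ t, γ' t))
          (continuousAt_christoffel (hcod t ht) (γ' t)) ((hγc t ht).prodMk (hγ'c t ht))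
      · have h1 : fderiv ℝ sH (γ t) (γ' t) = sH (γ t) ∘L christoffel (metric y) (γ t) (γ' t)
            - christoffel (metric y) (γ t) (γ' t) ∘L sH (γ t) := by
          have h2 := hcov t ht
          rw [cov, sub_eq_zero, ← eq_sub_iff_add_eq] at h2
          exact h2
        rw [h1]
        calc _ ≤ ‖sH (γ t)‖ * ‖christoffel (metric y) (γ t) (γ' t)‖
              + ‖christoffel (metric y) (γ t) (γ' t)‖ * ‖sH (γ t)‖ :=
              (norm_sub_le _ _).trans (add_le_add (ContinuousLinearMap.opNorm_comp_le _ _)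
                (ContinuousLinearMap.opNorm_comp_le _ _))
          _ = _ := by ring
      · rw [hγ0]
        exact (endHat_eq_zero_iff hx₀).2 (by rw [hpt]; exact hS)
    rw [← hγ2]
    exact hSγ 2 ⟨by norm_num, le_rfl⟩
  have hc : ContinuousAt (extChartAt 𝓘(ℝ, E) y) y := continuousAt_extChartAt y
  filter_upwards [hc.eventually hmain, dom_mem_nhds hyd] with p hp hpd
  have := (endHat_eq_zero_iff (chart_mem_cod hpd)).1 hp
  rwa [pt_chart hpd] at this

end Propagation

/-! ### The good set is clopen. -/

section Critical

set_option linter.unusedSectionVars false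

variable {E : Type*} [NormedAddCommGroup E] [NormedSpace ℝ E] [FiniteDimensional ℝ E]
  {M : Type*} [TopologicalSpace M] [T2Space M] [ChartedSpace E M] [IsManifold 𝓘(ℝ, E) ∞ M]
  [RiemannianBundle (TangentSpace 𝓘(ℝ, E) : M → Type _)]
  [IsContMDiffRiemannianBundle 𝓘(ℝ, E) ∞ E (TangentSpace 𝓘(ℝ, E) : M → Type _)]
  {o y : M} {x : E} {R : ∀ y : M, Submodule ℝ (TangentSpace 𝓘(ℝ, E) y)}
  {T : ∀ y : M, TangentSpace 𝓘(ℝ, E) y →L[ℝ] TangentSpace 𝓘(ℝ, E) y}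
  {r : ℕ} {f : M → ℝ} {P : ∀ y : M, TangentSpace 𝓘(ℝ, E) y →L[ℝ] TangentSpace 𝓘(ℝ, E) y}

theorem nablaEnd_eq_zero_of_eventually (hy : y ∈ dom (E := E) o) (hT : ∀ᶠ p in 𝓝 y, T p = 0)
    (v : TangentSpace 𝓘(ℝ, E) y) : nablaEnd o T y v = 0 := by
  obtain ⟨x, hx, rfl⟩ := exists_pt_eq hy
  have hc : ContinuousAt (pt (E := E) o) x := (contMDiffAt_chart_symm hx).continuousAt
  have h1 : endHat o T =ᶠ[𝓝 x] fun _ => 0 := by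
    filter_upwards [hc.eventually hT, cod_mem_nhds hx] with z hz hz'
      using (endHat_eq_zero_iff hz').2 hz
  ext a
  rw [nablaEnd_apply, cov, chart_pt hx, h1.fderiv_eq, h1.self_of_nhds]
  simp

theorem eventually_of_chart (hy : y ∈ dom (E := E) o) {p : M → Prop} {q : E → Prop}
    (h : ∀ x ∈ cod (E := E) o, q x → p (pt o x)) (hq : ∀ᶠ x in 𝓝 (extChartAt 𝓘(ℝ, E) o y), q x) :
    ∀ᶠ y' in 𝓝 y, p y' := by
  have hc : ContinuousAt (extChartAt 𝓘(ℝ, E) o) y := (contMDiffAt_chart hy).continuousAt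
  filter_upwards [hc.eventually hq, dom_mem_nhds hy] with y' h1 h2
  have := h _ (chart_mem_cod h2) h1
  rwa [pt_chart h2] at this

theorem trace_endHat (hx : x ∈ cod o) :
    LinearMap.trace ℝ E (endHat o T x).toLinearMap
      = LinearMap.trace ℝ (TangentSpace 𝓘(ℝ, E) (pt o x)) (T (pt o x)).toLinearMap := by
  have h1 : (endHat o T x).toLinearMap = (coordMap o (pt o x)).toLinearMap ∘ₗ
      ((T (pt o x)).toLinearMap ∘ₗ (coordVec o (pt o x)).toLinearMap) := rfl
  rw [h1, LinearMap.trace_comp_comm']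
  congr 1
  ext v
  exact congrArg _ (coordVec_coordMap (pt_mem_dom hx) v)

theorem continuous_trace :
    Continuous fun A : E →L[ℝ] E => LinearMap.trace ℝ E A.toLinearMap :=
  ((LinearMap.trace ℝ E) ∘ₗ ContinuousLinearMap.coeLM ℝ).continuous_of_finiteDimensional

theorem continuous_trace_smoothEnd (hT : SmoothEnd T) : Continuous fun y =>
    LinearMap.trace ℝ (TangentSpace 𝓘(ℝ, E) y) (T y).toLinearMap := by
  refine continuous_iff_continuousAt.2 fun y => ?_
  have hy := self_mem_dom (E := E) y
  have hc : ContinuousAt (extChartAt 𝓘(ℝ, E) y) y := (contMDiffAt_chart hy).continuousAt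
  have h1 : ContinuousAt (fun x => LinearMap.trace ℝ E (endHat y T x).toLinearMap)
      (extChartAt 𝓘(ℝ, E) y y) :=
    continuous_trace.continuousAt.comp (hT y _ (chart_mem_cod hy)).continuousAt
  refine (ContinuousAt.comp (f := extChartAt 𝓘(ℝ, E) y) h1 hc).congr ?_
  filter_upwards [dom_mem_nhds hy] with p hp
  have := trace_endHat (T := T) (chart_mem_cod hp)
  rw [pt_chart hp] at this
  exact this

/-- Where `S = 0`, minus this operator is idempotent and its trace is its rank. Integrality makes
the continuous trace locally constant where `S` vanishes. -/
theorem trace_phiSq_nat (hP : IsKahler P) (hS : semi R P y = 0) :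
    ∃ k : ℕ, LinearMap.trace ℝ (TangentSpace 𝓘(ℝ, E) y) (phiSq R P y).toLinearMap = -k := by
  have h1 := finrank_range_of_idempotent (Q := -phiSq R P y) fun v => by
    have := idempotent_of_semiInvariant (p := proj R y) (J := P y) (proj_proj y) (hP.sq_eq y)
      (fun v => congrArg (fun T => T v) hS) v
    have h2 : phiSq R P y (phiSq R P y v) = -phiSq R P y v := this
    simp [h2]
  refine ⟨_, neg_eq_iff_eq_neg.1 (Eq.trans ?_ h1)⟩
  rw [← map_neg]
  rfl

/-- The set where `f` is critical, `R` is semi-invariant and the invariant part has dimension `d`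
is closed and open. -/
theorem isClopen_critical (h : IsClairautFoliation R r f) (hP : IsKahler P) {d : ℕ} (hd : 0 < d)
    (hr : d + 1 < r) :
    IsClopen {y : M | mvfderiv 𝓘(ℝ, E) f y = 0 ∧ semi R P y = 0 ∧
      LinearMap.trace ℝ (TangentSpace 𝓘(ℝ, E) y) (phiSq R P y).toLinearMap = -d} := by
  have hπ := smoothEnd_proj h.subbundle
  have hSs := smoothEnd_semi hπ hP.smoothEnd
  have htr := continuous_trace_smoothEnd (smoothEnd_phiSq hπ hP.smoothEnd)
  constructor
  · rw [← isOpen_compl_iff, isOpen_iff_eventually]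
    intro y hy
    have hyd := self_mem_dom (E := E) y
    have hx := chart_mem_cod hyd
    simp only [mem_compl_iff, mem_ofPred_eq, not_and_or] at hy ⊢
    rcases hy with hy | hy | hy
    · have hc : ContinuousAt (fderiv ℝ fun z => f (pt y z)) (extChartAt 𝓘(ℝ, E) y y) :=
        (contDiffAt_fderiv_of_top (contDiffAt_comp_pt h.smooth hx)).continuousAt
      refine (eventually_of_chart hyd (fun x hx h1 => ?_) (hc.eventually_ne (y := 0) ?_)).mono
        fun p hp => Or.inl hp
      · rwa [← fderiv_comp_pt_eq_zero_iff h.smooth hx]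
      · rwa [Ne, fderiv_comp_pt_eq_zero_iff h.smooth hx, pt_chart hyd]
    · refine (eventually_of_chart hyd (fun x hx h1 => ?_)
        ((hSs y _ hx).continuousAt.eventually_ne (y := 0) ?_)).mono fun p hp => Or.inr (Or.inl hp)
      · rwa [← endHat_eq_zero_iff hx]
      · rwa [Ne, endHat_eq_zero_iff hx, pt_chart hyd]
    · exact (htr.continuousAt.eventually_ne hy).mono fun p hp => Or.inr (Or.inr hp)
  · rw [isOpen_iff_eventually]
    rintro y ⟨h1, h2, h3⟩
    have hS := eventually_semi_eq_zero h hP h1 h2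
    -- A trace within distance `1` of `-d` that is minus a natural number must equal `-d`.
    have hlt : ∀ᶠ p in 𝓝 y, |LinearMap.trace ℝ (TangentSpace 𝓘(ℝ, E) p)
        (phiSq R P p).toLinearMap + d| < 1 := by
      have hc := (htr.add (continuous_const (y := (d : ℝ)))).abs
      refine hc.continuousAt.eventually (gt_mem_nhds (show
        |LinearMap.trace ℝ (TangentSpace 𝓘(ℝ, E) y) (phiSq R P y).toLinearMap + (d : ℝ)| < 1 from ?_))
      rw [h3]; simp
    filter_upwards [eventually_eventually_nhds.2 hS, hlt] with p hp hpd
    have hp0 := hp.self_of_nhds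
    obtain ⟨k, hk⟩ := trace_phiSq_nat hP hp0
    have hkd : k = d := by
      rw [hk, abs_lt] at hpd
      have e1 : (d : ℝ) < k + 1 := by linarith [hpd.2]
      have e2 : (k : ℝ) < d + 1 := by linarith [hpd.1]
      norm_cast at e1 e2
      omega
    rw [hkd] at hk
    exact ⟨mvfderiv_eq_zero_of_semi h hP (self_mem_dom p) hp0
      (fun u _ => nablaEnd_eq_zero_of_eventually (self_mem_dom p) hp u) hk hd hr, hp0, hk⟩

end Critical

/-! ### Linear algebra of a semi-invariant subspace. -/

section SemiInvariantAlgebra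

set_option linter.unusedSectionVars false

variable {V : Type*} [NormedAddCommGroup V] [InnerProductSpace ℝ V] [FiniteDimensional ℝ V]
  {J : V →L[ℝ] V} {K D₁ D₂ : Submodule ℝ V}

/-- Apply the isometry `J`: `Ju` stays in `D₁ ⊆ K`, while `Jw` is orthogonal to `K`. -/
theorem inner_eq_zero_of_semiInvariant (hJi : ∀ v w, inner ℝ (J v) (J w) = inner ℝ v w)
    (hK : D₁ ⊔ D₂ = K) (h1 : D₁.map J.toLinearMap = D₁) (h2 : ∀ v ∈ D₂, J v ∈ Kᗮ)
    {u w : V} (hu : u ∈ D₁) (hw : w ∈ D₂) : inner ℝ u w = 0 := by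
  have hJu : J u ∈ D₁ := by
    have := Submodule.mem_map_of_mem (f := J.toLinearMap) hu
    rwa [h1] at this
  rw [← hJi]
  exact Submodule.inner_right_of_mem_orthogonal (hK ▸ Submodule.mem_sup_left hJu) (h2 w hw)

theorem finrank_of_semiInvariant (hJi : ∀ v w, inner ℝ (J v) (J w) = inner ℝ v w)
    (hK : D₁ ⊔ D₂ = K) (h1 : D₁.map J.toLinearMap = D₁) (h2 : ∀ v ∈ D₂, J v ∈ Kᗮ) :
    Module.finrank ℝ K = Module.finrank ℝ D₁ + Module.finrank ℝ D₂ := by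
  have h0 : D₁ ⊓ D₂ = ⊥ := (Submodule.eq_bot_iff _).2 fun u hu =>
    inner_self_eq_zero (𝕜 := ℝ).1 (inner_eq_zero_of_semiInvariant hJi hK h1 h2 hu.1 hu.2)
  have := Submodule.finrank_sup_add_finrank_inf_eq D₁ D₂
  rwa [h0, finrank_bot, add_zero, hK] at this

/-- The vector `u` is the `D₁`-component of `v`: the projection keeps `Ju` and kills `J` of the
`D₂`-component. The last clause lets `trace_of_semiInvariant` recognise a projection onto `D₁`. -/
theorem exists_decomposition_of_semiInvariant (hJ : ∀ v, J (J v) = -v)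
    (hK : D₁ ⊔ D₂ = K) (h1 : D₁.map J.toLinearMap = D₁) (h2 : ∀ v ∈ D₂, J v ∈ Kᗮ)
    {v : V} (hv : v ∈ K) :
    ∃ u ∈ D₁, J (K.starProjection (J v)) = -u ∧ (v ∈ D₁ → u = v) := by
  have hmem : ∀ u ∈ D₁, K.starProjection (J u) = J u := fun u hu => by
    refine Submodule.starProjection_eq_self_iff.2 (hK ▸ Submodule.mem_sup_left ?_)
    have := Submodule.mem_map_of_mem (f := J.toLinearMap) hu
    rwa [h1] at this
  by_cases hv1 : v ∈ D₁
  · exact ⟨v, hv1, by rw [hmem v hv1, hJ], fun _ => rfl⟩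
  · obtain ⟨u, hu, w, hw, rfl⟩ := Submodule.mem_sup.1 (hK ▸ hv : v ∈ D₁ ⊔ D₂)
    refine ⟨u, hu, ?_, fun h => absurd h hv1⟩
    rw [map_add, map_add, hmem u hu, (Submodule.starProjection_apply_eq_zero_iff _).2 (h2 w hw),
      add_zero, hJ]

/-- Move all operators to the test vector by self-adjointness of the projection and skewness of `J`:
they send it into `D₁ ⊆ K`, which is orthogonal to `v - Kv`. -/
theorem obstruction_eq_zero_of_semiInvariant (hJ : ∀ v, J (J v) = -v)
    (hJi : ∀ v w, inner ℝ (J v) (J w) = inner ℝ v w)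
    (hK : D₁ ⊔ D₂ = K) (h1 : D₁.map J.toLinearMap = D₁) (h2 : ∀ v ∈ D₂, J v ∈ Kᗮ) (v : V) :
    K.starProjection (J (K.starProjection (J (v - K.starProjection v)))) = 0 := by
  have hsk : ∀ a b, inner ℝ (J a) b = -inner ℝ a (J b) := fun a b => by
    rw [← hJi a (J b), hJ, inner_neg_right, neg_neg]
  refine ext_inner_right ℝ fun z => ?_
  obtain ⟨u, hu, hue, -⟩ := exists_decomposition_of_semiInvariant hJ hK h1 h2
    (Submodule.starProjection_apply_mem K z)
  rw [Submodule.inner_starProjection_left_eq_right, hsk,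
    Submodule.inner_starProjection_left_eq_right, hsk, neg_neg, hue, inner_zero_left]
  exact Submodule.inner_left_of_mem_orthogonal (K := K)
    (K.neg_mem (hK ▸ Submodule.mem_sup_left hu)) (Submodule.sub_starProjection_mem_orthogonal v)

theorem trace_of_semiInvariant (hJ : ∀ v, J (J v) = -v)
    (hK : D₁ ⊔ D₂ = K) (h1 : D₁.map J.toLinearMap = D₁) (h2 : ∀ v ∈ D₂, J v ∈ Kᗮ) :
    LinearMap.trace ℝ V (K.starProjection ∘L J ∘L K.starProjection ∘L J ∘L
      K.starProjection).toLinearMap = -Module.finrank ℝ D₁ := by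
  have hDK : D₁ ≤ K := hK ▸ le_sup_left
  have h : LinearMap.IsProj D₁ (-(K.starProjection ∘L J ∘L K.starProjection ∘L J ∘L
      K.starProjection)).toLinearMap := by
    constructor
    · intro v
      obtain ⟨u, hu, hue, -⟩ := exists_decomposition_of_semiInvariant hJ hK h1 h2
        (Submodule.starProjection_apply_mem K v)
      show -(K.starProjection (J (K.starProjection (J (K.starProjection v))))) ∈ D₁
      rwa [hue, map_neg, neg_neg, Submodule.starProjection_eq_self_iff.2 (hDK hu)]
    · intro v hv
      obtain ⟨u, hu, hue, huv⟩ := exists_decomposition_of_semiInvariant hJ hK h1 h2 (hDK hv)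
      show -(K.starProjection (J (K.starProjection (J (K.starProjection v))))) = v
      rw [Submodule.starProjection_eq_self_iff.2 (hDK hv), hue, map_neg, neg_neg, huv hv,
        Submodule.starProjection_eq_self_iff.2 (hDK hv)]
  set Q := K.starProjection ∘L J ∘L K.starProjection ∘L J ∘L K.starProjection
  have h0 : Q.toLinearMap + (-Q).toLinearMap = 0 := by ext v; simp
  rw [eq_neg_iff_add_eq_zero, ← h.trace, ← map_add, h0, map_zero]

end SemiInvariantAlgebra

/-! ### Endomorphism fields vanishing along a map. -/

section AlongSemiInvariant

set_option linter.unusedSectionVars false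

variable {E : Type*} [NormedAddCommGroup E] [NormedSpace ℝ E]
  {M : Type*} [TopologicalSpace M] [ChartedSpace E M]
  {E' : Type*} [NormedAddCommGroup E'] [NormedSpace ℝ E'] [FiniteDimensional ℝ E']
  {N : Type*} [TopologicalSpace N] [T2Space N] [ChartedSpace E' N] [IsManifold 𝓘(ℝ, E') ∞ N]
  {F : M → N} {q : M} {o : N}

theorem mvfderiv_chart_comp {V : Type*} [NormedAddCommGroup V] [NormedSpace ℝ V] {G : E' → V}
    (hq : F q ∈ dom (E := E') o) (hF : MDifferentiableAt 𝓘(ℝ, E) 𝓘(ℝ, E') F q)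
    (hG : DifferentiableAt ℝ G (extChartAt 𝓘(ℝ, E') o (F q))) (v : TangentSpace 𝓘(ℝ, E) q) :
    mvfderiv 𝓘(ℝ, E) (fun p => G (extChartAt 𝓘(ℝ, E') o (F p))) q v
      = fderiv ℝ G (extChartAt 𝓘(ℝ, E') o (F q))
        (coordMap o (F q) (mfderiv 𝓘(ℝ, E) 𝓘(ℝ, E') F q v)) := by
  have h1 : MDifferentiableAt 𝓘(ℝ, E') 𝓘(ℝ, E') (extChartAt 𝓘(ℝ, E') o) (F q) :=
    (contMDiffAt_chart hq).mdifferentiableAt (by simp)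
  have h2 := hG.hasFDerivAt.hasMFDerivAt.comp q (h1.hasMFDerivAt.comp q hF.hasMFDerivAt)
  rw [coordMap_eq_mfderiv hq]
  exact congrArg (fun L => L v) h2.mfderiv

variable [RiemannianBundle (TangentSpace 𝓘(ℝ, E') : N → Type _)]
  [IsContMDiffRiemannianBundle 𝓘(ℝ, E') ∞ E' (TangentSpace 𝓘(ℝ, E') : N → Type _)]
  {T : ∀ y : N, TangentSpace 𝓘(ℝ, E') y →L[ℝ] TangentSpace 𝓘(ℝ, E') y}

/-- Vanishing along `F` controls only derivatives in directions of `range F_*`. Where this range is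
`R`, these are the directions required by `mvfderiv_eq_zero_of_semi`. -/
theorem nablaEnd_mfderiv_eq_zero (hT : SmoothEnd T) (hq : F q ∈ dom (E := E') o)
    (hF : MDifferentiableAt 𝓘(ℝ, E) 𝓘(ℝ, E') F q) (h : ∀ p, T (F p) = 0)
    (v : TangentSpace 𝓘(ℝ, E) q) :
    nablaEnd o T (F q) (mfderiv 𝓘(ℝ, E) 𝓘(ℝ, E') F q v) = 0 := by
  have hx := chart_mem_cod hq
  have h0 : ∀ p, F p ∈ dom (E := E') o → endHat o T (extChartAt 𝓘(ℝ, E') o (F p)) = 0 :=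
    fun p hp => (endHat_eq_zero_iff (chart_mem_cod hp)).2 (by rw [pt_chart hp]; exact h p)
  have h1 := mvfderiv_chart_comp hq hF ((hT o _ hx).differentiableAt (by simp)) v
  rw [mvfderiv_congr (g := fun _ => 0) (by
    filter_upwards [hF.continuousAt.eventually (dom_mem_nhds hq)] with p hp using h0 p hp),
    mvfderiv_const] at h1
  ext a
  rw [nablaEnd_apply, cov, ← h1, h0 q hq]
  simp

end AlongSemiInvariant

/-! ### The Clairaut function is locally constant and `R` is parallel. -/

section GradientVanishes

set_option linter.unusedSectionVars false

variable {E E' : Type*} [NormedAddCommGroup E] [NormedSpace ℝ E] [FiniteDimensional ℝ E]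
  [NormedAddCommGroup E'] [NormedSpace ℝ E'] [FiniteDimensional ℝ E']
  {M : Type*} [TopologicalSpace M] [Nonempty M]
  [ChartedSpace E M] [IsManifold 𝓘(ℝ, E) ∞ M]
  [RiemannianBundle (TangentSpace 𝓘(ℝ, E) : M → Type _)]
  {N : Type*} [TopologicalSpace N] [T2Space N]
  [ChartedSpace E' N] [IsManifold 𝓘(ℝ, E') ∞ N]
  [RiemannianBundle (TangentSpace 𝓘(ℝ, E') : N → Type _)]
  [IsContMDiffRiemannianBundle 𝓘(ℝ, E') ∞ E' (TangentSpace 𝓘(ℝ, E') : N → Type _)]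
  {P : ∀ y : N, TangentSpace 𝓘(ℝ, E') y →L[ℝ] TangentSpace 𝓘(ℝ, E') y}
  {F : M → N} {r : ℕ} {D₁ D₂ : ∀ q : M, Submodule ℝ (TangentSpace 𝓘(ℝ, E') (F q))} {d₁ d₂ : ℕ}
  {R : ∀ y : N, Submodule ℝ (TangentSpace 𝓘(ℝ, E') y)} {f : N → ℝ}

theorem IsSubbundleAlong.finrank_eq {D : ∀ q : M, Submodule ℝ (TangentSpace 𝓘(ℝ, E') (F q))}
    {d : ℕ} (hD : IsSubbundleAlong (E := E) F D d) (q : M) : Module.finrank ℝ (D q) = d := by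
  obtain ⟨U, hU, e, -, he⟩ := hD q
  obtain ⟨hli, hsp⟩ := he q (mem_of_mem_nhds hU)
  rw [← hsp, finrank_span_eq_card hli, Fintype.card_fin]

/-- A Clairaut foliation of a connected Kähler manifold that extends the range of a semi-invariant
Riemannian map has a locally constant Clairaut function. -/
theorem mvfderiv_eq_zero [ConnectedSpace N] (h : IsClairautFoliation R r f) (hP : IsKahler P)
    (hF : IsRiemannianMap (E := E) (E' := E') F r)
    (hD : IsSemiInvariant (E := E) F P D₁ D₂ d₁ d₂) (hd₁ : 0 < d₁) (hd₂ : 1 < d₂)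
    (hRF : ∀ q : M, R (F q) = rangeD (E := E) F q) (y : N) : mvfderiv 𝓘(ℝ, E') f y = 0 := by
  have hπ := smoothEnd_proj h.subbundle
  have hK : ∀ q, D₁ q ⊔ D₂ q = R (F q) := fun q => (hD.sup_eq q).trans (hRF q).symm
  have hD₂ : ∀ q, ∀ v ∈ D₂ q, P (F q) v ∈ (R (F q))ᗮ := fun q => by
    rw [hRF q]; exact hD.antiInvariant q
  have hS : ∀ q, semi R P (F q) = 0 := fun q => ContinuousLinearMap.ext fun v =>
    obstruction_eq_zero_of_semiInvariant (hP.sq_eq _) (hP.inner_eq _) (hK q) (hD.invariant q)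
      (hD₂ q) v
  obtain ⟨q⟩ := ‹Nonempty M›
  have htr : LinearMap.trace ℝ (TangentSpace 𝓘(ℝ, E') (F q)) (phiSq R P (F q)).toLinearMap
      = -d₁ := by
    rw [← hD.subbundle₁.finrank_eq q]
    exact trace_of_semiInvariant (hP.sq_eq _) (hK q) (hD.invariant q) (hD₂ q)
  have hr : d₁ + d₂ = r := by
    rw [← hF.rank_eq q, ← hRF q, finrank_of_semiInvariant (hP.inner_eq _) (hK q) (hD.invariant q)
      (hD₂ q), hD.subbundle₁.finrank_eq q, hD.subbundle₂.finrank_eq q]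
  have hqd := self_mem_dom (E := E') (F q)
  have h0 : mvfderiv 𝓘(ℝ, E') f (F q) = 0 := by
    refine mvfderiv_eq_zero_of_semi h hP hqd (hS q) (fun u hu => ?_) htr hd₁ (by omega)
    have hu' : u ∈ rangeD (E := E) F q := by rw [← hRF q, ← hu]; exact proj_mem _ _
    obtain ⟨v, rfl⟩ := hu'
    exact nablaEnd_mfderiv_eq_zero (smoothEnd_semi hπ hP.smoothEnd) hqd
      (hF.smooth.mdifferentiable (by simp) q) hS v
  have hc := (isClopen_critical h hP hd₁ (by omega : d₁ + 1 < r)).eq_univ ⟨F q, h0, hS q, htr⟩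
  exact (hc.ge (mem_univ y)).1

theorem nablaEnd_proj_eq_zero (h : IsClairautFoliation R r f)
    (hf : ∀ y, mvfderiv 𝓘(ℝ, E') f y = 0) {o y : N} (hy : y ∈ dom (E := E') o)
    (v : TangentSpace 𝓘(ℝ, E') y) : nablaEnd o (proj R) y v = 0 := by
  have h1 := (nablaEnd_proj h hy (ξ := 0) fun v => by rw [hf y, inner_zero_left]; rfl).2 v
  ext a
  rw [h1 a, hf y]
  simp

/-- A section satisfies `Y = πY`, so `∇π = 0` gives `∇_X Y = π ∇_X Y`. -/
theorem isLocallyProduct (hinv : IsInvolutive R) (h : IsClairautFoliation R r f)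
    (hf : ∀ y, mvfderiv 𝓘(ℝ, E') f y = 0) : IsLocallyProduct R := by
  refine ⟨⟨hinv, fun X Y _ hY y => ?_⟩, h.orthogonal⟩
  have hY' : Y = fun p => proj R p (Y p) := funext fun p => (proj_eq_self (hY.2 p)).symm
  have hd : DiffField Y y := (hY.1 y).mdifferentiableAt (by simp)
  have h1 := nabla_end (smoothEnd_proj h.subbundle) (self_mem_dom y) hd (X y)
  rw [← hY', nablaEnd_proj_eq_zero h hf (self_mem_dom y), zero_apply, zero_add] at h1
  rw [h1]
  exact proj_mem _ _

end GradientVanishes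

/-! ### Maps and fields along them in coordinates; product rules for the pullback connection. -/

section AlongCoordinates

set_option linter.unusedSectionVars false

variable {E E' : Type*} [NormedAddCommGroup E] [NormedSpace ℝ E] [FiniteDimensional ℝ E]
  [NormedAddCommGroup E'] [NormedSpace ℝ E'] [FiniteDimensional ℝ E']
  {M : Type*} [TopologicalSpace M] [T2Space M] [ChartedSpace E M] [IsManifold 𝓘(ℝ, E) ∞ M]
  [RiemannianBundle (TangentSpace 𝓘(ℝ, E) : M → Type _)]
  [IsContMDiffRiemannianBundle 𝓘(ℝ, E) ∞ E (TangentSpace 𝓘(ℝ, E) : M → Type _)]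
  {N : Type*} [TopologicalSpace N] [T2Space N] [ChartedSpace E' N] [IsManifold 𝓘(ℝ, E') ∞ N]
  [RiemannianBundle (TangentSpace 𝓘(ℝ, E') : N → Type _)]
  [IsContMDiffRiemannianBundle 𝓘(ℝ, E') ∞ E' (TangentSpace 𝓘(ℝ, E') : N → Type _)]
  {F : M → N} {W V : ∀ q, TangentSpace 𝓘(ℝ, E') (F q)} {o : M} {o' : N} {x : E}

/-- The coordinate expression of a map. -/
def mapHat (o : M) (o' : N) (F : M → N) (x : E) : E' := extChartAt 𝓘(ℝ, E') o' (F (pt o x))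

/-- The coordinate expression of a field along a map. -/
def alongHat (o : M) (o' : N) (F : M → N) (W : ∀ q, TangentSpace 𝓘(ℝ, E') (F q)) (x : E) : E' :=
  coordMap o' (F (pt o x)) (W (pt o x))

theorem pt_mapHat (hx' : F (pt o x) ∈ dom (E := E') o') : pt (E := E') o' (mapHat (E := E) o o' F x) = F (pt o x) :=
  pt_chart hx'

theorem mapHat_mem_cod (hx' : F (pt o x) ∈ dom (E := E') o') : mapHat (E := E) o o' F x ∈ cod (E := E') o' :=
  chart_mem_cod hx'

theorem eventually_mem_dom (hF : ContMDiff 𝓘(ℝ, E) 𝓘(ℝ, E') ∞ F) (hx : x ∈ cod (E := E) o)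
    (hx' : F (pt o x) ∈ dom (E := E') o') :
    ∀ᶠ z in 𝓝 x, z ∈ cod o ∧ F (pt o z) ∈ dom (E := E') o' :=
  Filter.Eventually.and (cod_mem_nhds hx)
    ((hF.continuous.continuousAt.comp (f := pt (E := E) o)
      (contMDiffAt_chart_symm hx).continuousAt).eventually (dom_mem_nhds hx'))

theorem contDiffAt_mapHat (hF : ContMDiff 𝓘(ℝ, E) 𝓘(ℝ, E') ∞ F) (hx : x ∈ cod (E := E) o)
    (hx' : F (pt o x) ∈ dom (E := E') o') : ContDiffAt ℝ ∞ (mapHat (E' := E') o o' F) x :=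
  contDiffAt_chart_symm (f := fun p => extChartAt 𝓘(ℝ, E') o' (F p)) hx
    (ContMDiffAt.comp (I' := 𝓘(ℝ, E')) _ (contMDiffAt_chart hx') (hF _))

theorem coordMap_mfderiv (hF : ContMDiff 𝓘(ℝ, E) 𝓘(ℝ, E') ∞ F) (hx : x ∈ cod (E := E) o)
    (hx' : F (pt o x) ∈ dom (E := E') o') (a : E) :
    coordMap o' (F (pt o x)) (mfderiv 𝓘(ℝ, E) 𝓘(ℝ, E') F (pt o x) (coordVec o (pt o x) a))
      = fderiv ℝ (mapHat (E' := E') o o' F) x a := by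
  have hFd : MDifferentiableAt 𝓘(ℝ, E) 𝓘(ℝ, E') F (pt o x) :=
    hF.mdifferentiable (by simp) _
  have h1 : MDifferentiableAt 𝓘(ℝ, E) 𝓘(ℝ, E') (fun p => extChartAt 𝓘(ℝ, E') o' (F p)) (pt o x) :=
    MDifferentiableAt.comp (I' := 𝓘(ℝ, E')) _ ((contMDiffAt_chart hx').mdifferentiableAt (by simp))
      hFd
  have h2 := mvfderiv_coordVec (pt_mem_dom hx) h1 a
  rw [chart_pt hx] at h2
  refine Eq.trans ?_ h2
  have h3 := mvfderiv_chart_comp (G := fun z => z) hx' hFd differentiableAt_id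
    (coordVec o (pt o x) a)
  rw [h3, fderiv_fun_id]
  rfl

theorem alongHat_push (hF : ContMDiff 𝓘(ℝ, E) 𝓘(ℝ, E') ∞ F) (hx : x ∈ cod (E := E) o)
    (hx' : F (pt o x) ∈ dom (E := E') o') (X : ∀ q : M, TangentSpace 𝓘(ℝ, E) q) :
    alongHat o o' F (push F X) x = fderiv ℝ (mapHat (E' := E') o o' F) x (fieldHat o X x) := by
  rw [← coordMap_mfderiv hF hx hx', fieldHat, coordVec_coordMap (pt_mem_dom hx)]
  rfl

theorem diffAlong_iff_alongHat (hF : ContMDiff 𝓘(ℝ, E) 𝓘(ℝ, E') ∞ F) (hx : x ∈ cod (E := E) o)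
    (hx' : F (pt o x) ∈ dom (E := E') o') :
    DiffAlong (E := E) F W (pt o x) ↔ DifferentiableAt ℝ (alongHat o o' F W) x := by
  rw [diffAlong_iff hx' (hF.mdifferentiable (by simp) _)]
  constructor
  · intro h
    exact (MDifferentiableAt.comp (I' := 𝓘(ℝ, E)) x
      (g := fun p => coordMap o' (F p) (W p)) (f := (extChartAt 𝓘(ℝ, E) o).symm) h
      ((contMDiffAt_chart_symm hx).mdifferentiableAt (by simp))).differentiableAt
  · intro h
    have hy := pt_mem_dom hx
    have h1 : MDifferentiableAt 𝓘(ℝ, E) 𝓘(ℝ, E')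
        (fun p => alongHat o o' F W (extChartAt 𝓘(ℝ, E) o p)) (pt o x) :=
      MDifferentiableAt.comp (I' := 𝓘(ℝ, E)) (pt o x) (g := alongHat o o' F W)
        (by rw [chart_pt hx]; exact h.mdifferentiableAt)
        ((contMDiffAt_chart hy).mdifferentiableAt (by simp))
    refine h1.congr_of_eventuallyEq ?_
    filter_upwards [dom_mem_nhds hy] with p hp
    rw [alongHat, pt_chart hp]

theorem diffField_iff_fieldHat {X : ∀ q : M, TangentSpace 𝓘(ℝ, E) q} (hx : x ∈ cod o) :
    DiffField X (pt o x) ↔ DifferentiableAt ℝ (fieldHat o X) x :=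
  diffAlong_iff_alongHat (F := fun p => p) contMDiff_id hx (pt_mem_dom hx)

theorem diffAlong_push (hF : ContMDiff 𝓘(ℝ, E) 𝓘(ℝ, E') ∞ F) {q : M}
    {X : ∀ q : M, TangentSpace 𝓘(ℝ, E) q} (hX : DiffField X q) :
    DiffAlong (E := E) F (push (E' := E') F X) q := by
  obtain ⟨o, hq⟩ : ∃ o : M, q ∈ dom (E := E) o := ⟨q, self_mem_dom q⟩
  obtain ⟨x, hx, rfl⟩ := exists_pt_eq hq
  obtain ⟨o', hx'⟩ : ∃ o' : N, F (pt o x) ∈ dom (E := E') o' := ⟨_, self_mem_dom _⟩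
  rw [diffAlong_iff_alongHat hF hx hx']
  have h1 := (contDiffAt_fderiv_of_top (contDiffAt_mapHat hF hx hx')).differentiableAt (by simp)
  refine (h1.clm_apply (differentiableAt_fieldHat hx hX)).congr_of_eventuallyEq ?_
  filter_upwards [eventually_mem_dom hF hx hx'] with z hz using alongHat_push hF hz.1 hz.2 X

variable {T : ∀ y : N, TangentSpace 𝓘(ℝ, E') y →L[ℝ] TangentSpace 𝓘(ℝ, E') y}

/-- The pullback of the Levi-Civita connection in coordinates. -/
theorem coordMap_nablaAlong (hF : ContMDiff 𝓘(ℝ, E) 𝓘(ℝ, E') ∞ F) (hx : x ∈ cod (E := E) o)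
    (hx' : F (pt o x) ∈ dom (E := E') o') (hW : DiffAlong (E := E) F W (pt o x)) (u : E) :
    coordMap o' (F (pt o x)) (nablaAlong F W (pt o x) (coordVec o (pt o x) u))
      = fderiv ℝ (alongHat o o' F W) x u + christoffel (metric o') (mapHat o o' F x)
        (fderiv ℝ (mapHat (E' := E') o o' F) x u) (alongHat o o' F W x) := by
  have hFd : MDifferentiableAt 𝓘(ℝ, E) 𝓘(ℝ, E') F (pt o x) :=
    hF.mdifferentiable (by simp) _
  rw [nablaAlong_eq_coord hx' hW, map_add, coordMap_coordVec hx',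
    mvfderiv_coordVec (pt_mem_dom hx) ((diffAlong_iff hx' hFd).1 hW), chart_pt hx]
  congr 1
  have h1 := nablaCoord_coordVec (mapHat_mem_cod hx') (fderiv ℝ (mapHat (E' := E') o o' F) x u)
    (alongHat o o' F W x)
  rw [pt_mapHat hx', ← coordMap_mfderiv hF hx hx', coordVec_coordMap hx'] at h1
  rw [← coordMap_mfderiv hF hx hx']
  refine (congrArg _ h1).trans (coordMap_coordVec hx' _)

theorem nablaAlong_ext (hx' : F (pt o x) ∈ dom (E := E') o')
    {a b : TangentSpace 𝓘(ℝ, E') (F (pt o x))}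
    (h : coordMap o' (F (pt o x)) a = coordMap o' (F (pt o x)) b) : a = b := by
  rw [← coordVec_coordMap hx' a, h, coordVec_coordMap hx']

theorem inner_eq_metric (hx' : F (pt o x) ∈ dom (E := E') o')
    (a b : TangentSpace 𝓘(ℝ, E') (F (pt o x))) :
    inner ℝ a b = metric o' (mapHat o o' F x) (coordMap o' (F (pt o x)) a)
      (coordMap o' (F (pt o x)) b) := by
  rw [metric_apply, pt_mapHat hx', coordVec_coordMap hx', coordVec_coordMap hx']

theorem mdifferentiableAt_of_comp_pt {V : Type*} [NormedAddCommGroup V] [NormedSpace ℝ V]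
    {g : M → V} (hx : x ∈ cod o) (h : DifferentiableAt ℝ (fun z => g (pt o z)) x) :
    MDifferentiableAt 𝓘(ℝ, E) 𝓘(ℝ, V) g (pt o x) := by
  have hy := pt_mem_dom hx
  have h1 : MDifferentiableAt 𝓘(ℝ, E) 𝓘(ℝ, V)
      (fun p => g (pt o (extChartAt 𝓘(ℝ, E) o p))) (pt o x) :=
    MDifferentiableAt.comp (I' := 𝓘(ℝ, E)) (pt o x) (g := fun z => g (pt o z))
      (by rw [chart_pt hx]; exact h.mdifferentiableAt)
      ((contMDiffAt_chart hy).mdifferentiableAt (by simp))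
  refine h1.congr_of_eventuallyEq ?_
  filter_upwards [dom_mem_nhds hy] with p hp
  rw [pt_chart hp]

/-- The pullback connection is metric. -/
theorem mvfderiv_inner_along (hF : ContMDiff 𝓘(ℝ, E) 𝓘(ℝ, E') ∞ F) {q : M}
    (hW : DiffAlong (E := E) F W q) (hV : DiffAlong (E := E) F V q) (v : TangentSpace 𝓘(ℝ, E) q) :
    mvfderiv 𝓘(ℝ, E) (fun p => inner ℝ (W p) (V p)) q v
      = inner ℝ (nablaAlong F W q v) (V q) + inner ℝ (W q) (nablaAlong F V q v) := by
  obtain ⟨o, hq⟩ : ∃ o : M, q ∈ dom (E := E) o := ⟨q, self_mem_dom q⟩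
  obtain ⟨x, hx, rfl⟩ := exists_pt_eq hq
  obtain ⟨o', hx'⟩ : ∃ o' : N, F (pt o x) ∈ dom (E := E') o' := ⟨_, self_mem_dom _⟩
  have hFd := (contDiffAt_mapHat hF hx hx').differentiableAt (by simp)
  have hm := ((differentiableAt_metric (mapHat_mem_cod hx')).hasFDerivAt.comp x hFd.hasFDerivAt)
  have h1 := (hm.clm_apply ((diffAlong_iff_alongHat hF hx hx').1 hW).hasFDerivAt).clm_apply
    ((diffAlong_iff_alongHat hF hx hx').1 hV).hasFDerivAt
  have h2 : (fun z => inner ℝ (W (pt o z)) (V (pt o z))) =ᶠ[𝓝 x] fun z =>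
      metric o' (mapHat o o' F z) (alongHat o o' F W z) (alongHat o o' F V z) := by
    filter_upwards [eventually_mem_dom hF hx hx'] with z hz using inner_eq_metric hz.2 _ _
  have h3 := h1.congr_of_eventuallyEq h2
  have h4 : MDifferentiableAt 𝓘(ℝ, E) 𝓘(ℝ, ℝ) (fun p => inner ℝ (W p) (V p)) (pt o x) :=
    mdifferentiableAt_of_comp_pt hx h3.differentiableAt
  obtain ⟨u, rfl⟩ : ∃ u, coordVec o (pt o x) u = v := ⟨_, coordVec_coordMap hq v⟩
  have h5 := mvfderiv_coordVec hq h4 u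
  rw [chart_pt hx] at h5
  refine h5.trans ((congrArg (fun L => L u) h3.fderiv).trans ?_)
  rw [inner_eq_metric hx', inner_eq_metric hx', coordMap_nablaAlong hF hx hx' hW,
    coordMap_nablaAlong hF hx hx' hV]
  have h6 := fderiv_metric (differentiableAt_metric (mapHat_mem_cod hx')) (metric_comm o')
    (metric_isInvertible (mapHat_mem_cod hx')) (fderiv ℝ (mapHat (E' := E') o o' F) x u)
    (alongHat o o' F W x) (alongHat o o' F V x)
  simp only [map_add, add_apply]
  simp
  rw [h6]
  simp only [alongHat]
  ring

theorem nablaAlong_end (hT : SmoothEnd T) (hF : ContMDiff 𝓘(ℝ, E) 𝓘(ℝ, E') ∞ F) {q : M}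
    (hq' : F q ∈ dom (E := E') o')
    (hW : DiffAlong (E := E) F W q) (v : TangentSpace 𝓘(ℝ, E) q) :
    DiffAlong (E := E) F (fun p => T (F p) (W p)) q ∧
    nablaAlong F (fun p => T (F p) (W p)) q v
      = nablaEnd o' T (F q) (mfderiv 𝓘(ℝ, E) 𝓘(ℝ, E') F q v) (W q)
        + T (F q) (nablaAlong F W q v) := by
  obtain ⟨o, hq⟩ : ∃ o : M, q ∈ dom (E := E) o := ⟨q, self_mem_dom q⟩
  obtain ⟨x, hx, rfl⟩ := exists_pt_eq hq
  have hFd := (contDiffAt_mapHat hF hx hq').differentiableAt (by simp)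
  have hTd := ((hT o' _ (mapHat_mem_cod hq')).differentiableAt (by simp)).hasFDerivAt.comp x
    hFd.hasFDerivAt
  have h1 := hTd.clm_apply ((diffAlong_iff_alongHat hF hx hq').1 hW).hasFDerivAt
  have hpt : ∀ z : E, F (pt o z) ∈ dom (E := E') o' → ∀ a : TangentSpace 𝓘(ℝ, E') (F (pt o z)),
      coordMap o' (F (pt o z)) (T (F (pt o z)) a)
        = endHat o' T (mapHat o o' F z) (coordMap o' (F (pt o z)) a) := fun z hz a => by
    rw [endHat_apply, pt_mapHat hz, coordVec_coordMap hz]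
  have h2 : alongHat o o' F (fun p => T (F p) (W p)) =ᶠ[𝓝 x] fun z =>
      endHat o' T (mapHat o o' F z) (alongHat o o' F W z) := by
    filter_upwards [eventually_mem_dom hF hx hq'] with z hz using hpt z hz.2 _
  have h3 := h1.congr_of_eventuallyEq h2
  have hd := (diffAlong_iff_alongHat hF hx hq').2 h3.differentiableAt
  refine ⟨hd, nablaAlong_ext hq' ?_⟩
  obtain ⟨u, rfl⟩ : ∃ u, coordVec o (pt o x) u = v := ⟨_, coordVec_coordMap hq v⟩
  rw [coordMap_nablaAlong hF hx hq' hd, map_add, hpt x hq', coordMap_nablaAlong hF hx hq' hW,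
    nablaEnd_apply, coordMap_coordVec hq', coordMap_mfderiv hF hx hq', h3.fderiv, h2.self_of_nhds]
  simp only [cov, map_add]
  simp [mapHat, alongHat]
  abel

end AlongCoordinates

/-! ### The second fundamental form of a Riemannian map. -/

section SecondFundamentalForm

set_option linter.unusedSectionVars false

variable {E E' : Type*} [NormedAddCommGroup E] [NormedSpace ℝ E] [FiniteDimensional ℝ E]
  [NormedAddCommGroup E'] [NormedSpace ℝ E'] [FiniteDimensional ℝ E']
  {M : Type*} [TopologicalSpace M] [T2Space M] [ChartedSpace E M] [IsManifold 𝓘(ℝ, E) ∞ M]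
  [RiemannianBundle (TangentSpace 𝓘(ℝ, E) : M → Type _)]
  [IsContMDiffRiemannianBundle 𝓘(ℝ, E) ∞ E (TangentSpace 𝓘(ℝ, E) : M → Type _)]
  {N : Type*} [TopologicalSpace N] [T2Space N] [ChartedSpace E' N] [IsManifold 𝓘(ℝ, E') ∞ N]
  [RiemannianBundle (TangentSpace 𝓘(ℝ, E') : N → Type _)]
  [IsContMDiffRiemannianBundle 𝓘(ℝ, E') ∞ E' (TangentSpace 𝓘(ℝ, E') : N → Type _)]
  {F : M → N} {W : ∀ q, TangentSpace 𝓘(ℝ, E') (F q)} {o q : M} {o' : N} {x : E}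
  {X Y Z : ∀ q : M, TangentSpace 𝓘(ℝ, E) q}

/-- The second fundamental form of a map in coordinates. -/
theorem coordMap_nablaAlong_push (hF : ContMDiff 𝓘(ℝ, E) 𝓘(ℝ, E') ∞ F) (hx : x ∈ cod (E := E) o)
    (hx' : F (pt o x) ∈ dom (E := E') o') (hY : DiffField Y (pt o x)) (u : E) :
    coordMap o' (F (pt o x)) (nablaAlong F (push F Y) (pt o x) (coordVec o (pt o x) u)
      - mfderiv 𝓘(ℝ, E) 𝓘(ℝ, E') F (pt o x) (nabla Y (pt o x) (coordVec o (pt o x) u)))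
      = fderiv ℝ (fderiv ℝ (mapHat o o' F)) x u (fieldHat o Y x)
        + christoffel (metric o') (mapHat o o' F x) (fderiv ℝ (mapHat o o' F) x u)
          (fderiv ℝ (mapHat o o' F) x (fieldHat o Y x))
        - fderiv ℝ (mapHat o o' F) x (christoffel (metric o) x u (fieldHat o Y x)) := by
  have h1 := ((contDiffAt_fderiv_of_top (contDiffAt_mapHat hF hx hx')).differentiableAt
    (by simp)).hasFDerivAt.clm_apply (differentiableAt_fieldHat hx hY).hasFDerivAt
  have h2 : alongHat o o' F (push F Y) =ᶠ[𝓝 x] fun z =>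
      fderiv ℝ (mapHat (E' := E') o o' F) z (fieldHat o Y z) := by
    filter_upwards [eventually_mem_dom hF hx hx'] with z hz using alongHat_push hF hz.1 hz.2 Y
  have h3 := (h1.congr_of_eventuallyEq h2).fderiv
  rw [map_sub, coordMap_nablaAlong hF hx hx' (diffAlong_push hF hY), h3, h2.self_of_nhds,
    ← coordVec_coordMap (pt_mem_dom hx) (nabla Y _ _), coordMap_mfderiv hF hx hx',
    coordMap_nabla hx hY]
  simp
  abel

/-- The second fundamental form of a map is symmetric. -/
theorem nablaAlong_push_symm (hF : ContMDiff 𝓘(ℝ, E) 𝓘(ℝ, E') ∞ F) (hX : DiffField X q)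
    (hY : DiffField Y q) :
    nablaAlong F (push F Y) q (X q) - mfderiv 𝓘(ℝ, E) 𝓘(ℝ, E') F q (nabla Y q (X q))
      = nablaAlong F (push F X) q (Y q) - mfderiv 𝓘(ℝ, E) 𝓘(ℝ, E') F q (nabla X q (Y q)) := by
  obtain ⟨o, hq⟩ : ∃ o : M, q ∈ dom (E := E) o := ⟨q, self_mem_dom q⟩
  obtain ⟨x, hx, rfl⟩ := exists_pt_eq hq
  obtain ⟨o', hx'⟩ : ∃ o' : N, F (pt o x) ∈ dom (E := E') o' := ⟨_, self_mem_dom _⟩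
  refine nablaAlong_ext hx' ?_
  have hXe : X (pt o x) = coordVec o (pt o x) (fieldHat o X x) := (coordVec_coordMap hq _).symm
  have hYe : Y (pt o x) = coordVec o (pt o x) (fieldHat o Y x) := (coordVec_coordMap hq _).symm
  have hsym : IsSymmSndFDerivAt ℝ (mapHat o o' F) x :=
    (contDiffAt_mapHat hF hx hx').isSymmSndFDerivAt (by
      simp only [minSmoothness_of_isRCLikeNormedField]
      exact WithTop.coe_le_coe.2 (le_top : (2 : ℕ∞) ≤ ⊤))
  rw [hXe, hYe, coordMap_nablaAlong_push hF hx hx' hX, coordMap_nablaAlong_push hF hx hx' hY,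
    hsym.eq, christoffel_comm (differentiableAt_metric hx) (metric_comm o),
    christoffel_comm (differentiableAt_metric (mapHat_mem_cod hx')) (metric_comm o')]

theorem inner_adjointD (u : TangentSpace 𝓘(ℝ, E') (F q)) (v : TangentSpace 𝓘(ℝ, E) q) :
    inner ℝ (adjointD (E := E) F q u) v = inner ℝ u (mfderiv 𝓘(ℝ, E) 𝓘(ℝ, E') F q v) :=
  LinearMap.adjoint_inner_left _ _ _

theorem adjointD_mem (u : TangentSpace 𝓘(ℝ, E') (F q)) :
    adjointD (E := E) F q u ∈ (kerD (E := E) (E' := E') F q)ᗮ := by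
  refine (Submodule.mem_orthogonal' _ _).2 fun v hv => ?_
  have hv' : mfderiv 𝓘(ℝ, E) 𝓘(ℝ, E') F q v = 0 := hv
  rw [inner_adjointD, hv', inner_zero_right]

/-- In coordinates the adjoint is `g⁻¹ ∘ (DF)ᵀ ∘ g'`, a composition of differentiable families. -/
theorem diffField_adjointD (hF : ContMDiff 𝓘(ℝ, E) 𝓘(ℝ, E') ∞ F)
    (hW : DiffAlong (E := E) F W q) : DiffField (fun p => adjointD (E := E) F p (W p)) q := by
  obtain ⟨o, hq⟩ : ∃ o : M, q ∈ dom (E := E) o := ⟨q, self_mem_dom q⟩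
  obtain ⟨x, hx, rfl⟩ := exists_pt_eq hq
  obtain ⟨o', hx'⟩ : ∃ o' : N, F (pt o x) ∈ dom (E := E') o' := ⟨_, self_mem_dom _⟩
  rw [diffField_iff_fieldHat hx]
  have hh := contDiffAt_mapHat hF hx hx'
  have h1 : DifferentiableAt ℝ (fun z => metric o' (mapHat o o' F z) (alongHat o o' F W z)) x :=
    ((differentiableAt_metric (mapHat_mem_cod hx')).comp x (hh.differentiableAt (by simp))).clm_apply
      ((diffAlong_iff_alongHat hF hx hx').1 hW)
  have h2 := h1.clm_comp ((contDiffAt_fderiv_of_top hh).differentiableAt (by simp))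
  have h3 := ((contDiffAt_inverse (contDiffAt_metric hx) (metric_isInvertible hx)).differentiableAt
    (by simp)).clm_apply h2
  refine h3.congr_of_eventuallyEq ?_
  filter_upwards [eventually_mem_dom hF hx hx'] with z hz
  have h4 : metric o z (fieldHat o (fun p => adjointD (E := E) F p (W p)) z)
      = metric o' (mapHat o o' F z) (alongHat o o' F W z) ∘L fderiv ℝ (mapHat o o' F) z := by
    ext c
    rw [metric_apply, fieldHat, coordVec_coordMap (pt_mem_dom hz.1), inner_adjointD,
      inner_eq_metric hz.2, coordMap_mfderiv hF hz.1 hz.2]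
    rfl
  rw [← h4, inverse_apply_self (metric_isInvertible hz.1)]

variable {r : ℕ}

/-- Only one vector has to be horizontal: the kernel component of the other contributes to neither
side. -/
theorem inner_mfderiv (hF : IsRiemannianMap (E := E) (E' := E') F r)
    (v : TangentSpace 𝓘(ℝ, E) q) {w : TangentSpace 𝓘(ℝ, E) q}
    (hw : w ∈ (kerD (E := E) (E' := E') F q)ᗮ) :
    inner ℝ (mfderiv 𝓘(ℝ, E) 𝓘(ℝ, E') F q v) (mfderiv 𝓘(ℝ, E) 𝓘(ℝ, E') F q w) = inner ℝ v w := by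
  set K := kerD (E := E) (E' := E') F q
  have h1 : mfderiv 𝓘(ℝ, E) 𝓘(ℝ, E') F q (K.starProjection v) = 0 :=
    Submodule.starProjection_apply_mem K v
  have h2 := hF.isometry q _ (Submodule.sub_starProjection_mem_orthogonal (K := K) v) w hw
  rw [map_sub, h1, sub_zero, inner_sub_left, Submodule.inner_right_of_mem_orthogonal
    (Submodule.starProjection_apply_mem K v) hw, sub_zero] at h2
  exact h2

theorem mfderiv_adjointD (hF : IsRiemannianMap (E := E) (E' := E') F r)
    {u : TangentSpace 𝓘(ℝ, E') (F q)} (hu : u ∈ rangeD (E := E) F q) :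
    mfderiv 𝓘(ℝ, E) 𝓘(ℝ, E') F q (adjointD (E := E) F q u) = u := by
  have h1 : ∀ w ∈ rangeD (E := E) F q,
      inner ℝ (mfderiv 𝓘(ℝ, E) 𝓘(ℝ, E') F q (adjointD (E := E) F q u) - u) w = 0 := by
    rintro _ ⟨v, rfl⟩
    have h2 : inner ℝ (mfderiv 𝓘(ℝ, E) 𝓘(ℝ, E') F q (adjointD (E := E) F q u))
        (mfderiv 𝓘(ℝ, E) 𝓘(ℝ, E') F q v) = inner ℝ u (mfderiv 𝓘(ℝ, E) 𝓘(ℝ, E') F q v) := by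
      rw [real_inner_comm, inner_mfderiv hF v (adjointD_mem u), real_inner_comm, inner_adjointD]
    rw [inner_sub_left]
    exact sub_eq_zero.2 h2
  exact sub_eq_zero.1 (inner_self_eq_zero (𝕜 := ℝ).1 (h1 _ (Submodule.sub_mem _ ⟨_, rfl⟩ hu)))

/-- A Riemannian map preserves the connection, up to normal terms. -/
theorem inner_mfderiv_nabla (hF : IsRiemannianMap (E := E) (E' := E') F r)
    (hX : DiffField X q) (hY : DiffField Y q) (hZ : DiffField Z q)
    (hXh : ∀ p, X p ∈ (kerD (E := E) (E' := E') F p)ᗮ)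
    (hYh : ∀ p, Y p ∈ (kerD (E := E) (E' := E') F p)ᗮ)
    (hZh : ∀ p, Z p ∈ (kerD (E := E) (E' := E') F p)ᗮ) :
    inner ℝ (mfderiv 𝓘(ℝ, E) 𝓘(ℝ, E') F q (nabla Y q (X q))) (push F Z q)
      = inner ℝ (nablaAlong F (push F Y) q (X q)) (push (E' := E') F Z q) := by
  -- `b` pairs the second fundamental form with `F_*Z`. On horizontal fields it is symmetric in the
  -- first two arguments, and skew in the last two because both connections are metric and `F_*` is
  -- isometric.
  let b : ∀ _ _ _ : (∀ q : M, TangentSpace 𝓘(ℝ, E) q), ℝ := fun X Y Z =>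
    inner ℝ (nablaAlong F (push (E' := E') F Y) q (X q)
      - mfderiv 𝓘(ℝ, E) 𝓘(ℝ, E') F q (nabla Y q (X q))) (push F Z q)
  have hskew : ∀ X Y Z : ∀ q : M, TangentSpace 𝓘(ℝ, E) q, DiffField Y q → DiffField Z q →
      (∀ p, Y p ∈ (kerD (E := E) (E' := E') F p)ᗮ) →
      (∀ p, Z p ∈ (kerD (E := E) (E' := E') F p)ᗮ) → b X Y Z = -b X Z Y := by
    intro X Y Z hY hZ hYh hZh
    have h1 := mvfderiv_inner_along hF.smooth (diffAlong_push hF.smooth hY)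
      (diffAlong_push hF.smooth hZ) (X q)
    have h2 := mvfderiv_inner hY hZ (X q)
    have h3 : (fun p => inner ℝ (push (E' := E') F Y p) (push (E' := E') F Z p))
        = fun p => inner ℝ (Y p) (Z p) := funext fun p => inner_mfderiv hF _ (hZh p)
    rw [h3, h2] at h1
    have h4 : inner ℝ (mfderiv 𝓘(ℝ, E) 𝓘(ℝ, E') F q (nabla Y q (X q))) (push F Z q)
        = inner ℝ (nabla Y q (X q)) (Z q) := inner_mfderiv hF _ (hZh q)
    have h5 : inner ℝ (mfderiv 𝓘(ℝ, E) 𝓘(ℝ, E') F q (nabla Z q (X q))) (push F Y q)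
        = inner ℝ (nabla Z q (X q)) (Y q) := inner_mfderiv hF _ (hYh q)
    simp only [b]
    rw [inner_sub_left, inner_sub_left, h4, h5, real_inner_comm _ (nabla Z q (X q)),
      real_inner_comm _ (nablaAlong F (push F Z) q (X q))]
    linarith
  have hsymm : ∀ X Y Z : ∀ q : M, TangentSpace 𝓘(ℝ, E) q, DiffField X q → DiffField Y q →
      b X Y Z = b Y X Z := fun X Y Z hX hY =>
    congrArg (fun v => inner ℝ v (push F Z q)) (nablaAlong_push_symm hF.smooth hX hY)
  -- A trilinear form symmetric in one pair and skew in an overlapping pair vanishes: six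
  -- alternating swaps give `b = -b`.
  have h0 : b X Y Z = 0 := by
    linarith [hskew X Y Z hY hZ hYh hZh, hsymm X Z Y hX hZ, hskew Z X Y hX hY hXh hYh,
      hsymm Z Y X hZ hY, hskew Y Z X hZ hX hZh hXh, hsymm Y X Z hY hX]
  simp only [b] at h0
  rw [inner_sub_left, sub_eq_zero] at h0
  exact h0.symm

end SecondFundamentalForm

/-! ### The displayed expression for parallel `R`. -/

section InvariantDirections

set_option linter.unusedSectionVars false

variable {E E' : Type*} [NormedAddCommGroup E] [NormedSpace ℝ E] [FiniteDimensional ℝ E]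
  [NormedAddCommGroup E'] [NormedSpace ℝ E'] [FiniteDimensional ℝ E']
  {M : Type*} [TopologicalSpace M] [T2Space M] [ChartedSpace E M] [IsManifold 𝓘(ℝ, E) ∞ M]
  [RiemannianBundle (TangentSpace 𝓘(ℝ, E) : M → Type _)]
  [IsContMDiffRiemannianBundle 𝓘(ℝ, E) ∞ E (TangentSpace 𝓘(ℝ, E) : M → Type _)]
  {N : Type*} [TopologicalSpace N] [T2Space N] [ChartedSpace E' N] [IsManifold 𝓘(ℝ, E') ∞ N]
  [RiemannianBundle (TangentSpace 𝓘(ℝ, E') : N → Type _)]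
  [IsContMDiffRiemannianBundle 𝓘(ℝ, E') ∞ E' (TangentSpace 𝓘(ℝ, E') : N → Type _)]
  {F : M → N} {W : ∀ q, TangentSpace 𝓘(ℝ, E') (F q)} {q : M}
  {R : ∀ y : N, Submodule ℝ (TangentSpace 𝓘(ℝ, E') y)} {r : ℕ}
  {P : ∀ y : N, TangentSpace 𝓘(ℝ, E') y →L[ℝ] TangentSpace 𝓘(ℝ, E') y}
  {D₁ D₂ : ∀ q : M, Submodule ℝ (TangentSpace 𝓘(ℝ, E') (F q))} {d₁ d₂ : ℕ}

theorem tangentialPart_eq (hRF : ∀ q : M, R (F q) = rangeD (E := E) F q)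
    (w : TangentSpace 𝓘(ℝ, E') (F q)) : tangentialPart (E := E) F q w = proj R (F q) w := by
  simp only [tangentialPart, proj, hRF]

theorem normalPart_eq (hRF : ∀ q : M, R (F q) = rangeD (E := E) F q)
    (w : TangentSpace 𝓘(ℝ, E') (F q)) : normalPart (E := E) F q w = w - proj R (F q) w := by
  simp only [normalPart, proj, hRF, Submodule.starProjection_orthogonal_val]

/-- Put `H = F_*X ∈ D₁`. Then `φH = PH` and `ωH = 0`, and the first and third terms are the pairings
of `∇^F_X PH` with `BV` and `CV`. Their sum is `g(∇^F_X PH, PV) = g(P∇^F_X H, PV) = g(∇^F_X H, V)`,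
which vanishes because `R` is parallel. -/
theorem expression_eq_zero_of_parallel (hP : IsKahler P)
    (hF : IsRiemannianMap (E := E) (E' := E') F r)
    (hD : IsSemiInvariant (E := E) F P D₁ D₂ d₁ d₂)
    (hR : IsSubbundleAlong (E := E') (fun y : N => y) R r)
    (hRF : ∀ q : M, R (F q) = rangeD (E := E) F q)
    (hpar : ∀ (y : N) (v : TangentSpace 𝓘(ℝ, E') y), nablaEnd y (proj R) y v = 0)
    {X : ∀ q : M, TangentSpace 𝓘(ℝ, E) q} {V : ∀ q : M, TangentSpace 𝓘(ℝ, E') (F q)}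
    (hX : IsSectionOf (E := E) (fun q : M => q) (horizontalLift F D₁) X)
    (hV : IsSectionOf (E := E) F (fun q => (rangeD (E := E) F q)ᗮ) V) (q : M) :
    inner ℝ (mfderiv 𝓘(ℝ, E) 𝓘(ℝ, E') F q
        (nabla (fun p => adjointD (E := E) F p (tanP (E := E) F P (push F X) p)) q (X q)))
      (tanP (E := E) F P V q)
    + inner ℝ (normalNabla F (norP (E := E) F P (push F X)) q (X q)) (norP (E := E) F P V q)
    + inner ℝ (shapeOp F (norP (E := E) F P V) q (X q)) (tanP (E := E) F P (push F X) q) = 0 := by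
  have hFs := hF.smooth
  have hπ := smoothEnd_proj hR
  have hqd := self_mem_dom (E := E') (F q)
  set H : ∀ p : M, TangentSpace 𝓘(ℝ, E') (F p) := push F X
  have hH : ∀ p, H p ∈ D₁ p := fun p => (hX.2 p).2
  have hPH : ∀ p, P (F p) (H p) ∈ D₁ p := fun p => by
    have := Submodule.mem_map_of_mem (f := (P (F p)).toLinearMap) (hH p)
    rwa [hD.invariant p] at this
  have hDR : ∀ p, D₁ p ≤ R (F p) := fun p => by
    rw [hRF p, ← hD.sup_eq p]; exact le_sup_left
  have htan : ∀ W : ∀ p : M, TangentSpace 𝓘(ℝ, E') (F p), tanP (E := E) F P W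
      = fun p => proj R (F p) (P (F p) (W p)) := fun W => funext fun p => tangentialPart_eq hRF _
  have hnor : ∀ W : ∀ p : M, TangentSpace 𝓘(ℝ, E') (F p), norP (E := E) F P W
      = fun p => (ContinuousLinearMap.id ℝ (TangentSpace 𝓘(ℝ, E') (F p)) - proj R (F p)) (P (F p) (W p)) := fun W =>
    funext fun p => normalPart_eq hRF _
  have htanH : tanP (E := E) F P H = fun p => P (F p) (H p) := by
    rw [htan]; exact funext fun p => proj_eq_self (hDR p (hPH p))
  have hnorH : norP (E := E) F P H = fun p => (0 : TangentSpace 𝓘(ℝ, E') (F p)) := by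
    rw [hnor]
    exact funext fun p => sub_eq_zero.2 (proj_eq_self (hDR p (hPH p))).symm
  have dX : DiffField X q := (hX.1 q).mdifferentiableAt (by simp)
  have dH : DiffAlong (E := E) F H q := diffAlong_push hFs dX
  have dV : DiffAlong (E := E) F V q := (hV.1 q).mdifferentiableAt (by simp)
  obtain ⟨dPH, ePH⟩ := nablaAlong_end hP.smoothEnd hFs hqd dH (X q)
  rw [nablaEnd_kahler hP hqd, zero_add] at ePH
  have dPV := (nablaAlong_end hP.smoothEnd hFs hqd dV (X q)).1
  have dB := (nablaAlong_end hπ hFs hqd dPV (X q)).1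
  have dC := (nablaAlong_end (smoothEnd_id.sub hπ) hFs hqd dPV (X q)).1
  set B := tanP (E := E) F P V
  set C := norP (E := E) F P V
  rw [← htan V] at dB
  rw [← hnor V] at dC
  have hBC : ∀ p, B p + C p = P (F p) (V p) := fun p => by
    simp only [B, C, htan, hnor]
    simp
  have hBR : ∀ p, B p ∈ rangeD (E := E) F p := fun p => by
    rw [← hRF p]; simp only [B, htan]; exact proj_mem _ _
  have hCR : ∀ p, C p ∈ (R (F p))ᗮ := fun p => by
    simp only [C, hnor]; exact sub_proj_mem _ _
  have hHR : nablaAlong F H q (X q) ∈ R (F q) := by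
    have h1 := (nablaAlong_end hπ hFs hqd dH (X q)).2
    have h2 : (fun p => proj R (F p) (H p)) = H := funext fun p => proj_eq_self (hDR p (hH p))
    rw [h2, hpar, zero_apply, zero_add] at h1
    rw [h1]
    exact proj_mem _ _
  -- Horizontal lifting by the adjoint is undone by `F_*` on `range F_*`, so `PH` and `BV` are
  -- images of horizontal fields and `inner_mfderiv_nabla` applies.
  have hpushY : push F (fun p => adjointD (E := E) F p (P (F p) (H p)))
      = fun p => P (F p) (H p) :=
    funext fun p => mfderiv_adjointD hF (by rw [← hRF p]; exact hDR p (hPH p))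
  have hpushZ : push F (fun p => adjointD (E := E) F p (B p)) = B :=
    funext fun p => mfderiv_adjointD hF (hBR p)
  have hT1 := inner_mfderiv_nabla hF dX (diffField_adjointD hFs dPH) (diffField_adjointD hFs dB)
    (fun p => (hX.2 p).1) (fun p => adjointD_mem _) (fun p => adjointD_mem _)
  rw [hpushY, hpushZ] at hT1
  have hT2 : normalNabla F (fun p => (0 : TangentSpace 𝓘(ℝ, E') (F p))) q (X q) = 0 := by
    rw [normalNabla, nablaAlong_zero (hFs.mdifferentiable (by simp) q), normalPart_eq hRF]
    simp
  -- Differentiate `⟨CV, PH⟩ = 0`; the sign in the shape operator turns its term into the pairing of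
  -- `∇^F_X PH` with `CV`.
  have hT3 : inner ℝ (shapeOp F C q (X q)) (P (F q) (H q))
      = inner ℝ (nablaAlong F (fun p => P (F p) (H p)) q (X q)) (C q) := by
    have h1 := mvfderiv_inner_along hFs dC dPH (X q)
    have h2 : (fun p => inner ℝ (C p) (P (F p) (H p))) = fun _ => (0 : ℝ) := funext fun p =>
      Submodule.inner_left_of_mem_orthogonal (hDR p (hPH p)) (hCR p)
    rw [h2, mvfderiv_const] at h1
    have h3 : (0 : ℝ) = inner ℝ (nablaAlong F C q (X q)) (P (F q) (H q))
      + inner ℝ (C q) (nablaAlong F (fun p => P (F p) (H p)) q (X q)) := h1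
    rw [shapeOp, tangentialPart_eq hRF, inner_neg_left, inner_proj_left,
      proj_eq_self (hDR q (hPH q)), real_inner_comm (C q)]
    linarith
  rw [htanH, hnorH, hT1, hT2, inner_zero_left, hT3, add_zero, ← inner_add_right, hBC, ePH,
    hP.inner_eq]
  exact Submodule.inner_right_of_mem_orthogonal (K := R (F q)) hHR (by rw [hRF q]; exact hV.2 q)

end InvariantDirections

end Clairaut

end

theorem mainTheorem5
    {E E' : Type*}
    [NormedAddCommGroup E] [NormedSpace ℝ E] [FiniteDimensional ℝ E]
    [NormedAddCommGroup E'] [NormedSpace ℝ E'] [FiniteDimensional ℝ E']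
    -- the Riemannian manifold `(M, g_M)`
    {M : Type*} [TopologicalSpace M] [T2Space M] [SigmaCompactSpace M] [Nonempty M]
    [ChartedSpace E M] [IsManifold 𝓘(ℝ, E) ∞ M]
    [RiemannianBundle (TangentSpace 𝓘(ℝ, E) : M → Type _)]
    [IsContMDiffRiemannianBundle 𝓘(ℝ, E) ∞ E (TangentSpace 𝓘(ℝ, E) : M → Type _)]
    -- the Kähler manifold `(N, g_N, P)`
    {N : Type*} [TopologicalSpace N] [T2Space N] [SigmaCompactSpace N] [ConnectedSpace N]
    [ChartedSpace E' N] [IsManifold 𝓘(ℝ, E') ∞ N]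
    [RiemannianBundle (TangentSpace 𝓘(ℝ, E') : N → Type _)]
    [IsContMDiffRiemannianBundle 𝓘(ℝ, E') ∞ E' (TangentSpace 𝓘(ℝ, E') : N → Type _)]
    (P : ∀ y : N, TangentSpace 𝓘(ℝ, E') y →L[ℝ] TangentSpace 𝓘(ℝ, E') y)
    (hP : Clairaut.IsKahler P)
    -- the semi-invariant Riemannian map `F`
    (F : M → N) (r : ℕ) (hF : Clairaut.IsRiemannianMap (E := E) (E' := E') F r)
    (D₁ D₂ : ∀ q : M, Submodule ℝ (TangentSpace 𝓘(ℝ, E') (F q))) (d₁ d₂ : ℕ)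
    (hD : Clairaut.IsSemiInvariant (E := E) F P D₁ D₂ d₁ d₂)
    (hd₁ : 0 < d₁) (hd₂ : 1 < d₂)
    -- the foliation `R` of `N` that extends `range F_*`, with `Rᗮ` a totally geodesic foliation
    (R : ∀ y : N, Submodule ℝ (TangentSpace 𝓘(ℝ, E') y))
    (hR : Clairaut.IsSubbundleAlong (E := E') (fun y : N => y) R r)
    (hRinv : Clairaut.IsInvolutive R)
    (hRF : ∀ q : M, R (F q) = Clairaut.rangeD (E := E) F q)
    (hRperp : Clairaut.IsTotallyGeodesicFoliation fun y : N => (R y)ᗮ)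
    -- the Clairaut condition with `s = e^f`
    (f : N → ℝ) (hf : ContMDiff 𝓘(ℝ, E') 𝓘(ℝ, ℝ) ∞ f)
    (hCl : Clairaut.IsClairaut R f) :
    Clairaut.IsLocallyProduct R ↔
      ∀ (X : ∀ q : M, TangentSpace 𝓘(ℝ, E) q) (V : ∀ q : M, TangentSpace 𝓘(ℝ, E') (F q)),
        Clairaut.IsSectionOf (E := E) (fun q : M => q) (Clairaut.horizontalLift F D₁) X →
        Clairaut.IsSectionOf (E := E) F (fun q => (Clairaut.rangeD (E := E) F q)ᗮ) V →
        ∀ q : M,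
          -- `g_N(F_*(∇^M_X *F_* φ F_* X), B V)`
          inner ℝ (mfderiv 𝓘(ℝ, E) 𝓘(ℝ, E') F q
              (Clairaut.nabla (fun p => Clairaut.adjointD (E := E) F p
                (Clairaut.tanP (E := E) F P (Clairaut.push F X) p)) q (X q)))
            (Clairaut.tanP (E := E) F P V q)
          -- `g_N(∇^{F⊥}_X ω F_* X, C V)`
          + inner ℝ (Clairaut.normalNabla F (Clairaut.norP (E := E) F P (Clairaut.push F X)) q (X q))
            (Clairaut.norP (E := E) F P V q)
          -- `g_N(S_{C V} F_* X, φ F_* X)`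
          + inner ℝ (Clairaut.shapeOp F (Clairaut.norP (E := E) F P V) q (X q))
            (Clairaut.tanP (E := E) F P (Clairaut.push F X) q) = 0 := by
  have h : Clairaut.IsClairautFoliation R r f := ⟨hR, hRinv, hRperp, hf, hCl⟩
  have hdf := Clairaut.mvfderiv_eq_zero h hP hF hD hd₁ hd₂ hRF
  refine ⟨fun _ X V hX hV q => ?_, fun _ => Clairaut.isLocallyProduct hRinv h hdf⟩
  exact Clairaut.expression_eq_zero_of_parallel hP hF hD hR hRF
    (fun y v => Clairaut.nablaEnd_proj_eq_zero h hdf (Clairaut.self_mem_dom y) v) hX hV q
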